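/- Fix $\gamma,Q,S_{\mathrm{ph}},b>0$, $g_D\in\mathbb R$, and put $S_{\mathrm{at}}=g_D^2Q/(2\gamma^2)$. For a Larmor frequency $\omega_L\in\mathbb R$ and a sampling period $\Delta>0$, let $\hat T_{n}$ be the $n\times n$ Toeplitz matrix with entries $$T_{i,j}=K_{i-j},\qquad K_k=g_D^2\tfrac{Q}{2\gamma}e^{-\gamma|k|\Delta}\cos(k\omega_L\Delta)+\delta_{k,0}\tfrac{S_{\mathrm{ph}}}{\Delta},$$ and let $$\bar S(\omega)=S_{\mathrm{at}}\Big(\tfrac{\gamma^2}{\gamma^2+(\omega-\omega_L)^2}+\tfrac{\gamma^2}{\gamma^2+(\omega+\omega_L)^2}\Big)+S_{\mathrm{ph}}.$$ Two hypotheses $h=0,1$ differ only in the Larmor frequency $\omega_h$; write $\hat T_{h,n}$, $\bar S_h$ accordingly. Under $h$ the data $I=(I_1,\dots,I_n)$ has law $\mathcal N(0,\hat T_{h,n})$, with density $p_h$; let $L_I=\log\big(p_1(I)/p_0(I)\big)$. The high-pass filter turns $I$ into $R=(R_1,\dots,R_n)$ with $R_k=\alpha R_{k-1}+\sqrt\alpha\,(I_k-I_{k-1})$,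 $R_0=I_0=0$, $\alpha=e^{-b\Delta}$, i.e. $R=\hat BI$ with $\hat B$ lower triangular, $B_{ii}=\sqrt\alpha$ and $B_{ij}=\sqrt\alpha(\alpha-1)\alpha^{i-j-1}$ for $i>j$. Let $L_R=\log\big(p_1(R)/p_0(R)\big)$, $\epsilon_n=L_I-L_R$, $\hat D=\hat T_{0,n}^{-1}-\hat T_{1,n}^{-1}$, $\hat M=\hat D-\hat B^T\hat D\hat B$ and $t=n\Delta$. (1) For all $\Delta>0$, $n$, $h$ one has $\epsilon_n=\frac12 I^T\hat MI$; under $h$ the moment generating function of $\epsilon_n$ is finite near $0$, and for every $m\ge1$ the $m$-th cumulant of $\epsilon_n$ is $\tilde\kappa^h_{m,n}=\frac{(m-1)!}{2}\mathrm{Tr}\big((\hat M\hat T_{h,n})^m\big)$. (2) For all $\omega_0,\omega_1,h$ and $m\ge1$ the integral below converges absolutely, and for every $\Delta_0>0$ there is a constant $C$ such that for all $0<\Delta\le\Delta_0$ and all $n$ $$\left|\tilde\kappa^h_{m,n}-\frac{t\,(m-1)!}{2\pi}\int_0^\infty\Big(\frac{b^2}{\omega^2+b^2}\Big(\frac{\bar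 S_h(\omega)}{\bar S_0(\omega)}-\frac{\bar S_h(\omega)}{\bar S_1(\omega)}\Big)\Big)^m d\omega\right|\le C\,(1+t\Delta),$$ that is, the error is $\mathcal O(1)+t\,\mathcal O(\Delta)$. (3) Let $L_S=\frac{t}{2\pi}\int_0^\infty\big[\log\frac{\bar S_0}{\bar S_1}+\big(\frac1{\bar S_0}-\frac1{\bar S_1}\big)S_I(\omega)\big]d\omega$ be the frequency-domain log-likelihood ratio in the continuum limit, in which under $h$ the powers $S_I(\omega)$ are independent (one per frequency cell of width $2\pi/t$) and exponentially distributed with mean $\bar S_h(\omega)$. So its mean and variance are $\frac{t}{2\pi}\int_0^\infty$ of the mean and of the variance of $\log\frac{\bar S_0}{\bar S_1}+\big(\frac1{\bar S_0}-\frac1{\bar S_1}\big)S_I(\omega)$; both integrals converge absolutely. Let $\omega_h=\omega_c+(-1)^h\frac{\delta}{2}$ with $\delta\in\mathbb R$ fixed. For every $\Delta_0>0$ there are constants $C$ and $\Omega>0$ such that for every $\omega_c\ge\Omega$ there is a constant $K$ (which may depend on $\omega_c$) such that for all $0<\Delta\le\Delta_0$, all $n$ and $h=0,1$ $$\Big|\mathbb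 E_h[\epsilon_n]-\frac{b^2}{\omega_c^2}\mathbb E_h[L_S]\Big|\le C\Big(\frac{t}{\omega_c^3}+1\Big)+K\,t\Delta,\qquad \Big|\mathrm{Var}_h(\epsilon_n)-\frac{b^4}{\omega_c^4}\mathrm{Var}_h(L_S)\Big|\le C\Big(\frac{t}{\omega_c^5}+1\Big)+K\,t\Delta .$$ -/

import Mathlib

open MeasureTheory ProbabilityTheory Set

noncomputable section

namespace SpinNoise

/-- The sensor parameters shared by the two hypotheses: relaxation rate `γ`, transduction
constant `gD`, Wiener noise strength `Q`, photon shot-noise spectral density `Sph`. -/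
structure Sensor where
  γ : ℝ
  gD : ℝ
  Q : ℝ
  Sph : ℝ

/-- Stationary autocovariance (at lag `k`) of the photocurrent sampled with period `Δ`, for the
Larmor frequency `ωL`. -/
def autocov (s : Sensor) (ωL Δ : ℝ) (k : ℤ) : ℝ :=
  s.gD ^ 2 * (s.Q / (2 * s.γ)) * Real.exp (-s.γ * |(k : ℝ)| * Δ) * Real.cos (k * ωL * Δ)
    + if k = 0 then s.Sph / Δ else 0

/-- The `n × n` Toeplitz covariance matrix of `n` consecutive samples. -/
def covMat (s : Sensor) (ωL Δ : ℝ) (n : ℕ) : Matrix (Fin n) (Fin n) ℝ :=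
  Matrix.of fun i j => autocov s ωL Δ ((i : ℤ) - (j : ℤ))

/-- The steady-state law of the data vector of `n` samples: centred Gaussian. -/
def signalLaw (s : Sensor) (ωL Δ : ℝ) (n : ℕ) : Measure (EuclideanSpace ℝ (Fin n)) :=
  multivariateGaussian 0 (covMat s ωL Δ n)

/-- The centred Gaussian probability density with covariance matrix `T`. -/
def gaussDensity {n : ℕ} (T : Matrix (Fin n) (Fin n) ℝ) (x : EuclideanSpace ℝ (Fin n)) : ℝ :=
  Real.exp (-(1 / 2) * (x.ofLp ⬝ᵥ (T⁻¹).mulVec x.ofLp)) / Real.sqrt ((2 * Real.pi) ^ n * T.det)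

/-- The log-likelihood ratio `log (p₁ / p₀)`, as a function of the data; `ωL h` is the Larmor
frequency under hypothesis `h`. -/
def llr (s : Sensor) (ωL : Fin 2 → ℝ) (Δ : ℝ) {n : ℕ} (x : EuclideanSpace ℝ (Fin n)) : ℝ :=
  Real.log (gaussDensity (covMat s (ωL 1) Δ n) x / gaussDensity (covMat s (ωL 0) Δ n) x)

/-- The high-pass filter `R k = α R (k-1) + √α (u k - u (k-1))`, started from rest
(input and output vanish before the first sample, which has index `0` here). -/
def highPass (α : ℝ) (u : ℕ → ℝ) : ℕ → ℝ
  | 0 => Real.sqrt α * u 0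
  | k + 1 => α * highPass α u k + Real.sqrt α * (u (k + 1) - u k)

/-- The filtered data vector. -/
def filtered (α : ℝ) {n : ℕ} (x : EuclideanSpace ℝ (Fin n)) : EuclideanSpace ℝ (Fin n) :=
  WithLp.toLp 2 fun i : Fin n => highPass α (fun k => if hk : k < n then x ⟨k, hk⟩ else 0) i

/-- The (lower triangular, Toeplitz) matrix of the filter. -/
def filterMat (α : ℝ) (n : ℕ) : Matrix (Fin n) (Fin n) ℝ :=
  Matrix.of fun i j =>
    if i = j then Real.sqrt α
    else if j < i then Real.sqrt α * (α - 1) * α ^ ((i : ℕ) - (j : ℕ) - 1)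
    else 0

/-- The filter strength `α = exp (-b Δ)`. -/
def strength (b Δ : ℝ) : ℝ := Real.exp (-b * Δ)

/-- The error `ε = L_I - L_R` caused by evaluating the log-likelihood ratio on filtered data. -/
def filterError (s : Sensor) (ωL : Fin 2 → ℝ) (b Δ : ℝ) {n : ℕ}
    (x : EuclideanSpace ℝ (Fin n)) : ℝ :=
  llr s ωL Δ x - llr s ωL Δ (filtered (strength b Δ) x)

/-- `D = T₀⁻¹ - T₁⁻¹`. -/
def llrMat (s : Sensor) (ωL : Fin 2 → ℝ) (Δ : ℝ) (n : ℕ) : Matrix (Fin n) (Fin n) ℝ :=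
  (covMat s (ωL 0) Δ n)⁻¹ - (covMat s (ωL 1) Δ n)⁻¹

/-- `M = D - Bᵀ D B`. -/
def errorMat (s : Sensor) (ωL : Fin 2 → ℝ) (b Δ : ℝ) (n : ℕ) : Matrix (Fin n) (Fin n) ℝ :=
  llrMat s ωL Δ n
    - (filterMat (strength b Δ) n).transpose * llrMat s ωL Δ n * filterMat (strength b Δ) n

/-- The `m`-th cumulant of `X` under `μ`: the `m`-th derivative at `0` of `log E[exp (u X)]`. -/
def cumulant {Ω : Type*} [MeasurableSpace Ω] (m : ℕ) (X : Ω → ℝ) (μ : Measure Ω) : ℝ :=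
  iteratedDeriv m (cgf X μ) 0

/-- The mean power spectral density of the signal (continuous-time limit). -/
def psd (s : Sensor) (ωL ω : ℝ) : ℝ :=
  s.gD ^ 2 * s.Q / (2 * s.γ ^ 2)
      * (s.γ ^ 2 / (s.γ ^ 2 + (ω - ωL) ^ 2) + s.γ ^ 2 / (s.γ ^ 2 + (ω + ωL) ^ 2))
    + s.Sph

/-- The integrand of the `m`-th cumulant of the error under hypothesis `h`. -/
def errorIntegrand (s : Sensor) (ωL : Fin 2 → ℝ) (b : ℝ) (h : Fin 2) (m : ℕ) (ω : ℝ) : ℝ :=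
  (b ^ 2 / (ω ^ 2 + b ^ 2)
    * (psd s (ωL h) ω / psd s (ωL 0) ω - psd s (ωL h) ω / psd s (ωL 1) ω)) ^ m

/-- Asymptotic law of the spectral power `S_I(ω)` under hypothesis `h`: exponential with mean
the mean power spectral density. -/
def powerLaw (s : Sensor) (ωL : Fin 2 → ℝ) (h : Fin 2) (ω : ℝ) : Measure ℝ :=
  expMeasure (psd s (ωL h) ω)⁻¹

/-- The contribution of the frequency `ω` to the frequency-domain log-likelihood ratio
`L_S = t/(2π) ∫₀^∞ [log (S̄₀/S̄₁) + (1/S̄₀ - 1/S̄₁) S_I] dω`, when `S_I(ω) = x`. -/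
def spectralLLR (s : Sensor) (ωL : Fin 2 → ℝ) (ω x : ℝ) : ℝ :=
  Real.log (psd s (ωL 0) ω / psd s (ωL 1) ω)
    + (1 / psd s (ωL 0) ω - 1 / psd s (ωL 1) ω) * x

/-- Mean of the contribution of the frequency `ω` under hypothesis `h`. -/
def spectralMean (s : Sensor) (ωL : Fin 2 → ℝ) (h : Fin 2) (ω : ℝ) : ℝ :=
  ∫ x, spectralLLR s ωL ω x ∂(powerLaw s ωL h ω)

/-- Variance of the contribution of the frequency `ω` under hypothesis `h`. -/
def spectralVar (s : Sensor) (ωL : Fin 2 → ℝ) (h : Fin 2) (ω : ℝ) : ℝ :=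
  variance (spectralLLR s ωL ω) (powerLaw s ωL h ω)

/-- `E_h[L_S]` over a time `t`: the frequencies have density `t/(2π) dω`, i.e. one
per cell of width `2π/t`. -/
def meanLS (s : Sensor) (ωL : Fin 2 → ℝ) (h : Fin 2) (t : ℝ) : ℝ :=
  t / (2 * Real.pi) * ∫ ω in Ioi (0 : ℝ), spectralMean s ωL h ω

/-- `Var_h(L_S)` over a time `t`: different frequencies are independent, so the
variances of the cells add up. -/
def varLS (s : Sensor) (ωL : Fin 2 → ℝ) (h : Fin 2) (t : ℝ) : ℝ :=
  t / (2 * Real.pi) * ∫ ω in Ioi (0 : ℝ), spectralVar s ωL h ω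

/-- Larmor frequencies `ω_c + (-1)^h δ/2` centred at `ω_c = (ω₀ + ω₁)/2`. -/
def centred (ωc δ : ℝ) (h : Fin 2) : ℝ := ωc + (-1) ^ (h : ℕ) * (δ / 2)

end SpinNoise

end

/-! ### Quadratic forms of Gaussian vectors -/

namespace SpinNoise

open Matrix

/-! Cumulants as traces. The normalising determinants of the likelihood ratios cancel in the
difference (`llr_sub_llr`), so the error is a quadratic form in a centred Gaussian vector. Writing
that vector as the square root of its covariance applied to white noise and diagonalising turns the
form into a weighted sum of independent squares. Its cumulants are then power sums of eigenvalues,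
that is, traces of powers of `M T_h` (`cumulant_quadraticForm`).

Traces as integrals. `M T_h` is a polynomial in Toeplitz matrices and inverses of Toeplitz matrices.
Scaled by `Δ / Sph`, the covariance has a symbol `1 + phi ≥ 1`, so its inverse has norm at most 1.
Replacing a product of Toeplitz matrices by the Toeplitz matrix of the product symbol costs a
trace-norm error controlled by the `energy` of the symbols (`norm_trace_mul_toep_defect_le`). This
energy is a double integral of squared increments (`two_mul_energy`). It is bounded uniformly in
`n`, in `Δ ≤ Δ₀` and in the Larmor frequencies: the poles approach the unit circle as `Δ → 0`, but
their amplitudes vanish at the same rate. Hence the trace of the `m`-th power is `n` times the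
circle mean of the `m`-th power of the product symbol, up to a bounded error (`exists_trace_bound`).

From samples to continuous time. The filter enters that symbol through `1 - |B|²`, a sampled form of
`b² / (ω² + b²)`. Under `x = ω Δ` the circle mean is `Δ / π` times a half-line integral cut off at
the Nyquist frequency, and this integral is within `O(Δ)` of the continuous one
(`exists_integral_bound`). Multiplied by `n Δ`, this is the error `t O(Δ)`. Only this step depends
on the Larmor frequencies.

Large central frequency. For nearby Larmor frequencies the spectral ratio is concentrated at `ω_c`
with cubic decay, while the filter weight deviates from `b² / ω_c²` by a multiple of `(1 + |ω -
ω_c|) / ω_c³` there. One power of decay pays for the deviation (`exists_integral_centred_bound`).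
The variance of an exponential law is the square of its mean, so the variance of `L_S` matches
directly. The mean contains in addition the integral of `log (S̄₀ / S̄₁)`, which is small because
that integral would be translation invariant but for the interaction of each peak with its mirror
image (`exists_integral_log_bound`). -/

lemma trace_pow_eq_sum_eigenvalues {ι : Type*} [Fintype ι] [DecidableEq ι] {N : Matrix ι ι ℝ}
    (hN : N.IsHermitian) (m : ℕ) : (N ^ m).trace = ∑ i, hN.eigenvalues i ^ m := by
  conv_lhs => rw [hN.spectral_theorem, ← map_pow, Unitary.conjStarAlgAut_apply, trace_mul_cycle]
  simp [Matrix.diagonal_pow, Matrix.trace]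

lemma inner_mulVec_eq_sum_eigenvalues {ι : Type*} [Fintype ι] [DecidableEq ι] {N : Matrix ι ι ℝ}
    (hN : N.IsHermitian) (x : ι → ℝ) :
    (∑ i, x i • hN.eigenvectorBasis i).ofLp ⬝ᵥ N *ᵥ (∑ i, x i • hN.eigenvectorBasis i).ofLp
      = ∑ i, hN.eigenvalues i * x i ^ 2 := by
  have h1 : N *ᵥ (∑ i, x i • hN.eigenvectorBasis i).ofLp
      = (∑ i, (hN.eigenvalues i * x i) • hN.eigenvectorBasis i).ofLp := by
    simp only [WithLp.ofLp_sum, WithLp.ofLp_smul, Matrix.mulVec_sum, Matrix.mulVec_smul,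
      hN.mulVec_eigenvectorBasis, smul_smul]
    exact Finset.sum_congr rfl fun i _ => by rw [mul_comm]
  have h2 := hN.eigenvectorBasis.orthonormal.inner_sum (fun i => hN.eigenvalues i * x i) x
    Finset.univ
  rw [h1, dotProduct_comm]
  have h3 : ∀ u v : EuclideanSpace ℝ ι, u.ofLp ⬝ᵥ v.ofLp = inner ℝ u v := fun u v => by
    rw [EuclideanSpace.inner_eq_star_dotProduct, star_trivial, dotProduct_comm]
  rw [h3, h2]
  exact Finset.sum_congr rfl fun i _ => by simp; ring

/-- The exponential moment of half a squared standard Gaussian variable. -/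
lemma integral_exp_sq_gaussianReal {a : ℝ} (ha : a < 1) :
    Integrable (fun x : ℝ => Real.exp (a * (x ^ 2 / 2))) (gaussianReal 0 1) ∧
      ∫ x : ℝ, Real.exp (a * (x ^ 2 / 2)) ∂(gaussianReal 0 1) = (√(1 - a))⁻¹ := by
  have key : ∀ x : ℝ, gaussianPDFReal 0 1 x * Real.exp (a * (x ^ 2 / 2))
      = (√(2 * Real.pi))⁻¹ * Real.exp (-((1 - a) / 2) * x ^ 2) := by
    intro x
    rw [gaussianPDFReal, mul_assoc, ← Real.exp_add]
    simp only [NNReal.coe_one, mul_one, sub_zero]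
    congr 2
    ring
  have hb : 0 < (1 - a) / 2 := by linarith
  constructor
  · rw [gaussianReal_of_var_ne_zero _ one_ne_zero, gaussianPDF_def,
      integrable_withDensity_iff_integrable_smul₀' (by fun_prop) (by simp)]
    refine (((integrable_exp_neg_mul_sq hb).const_mul (√(2 * Real.pi))⁻¹)).congr
      (ae_of_all _ fun x => ?_)
    beta_reduce
    rw [← key, ENNReal.toReal_ofReal (gaussianPDFReal_nonneg _ _ _), smul_eq_mul]
  · rw [integral_gaussianReal_eq_integral_smul one_ne_zero]
    simp_rw [smul_eq_mul, key, integral_const_mul, integral_gaussian]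
    rw [← Real.sqrt_inv, ← Real.sqrt_inv, ← Real.sqrt_mul (by positivity)]
    congr 1
    have := Real.pi_pos
    have : 1 - a ≠ 0 := by linarith
    field_simp

/-- The function is the cumulant generating function of `l / 2` times a squared standard Gaussian.
The formula is stated on a neighbourhood of `0`, not only at `0`, so that the induction can
differentiate it. -/
lemma iteratedDeriv_neg_half_log {l : ℝ} (m : ℕ) :
    ∀ᶠ u in nhds (0 : ℝ), iteratedDeriv (m + 1) (fun u => -(1 / 2) * Real.log (1 - u * l)) u
      = (m.factorial : ℝ) / 2 * l ^ (m + 1) / (1 - u * l) ^ (m + 1) := by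
  have hpos : ∀ᶠ u in nhds (0 : ℝ), 0 < 1 - u * l := by
    have : ContinuousAt (fun u : ℝ => 1 - u * l) 0 := by fun_prop
    exact this.eventually (lt_mem_nhds (by simp))
  have hd : ∀ u : ℝ, HasDerivAt (fun u : ℝ => 1 - u * l) (-l) u := fun u => by
    simpa using ((hasDerivAt_id u).mul_const l).const_sub 1
  induction m with
  | zero =>
    filter_upwards [hpos] with u hu
    rw [zero_add, iteratedDeriv_one]
    rw [(((hd u).log hu.ne').const_mul (-(1 / 2))).deriv]
    simp
    ring
  | succ m ih =>
    filter_upwards [hpos, ih.eventually_nhds] with u hu hev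
    rw [iteratedDeriv_succ, Filter.EventuallyEq.deriv_eq (f₁ := iteratedDeriv (m + 1) _)
      (f := fun u : ℝ => (m.factorial : ℝ) / 2 * l ^ (m + 1) / (1 - u * l) ^ (m + 1)) hev]
    have h1 := (((hd u).pow (m + 1)).inv (pow_ne_zero _ hu.ne')).const_mul
      ((m.factorial : ℝ) / 2 * l ^ (m + 1))
    have h2 : (fun u : ℝ => (m.factorial : ℝ) / 2 * l ^ (m + 1) / (1 - u * l) ^ (m + 1))
      = fun u => (m.factorial : ℝ) / 2 * l ^ (m + 1) * ((fun u : ℝ => 1 - u * l) ^ (m + 1))⁻¹ u :=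
        by
      ext u; simp [div_eq_mul_inv]
    rw [h2, h1.deriv]
    simp only [Nat.factorial_succ, Pi.pow_apply, Nat.add_sub_cancel]
    push_cast
    field_simp
    ring

/-- Exponential moments of a weighted sum of squares of independent standard Gaussians. -/
lemma mgf_sum_sq_gaussian {ι : Type*} [Fintype ι] (l : ι → ℝ) {u : ℝ}
    (hu : ∀ i, u * l i < 1) :
    Integrable (fun x : ι → ℝ => Real.exp (u * (1 / 2 * ∑ i, l i * x i ^ 2)))
        (Measure.pi fun _ : ι => gaussianReal 0 1) ∧
      ∫ x : ι → ℝ, Real.exp (u * (1 / 2 * ∑ i, l i * x i ^ 2))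
        ∂(Measure.pi fun _ : ι => gaussianReal 0 1) = ∏ i, (√(1 - u * l i))⁻¹ := by
  have h : (fun x : ι → ℝ => Real.exp (u * (1 / 2 * ∑ i, l i * x i ^ 2)))
      = fun x => ∏ i, Real.exp (u * l i * (x i ^ 2 / 2)) := by
    ext x
    rw [← Real.exp_sum]
    congr 1
    rw [Finset.mul_sum, Finset.mul_sum]
    exact Finset.sum_congr rfl fun i _ => by ring
  rw [h]
  refine ⟨Integrable.fintype_prod fun i => (integral_exp_sq_gaussianReal (hu i)).1, ?_⟩
  rw [integral_fintype_prod_eq_prod (f := fun i (y : ℝ) => Real.exp (u * l i * (y ^ 2 / 2)))]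
  exact Finset.prod_congr rfl fun i _ => (integral_exp_sq_gaussianReal (hu i)).2

section QuadraticForm

variable {n : ℕ} {T M : Matrix (Fin n) (Fin n) ℝ}

open scoped MatrixOrder in
/-- A quadratic form of a centred Gaussian vector is a weighted sum of squares of independent
standard Gaussians; the power sums of the weights are traces. -/
lemma exists_diagonalization (hT : T.PosSemidef) (hM : M.IsHermitian) :
    ∃ l : Fin n → ℝ, (∀ m : ℕ, 1 ≤ m → ((M * T) ^ m).trace = ∑ i, l i ^ m) ∧
      ∃ g : (Fin n → ℝ) → EuclideanSpace ℝ (Fin n), Measurable g ∧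
        multivariateGaussian 0 T = (Measure.pi fun _ : Fin n => gaussianReal 0 1).map g ∧
        ∀ x, (g x).ofLp ⬝ᵥ M *ᵥ (g x).ofLp = ∑ i, l i * x i ^ 2 := by
  -- The Gaussian vector is `S` applied to white noise, and white noise is expanded in an eigenbasis
  -- of `S M S`, which is symmetric although `M T` need not be.
  set S := CFC.sqrt T with hS
  have hSS : S * S = T := CFC.sqrt_mul_sqrt_self T hT.nonneg
  have hSh : S.IsHermitian := (CFC.sqrt_nonneg T).isSelfAdjoint
  have hSt : Sᵀ = S := by simpa [Matrix.IsHermitian] using hSh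
  have hN : (S * M * S).IsHermitian := by
    have := Matrix.isHermitian_conjTranspose_mul_mul S hM
    rwa [hSh.eq] at this
  refine ⟨hN.eigenvalues, fun m hm => ?_, fun x => toEuclideanCLM (𝕜 := ℝ) S
    (∑ i, x i • hN.eigenvectorBasis i), by fun_prop, ?_, fun x => ?_⟩
  · rw [← trace_pow_eq_sum_eigenvalues hN, ← hSS]
    obtain ⟨k, rfl⟩ : ∃ k, m = k + 1 := ⟨m - 1, by omega⟩
    -- `M S S` and `S M S` are the two orders of the product of `M S` and `S`; sliding `M S` through
    -- a power and using cyclicity equates the traces.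
    have : ∀ k, (M * (S * S)) ^ k * M * S = M * S * (S * M * S) ^ k := by
      intro k
      induction k with
      | zero => simp
      | succ k ih =>
        rw [pow_succ', pow_succ', Matrix.mul_assoc, Matrix.mul_assoc, ← Matrix.mul_assoc _ M S, ih]
        simp only [Matrix.mul_assoc]
    rw [pow_succ, ← Matrix.mul_assoc, ← Matrix.mul_assoc, this, Matrix.trace_mul_comm,
      ← Matrix.mul_assoc, ← Matrix.mul_assoc, ← pow_succ']
  · rw [multivariateGaussian, stdGaussian_eq_map_pi_orthonormalBasis hN.eigenvectorBasis,
      Measure.map_map (by fun_prop) (by fun_prop)]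
    congr 1
    ext x : 1
    simp [hS]
  · rw [← inner_mulVec_eq_sum_eigenvalues hN, ofLp_toEuclideanCLM]
    simp only [← Matrix.mulVec_mulVec]
    rw [← Matrix.vecMul_transpose, hSt, ← Matrix.dotProduct_mulVec]

/-- Exponential moments and cumulants of a quadratic form of a centred Gaussian vector. -/
lemma cumulant_quadraticForm (hT : T.PosSemidef) (hM : M.IsHermitian)
    {X : EuclideanSpace ℝ (Fin n) → ℝ} (hX : ∀ x, X x = 1 / 2 * (x.ofLp ⬝ᵥ M *ᵥ x.ofLp)) :
    0 ∈ interior (integrableExpSet X (multivariateGaussian 0 T)) ∧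
      ∀ m : ℕ, 1 ≤ m → cumulant m X (multivariateGaussian 0 T)
        = ((m - 1).factorial : ℝ) / 2 * ((M * T) ^ m).trace := by
  obtain ⟨l, hl, g, hg, hmap, hgl⟩ := exists_diagonalization hT hM
  have hXm : Continuous X := by
    have : X = fun x => 1 / 2 * (x.ofLp ⬝ᵥ M *ᵥ x.ofLp) := funext hX
    rw [this]
    fun_prop
  have hpos : ∀ᶠ u in nhds (0 : ℝ), ∀ i, u * l i < 1 := by
    refine Filter.eventually_all.2 fun i => ?_
    have : ContinuousAt (fun u : ℝ => u * l i) 0 := by fun_prop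
    exact this.eventually (gt_mem_nhds (by simp))
  have hXg : ∀ u, (fun x => Real.exp (u * X (g x)))
      = fun x => Real.exp (u * (1 / 2 * ∑ i, l i * x i ^ 2)) := fun u => by
    ext x; rw [hX, hgl]
  have hint : ∀ᶠ u in nhds (0 : ℝ), u ∈ integrableExpSet X (multivariateGaussian 0 T) := by
    filter_upwards [hpos] with u hu
    rw [integrableExpSet, mem_ofPred_eq, hmap, integrable_map_measure (by fun_prop) (by fun_prop)]
    have := (mgf_sum_sq_gaussian l hu).1
    rwa [← hXg] at this
  have hcgf : ∀ᶠ u in nhds (0 : ℝ), cgf X (multivariateGaussian 0 T) u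
      = ∑ i, -(1 / 2) * Real.log (1 - u * l i) := by
    filter_upwards [hpos] with u hu
    rw [cgf, mgf, hmap, integral_map (by fun_prop) (by fun_prop), hXg,
      (mgf_sum_sq_gaussian l hu).2, Real.log_prod (fun i _ => ?_)]
    · refine Finset.sum_congr rfl fun i _ => ?_
      rw [Real.log_inv, Real.log_sqrt (by linarith [hu i])]
      ring
    · have : 0 < 1 - u * l i := by linarith [hu i]
      positivity
  refine ⟨mem_interior_iff_mem_nhds.2 hint, fun m hm => ?_⟩
  obtain ⟨k, rfl⟩ : ∃ k, m = k + 1 := ⟨m - 1, by omega⟩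
  rw [cumulant, Filter.EventuallyEq.iteratedDeriv_eq _ hcgf]
  have hs : (fun u : ℝ => ∑ i, -(1 / 2) * Real.log (1 - u * l i))
      = fun u => ∑ i, (fun i (u : ℝ) => -(1 / 2) * Real.log (1 - u * l i)) i u := rfl
  rw [hs, iteratedDeriv_fun_sum]
  · rw [hl _ hm, Finset.mul_sum]
    refine Finset.sum_congr rfl fun i _ => ?_
    rw [(iteratedDeriv_neg_half_log k).self_of_nhds]
    simp
  · intro i _
    refine contDiffAt_const.mul (ContDiffAt.log (by fun_prop) (by simp))

end QuadraticForm

end SpinNoise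

noncomputable section

namespace SpinNoise

open Matrix ComplexConjugate

/-! ### Toeplitz matrices and their symbols -/

/-- The uniform probability measure on `(-π, π]`. -/
def circ : Measure ℝ := ENNReal.ofReal (2 * Real.pi)⁻¹ • volume.restrict (Ioc (-Real.pi) Real.pi)

instance : IsProbabilityMeasure circ := ⟨by
  rw [circ, Measure.smul_apply, Measure.restrict_apply_univ, Real.volume_Ioc, smul_eq_mul,
    ← ENNReal.ofReal_mul (by positivity)]
  have := Real.pi_pos
  rw [show (2 * Real.pi)⁻¹ * (Real.pi - -Real.pi) = 1 by field_simp; ring, ENNReal.ofReal_one]⟩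

lemma integral_circ {E : Type*} [NormedAddCommGroup E] [NormedSpace ℝ E] (f : ℝ → E) :
    ∫ x, f x ∂circ = (2 * Real.pi)⁻¹ • ∫ x in (-Real.pi)..Real.pi, f x := by
  rw [circ, integral_smul_measure, intervalIntegral.integral_of_le (by linarith [Real.pi_pos]),
    ENNReal.toReal_ofReal (by positivity)]

/-- The characters of the circle. -/
def ex (k : ℤ) (x : ℝ) : ℂ := Complex.exp (k * x * Complex.I)

lemma ex_add (j k : ℤ) (x : ℝ) : ex (j + k) x = ex j x * ex k x := by
  rw [ex, ex, ex, ← Complex.exp_add]; push_cast; ring_nf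

lemma ex_zero (x : ℝ) : ex 0 x = 1 := by simp [ex]

lemma norm_ex (k : ℤ) (x : ℝ) : ‖ex k x‖ = 1 := by
  rw [ex, show ((k : ℂ) * x * Complex.I) = ((k * x : ℝ) : ℂ) * Complex.I by push_cast; rfl]
  exact Complex.norm_exp_ofReal_mul_I _

lemma conj_ex (k : ℤ) (x : ℝ) : conj (ex k x) = ex (-k) x := by
  simp [ex, ← Complex.exp_conj]

lemma ex_natCast (k : ℕ) (x : ℝ) : ex k x = ex 1 x ^ k := by
  rw [ex, ex, ← Complex.exp_nat_mul]; push_cast; ring_nf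

@[fun_prop]
lemma continuous_ex (k : ℤ) : Continuous (ex k) := by unfold ex; fun_prop

@[fun_prop]
lemma measurable_ex (k : ℤ) : Measurable (ex k) := (continuous_ex k).measurable

lemma integral_ex (k : ℤ) : ∫ x, ex k x ∂circ = if k = 0 then 1 else 0 := by
  split_ifs with h
  · simp [h, ex_zero]
  · rw [integral_circ]
    have hk : (k : ℂ) * Complex.I ≠ 0 := by simp [h]
    have : ∀ x : ℝ, ex k x = Complex.exp ((k * Complex.I) * x) := fun x => by
      rw [ex]; ring_nf
    simp_rw [this]
    rw [integral_exp_mul_complex hk]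
    have h2 : Complex.exp (k * Complex.I * (Real.pi : ℝ))
        = Complex.exp (k * Complex.I * ((-Real.pi : ℝ) : ℂ)) := by
      rw [Complex.exp_eq_exp_iff_exists_int]
      exact ⟨k, by push_cast; ring⟩
    rw [h2]
    simp

/-- Bounded measurable symbols. -/
structure Bdd (C : ℝ) (f : ℝ → ℂ) : Prop where
  meas : Measurable f
  bound : ∀ x, ‖f x‖ ≤ C

namespace Bdd

variable {C D : ℝ} {f g : ℝ → ℂ}

lemma nonneg (hf : Bdd C f) : 0 ≤ C := (norm_nonneg _).trans (hf.bound 0)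

lemma integrable (hf : Bdd C f) : Integrable f circ :=
  Integrable.of_bound hf.meas.aestronglyMeasurable C (ae_of_all _ hf.bound)

lemma mul (hf : Bdd C f) (hg : Bdd D g) : Bdd (C * D) (fun x => f x * g x) :=
  ⟨hf.meas.mul hg.meas, fun x => by
    rw [norm_mul]; exact mul_le_mul (hf.bound x) (hg.bound x) (norm_nonneg _) hf.nonneg⟩

lemma add (hf : Bdd C f) (hg : Bdd D g) : Bdd (C + D) (fun x => f x + g x) :=
  ⟨hf.meas.add hg.meas, fun x => (norm_add_le _ _).trans (add_le_add (hf.bound x) (hg.bound x))⟩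

lemma sub (hf : Bdd C f) (hg : Bdd D g) : Bdd (C + D) (fun x => f x - g x) :=
  ⟨hf.meas.sub hg.meas, fun x => (norm_sub_le _ _).trans (add_le_add (hf.bound x) (hg.bound x))⟩

lemma star (hf : Bdd C f) : Bdd C (fun x => conj (f x)) :=
  ⟨Complex.measurable_ofReal.comp (Complex.measurable_re.comp hf.meas) |>.sub
    ((Complex.measurable_ofReal.comp (Complex.measurable_im.comp hf.meas)).mul_const Complex.I)
    |> fun h => by
      convert h using 2 with x
      apply Complex.ext <;> simp, fun x => by simpa using hf.bound x⟩

lemma const (c : ℂ) : Bdd ‖c‖ (fun _ => c) := ⟨measurable_const, fun _ => le_rfl⟩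

lemma ex (k : ℤ) : Bdd 1 (ex k) := ⟨by fun_prop, fun x => (norm_ex k x).le⟩

lemma mono (hf : Bdd C f) (h : C ≤ D) : Bdd D f := ⟨hf.meas, fun x => (hf.bound x).trans h⟩

lemma sum {ι : Type*} {s : Finset ι} {c : ι → ℝ} {f : ι → ℝ → ℂ} (hf : ∀ i ∈ s, Bdd (c i) (f i)) :
    Bdd (∑ i ∈ s, c i) (fun x => ∑ i ∈ s, f i x) :=
  ⟨Finset.measurable_fun_sum s fun i hi => (hf i hi).meas,
    fun x => (norm_sum_le _ _).trans (Finset.sum_le_sum fun i hi => (hf i hi).bound x)⟩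

end Bdd

/-- Fourier coefficients. -/
def coef (f : ℝ → ℂ) (k : ℤ) : ℂ := ∫ x, f x * ex (-k) x ∂circ

/-- The Toeplitz matrix with a given symbol. -/
def toep (n : ℕ) (f : ℝ → ℂ) : Matrix (Fin n) (Fin n) ℂ :=
  Matrix.of fun i j => coef f ((i : ℤ) - (j : ℤ))

/-- The trigonometric polynomial with given coefficients. -/
def poly {n : ℕ} (v : Fin n → ℂ) (x : ℝ) : ℂ := ∑ j : Fin n, v j * ex (j : ℤ) x

lemma bdd_poly {n : ℕ} (v : Fin n → ℂ) : Bdd (∑ j, ‖v j‖ * 1) (poly v) :=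
  Bdd.sum fun j _ => (Bdd.const (v j)).mul (Bdd.ex j)

/-- A Toeplitz matrix is the compression of multiplication by its symbol to trigonometric
polynomials of degree less than `n`. The norm and positivity bounds for Toeplitz matrices are read
off from this form. -/
lemma star_dotProduct_toep_mulVec {C : ℝ} {n : ℕ} {f : ℝ → ℂ} (hf : Bdd C f) (v w : Fin n → ℂ) :
    star v ⬝ᵥ toep n f *ᵥ w = ∫ x, f x * (conj (poly v x) * poly w x) ∂circ := by
  have h : ∀ x, f x * (conj (poly v x) * poly w x)
      = ∑ i : Fin n, ∑ j : Fin n, conj (v i) * (w j) * (f x * ex (-((i : ℤ) - (j : ℤ))) x) := by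
    intro x
    simp only [poly, map_sum, map_mul, conj_ex]
    rw [Finset.sum_mul_sum, Finset.mul_sum]
    refine Finset.sum_congr rfl fun i _ => ?_
    rw [Finset.mul_sum]
    refine Finset.sum_congr rfl fun j _ => ?_
    rw [show (-((i : ℤ) - (j : ℤ))) = -(i : ℤ) + j by ring, ex_add]
    ring
  simp_rw [h]
  have hi : ∀ i j : Fin n, Integrable (fun x => conj (v i) * (w j)
      * (f x * ex (-((i : ℤ) - (j : ℤ))) x)) circ := fun i j =>
    (hf.mul (Bdd.ex _)).integrable.const_mul _
  rw [integral_finsetSum _ fun i _ => integrable_finsetSum _ fun j _ => hi i j]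
  simp only [dotProduct, mulVec, Pi.star_apply, toep, of_apply, coef]
  refine Finset.sum_congr rfl fun i _ => ?_
  rw [integral_finsetSum _ fun j _ => hi i j, Finset.mul_sum]
  refine Finset.sum_congr rfl fun j _ => ?_
  rw [integral_const_mul]
  simp only [RCLike.star_def]
  ring

lemma coef_one (k : ℤ) : coef (fun _ => 1) k = if k = 0 then 1 else 0 := by
  simp [coef, integral_ex]

lemma toep_one (n : ℕ) : toep n (fun _ => 1) = 1 := by
  ext i j
  simp only [toep, of_apply, coef_one, Matrix.one_apply]
  congr 1
  simp [sub_eq_zero, Fin.ext_iff]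

lemma integral_normSq_poly {n : ℕ} (v : Fin n → ℂ) :
    ∫ x, ‖poly v x‖ ^ 2 ∂circ = ∑ i, ‖v i‖ ^ 2 := by
  have h := star_dotProduct_toep_mulVec (n := n) (Bdd.const 1) v v
  rw [toep_one, Matrix.one_mulVec] at h
  have h1 : ∀ x, (1 : ℂ) * (conj (poly v x) * poly v x) = ((‖poly v x‖ ^ 2 : ℝ) : ℂ) := fun x => by
    rw [one_mul, mul_comm, Complex.mul_conj, Complex.normSq_eq_norm_sq]
  simp_rw [h1] at h
  rw [integral_complex_ofReal] at h
  have h2 : star v ⬝ᵥ v = ((∑ i, ‖v i‖ ^ 2 : ℝ) : ℂ) := by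
    simp only [dotProduct, Pi.star_apply, RCLike.star_def, Complex.ofReal_sum]
    refine Finset.sum_congr rfl fun i _ => ?_
    rw [mul_comm, Complex.mul_conj, Complex.normSq_eq_norm_sq]
  rw [h2] at h
  exact_mod_cast h.symm

open scoped Matrix.Norms.L2Operator

lemma integrable_normSq {C : ℝ} {f : ℝ → ℂ} (hf : Bdd C f) :
    Integrable (fun x => ‖f x‖ ^ 2) circ :=
  Integrable.of_bound (hf.meas.norm.pow_const 2).aestronglyMeasurable (C ^ 2)
    (ae_of_all _ fun x => by
    rw [Real.norm_of_nonneg (by positivity)]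
    exact pow_le_pow_left₀ (norm_nonneg _) (hf.bound x) 2)

lemma norm_le_of_forall_sum_sq {n : ℕ} {A : Matrix (Fin n) (Fin n) ℂ} {C : ℝ} (hC : 0 ≤ C)
    (h : ∀ w : Fin n → ℂ, ∑ i, ‖(A *ᵥ w) i‖ ^ 2 ≤ C ^ 2 * ∑ i, ‖w i‖ ^ 2) : ‖A‖ ≤ C := by
  rw [cstar_norm_def]
  refine ContinuousLinearMap.opNorm_le_bound _ hC fun w => ?_
  rw [EuclideanSpace.norm_eq, EuclideanSpace.norm_eq w, ofLp_toEuclideanCLM,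
    ← Real.sqrt_sq hC, ← Real.sqrt_mul (by positivity)]
  exact Real.sqrt_le_sqrt (h w.ofLp)

lemma sum_sq_mulVec_le {n : ℕ} (A : Matrix (Fin n) (Fin n) ℂ) (w : Fin n → ℂ) :
    ∑ i, ‖(A *ᵥ w) i‖ ^ 2 ≤ ‖A‖ ^ 2 * ∑ i, ‖w i‖ ^ 2 := by
  have h := (toEuclideanCLM (n := Fin n) (𝕜 := ℂ) A).le_opNorm (WithLp.toLp 2 w)
  rw [← cstar_norm_def] at h
  have h2 := pow_le_pow_left₀ (norm_nonneg _) h 2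
  rwa [mul_pow, EuclideanSpace.norm_sq_eq, EuclideanSpace.norm_sq_eq] at h2

lemma norm_toep_le {C : ℝ} (hC : 0 < C) {f : ℝ → ℂ} (hf : Bdd C f) (n : ℕ) :
    ‖toep n f‖ ≤ C := by
  refine norm_le_of_forall_sum_sq hC.le fun w => ?_
  -- Testing the form against `v = T w` itself gives `‖v‖² ≤ ‖v‖² / 2 + C² ‖w‖² / 2` by the
  -- arithmetic–geometric mean inequality and Parseval.
  set v := toep n f *ᵥ w with hv
  have h := star_dotProduct_toep_mulVec hf v w
  rw [← hv] at h
  have h2 : star v ⬝ᵥ v = ((∑ i, ‖v i‖ ^ 2 : ℝ) : ℂ) := by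
    simp only [dotProduct, Pi.star_apply, RCLike.star_def, Complex.ofReal_sum]
    refine Finset.sum_congr rfl fun i _ => ?_
    rw [mul_comm, Complex.mul_conj, Complex.normSq_eq_norm_sq]
  have h3 : ∑ i, ‖v i‖ ^ 2 = ‖∫ x, f x * (conj (poly v x) * poly w x) ∂circ‖ := by
    rw [← h, h2, Complex.norm_real, Real.norm_of_nonneg (by positivity)]
  have h4 : ‖∫ x, f x * (conj (poly v x) * poly w x) ∂circ‖
      ≤ ∫ x, (1 / 2 * ‖poly v x‖ ^ 2 + C ^ 2 / 2 * ‖poly w x‖ ^ 2) ∂circ := by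
    refine norm_integral_le_of_norm_le (((integrable_normSq (bdd_poly v)).const_mul _).add
      ((integrable_normSq (bdd_poly w)).const_mul _)) (ae_of_all _ fun x => ?_)
    rw [norm_mul, norm_mul, RCLike.norm_conj]
    have := hf.bound x
    have h5 : ‖f x‖ * (‖poly v x‖ * ‖poly w x‖) ≤ C * (‖poly v x‖ * ‖poly w x‖) := by gcongr
    nlinarith [sq_nonneg (‖poly v x‖ - C * ‖poly w x‖)]
  rw [integral_add ((integrable_normSq (bdd_poly v)).const_mul _)
      ((integrable_normSq (bdd_poly w)).const_mul _), integral_const_mul, integral_const_mul,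
    integral_normSq_poly, integral_normSq_poly] at h4
  linarith

/-! ### The Toeplitz energy -/

lemma integral_sub_sub_add {f g h k : ℝ → ℂ} (hf : Integrable f circ) (hg : Integrable g circ)
    (hh : Integrable h circ) (hk : Integrable k circ) :
    ∫ x, (f x - g x - h x + k x) ∂circ
      = ∫ x, f x ∂circ - ∫ x, g x ∂circ - ∫ x, h x ∂circ + ∫ x, k x ∂circ := by
  have h1 : Integrable (fun x => f x - g x) circ := hf.sub hg
  have h2 : Integrable (fun x => f x - g x - h x) circ := h1.sub hh
  rw [integral_add h2 hk, integral_sub h1 hh, integral_sub hf hg]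

/-- The squared Hilbert–Schmidt norm of the corner of the multiplication operator. -/
def energy (n : ℕ) (f : ℝ → ℂ) : ℝ :=
  n * ∫ x, ‖f x‖ ^ 2 ∂circ - ∑ i : Fin n, ∑ j : Fin n, ‖coef f ((i : ℤ) - (j : ℤ))‖ ^ 2

/-- Pythagoras for the projection onto the span of finitely many characters. Applied to translates
of a symbol and summed over them, it identifies `energy` as a sum of squared distances. -/
lemma integral_normSq_sub_projection {C : ℝ} {n : ℕ} {F : ℝ → ℂ} (hF : Bdd C F)
    (e : Fin n → ℤ) (he : Function.Injective e) :
    ∫ x, ‖F x - ∑ k, coef F (e k) * ex (e k) x‖ ^ 2 ∂circ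
      = ∫ x, ‖F x‖ ^ 2 ∂circ - ∑ k, ‖coef F (e k)‖ ^ 2 := by
  have hp : Bdd (∑ k, ‖coef F (e k)‖ * 1) (fun x => ∑ k, coef F (e k) * ex (e k) x) :=
    Bdd.sum fun k _ => (Bdd.const _).mul (Bdd.ex _)
  have h1 : ∀ x, ((‖F x - ∑ k, coef F (e k) * ex (e k) x‖ ^ 2 : ℝ) : ℂ)
      = ((‖F x‖ ^ 2 : ℝ) : ℂ) - ∑ k, conj (coef F (e k)) * (F x * ex (-(e k)) x)
        - ∑ k, coef F (e k) * conj (F x * ex (-(e k)) x)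
        + ∑ k, ∑ l, coef F (e k) * conj (coef F (e l)) * ex (e k - e l) x := by
    intro x
    rw [← Complex.normSq_eq_norm_sq, ← Complex.normSq_eq_norm_sq, ← Complex.mul_conj,
      ← Complex.mul_conj]
    have e1 : ∀ k l, coef F (e k) * ex (e k) x * (conj (coef F (e l)) * ex (-(e l)) x)
        = coef F (e k) * conj (coef F (e l)) * ex (e k - e l) x := fun k l => by
      rw [sub_eq_add_neg, ex_add]; ring
    have e2 : F x * ∑ i, conj (coef F (e i)) * ex (-(e i)) x
        = ∑ i, conj (coef F (e i)) * (F x * ex (-(e i)) x) := by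
      rw [Finset.mul_sum]
      exact Finset.sum_congr rfl fun _ _ => by ring
    have e3 : (∑ i, coef F (e i) * ex (e i) x) * conj (F x)
        = ∑ i, coef F (e i) * (conj (F x) * ex (e i) x) := by
      rw [Finset.sum_mul]
      exact Finset.sum_congr rfl fun _ _ => by ring
    simp only [map_sub, map_sum, map_mul, conj_ex, neg_neg]
    rw [sub_mul, mul_sub, mul_sub, Finset.sum_mul_sum, e2, e3]
    simp only [e1]
    ring
  have hI1 : ∀ k, Integrable (fun x => conj (coef F (e k)) * (F x * ex (-(e k)) x)) circ :=
    fun k => (hF.mul (Bdd.ex _)).integrable.const_mul _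
  have hI2 : ∀ k, Integrable (fun x => coef F (e k) * conj (F x * ex (-(e k)) x)) circ :=
    fun k => (hF.mul (Bdd.ex _)).star.integrable.const_mul _
  have hI3 : ∀ k l, Integrable
      (fun x => coef F (e k) * conj (coef F (e l)) * ex (e k - e l) x) circ :=
    fun k l => (Bdd.ex _).integrable.const_mul _
  have hI0 : Integrable (fun x => ((‖F x‖ ^ 2 : ℝ) : ℂ)) circ := (integrable_normSq hF).ofReal
  have h2 : ((∫ x, ‖F x - ∑ k, coef F (e k) * ex (e k) x‖ ^ 2 ∂circ : ℝ) : ℂ)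
      = ((∫ x, ‖F x‖ ^ 2 ∂circ - ∑ k, ‖coef F (e k)‖ ^ 2 : ℝ) : ℂ) := by
    rw [← integral_complex_ofReal]
    simp_rw [h1]
    have hJ1 := integrable_finsetSum Finset.univ fun k _ => hI1 k
    have hJ2 := integrable_finsetSum Finset.univ fun k _ => hI2 k
    have hJ3 := integrable_finsetSum Finset.univ fun k _ =>
      integrable_finsetSum Finset.univ fun l _ => hI3 k l
    rw [integral_sub_sub_add hI0 hJ1 hJ2 hJ3,
      integral_finsetSum _ fun k _ => hI1 k, integral_finsetSum _ fun k _ => hI2 k,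
      integral_finsetSum _ fun k _ => integrable_finsetSum _ fun l _ => hI3 k l]
    have h3 : ∀ k, ∫ x, ∑ l, coef F (e k) * conj (coef F (e l)) * ex (e k - e l) x ∂circ
        = ((‖coef F (e k)‖ ^ 2 : ℝ) : ℂ) := by
      intro k
      rw [integral_finsetSum _ fun l _ => hI3 k l]
      simp_rw [integral_const_mul, integral_ex, sub_eq_zero, he.eq_iff]
      simp [Complex.mul_conj, Complex.normSq_eq_norm_sq]
    have h4 : ∀ k, ∫ x, conj (coef F (e k)) * (F x * ex (-(e k)) x) ∂circ
        = ((‖coef F (e k)‖ ^ 2 : ℝ) : ℂ) := by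
      intro k
      rw [integral_const_mul, ← coef, mul_comm, Complex.mul_conj, Complex.normSq_eq_norm_sq]
    have h5 : ∀ k, ∫ x, coef F (e k) * conj (F x * ex (-(e k)) x) ∂circ
        = ((‖coef F (e k)‖ ^ 2 : ℝ) : ℂ) := by
      intro k
      rw [integral_const_mul, integral_conj, ← coef, Complex.mul_conj, Complex.normSq_eq_norm_sq]
    simp_rw [h3, h4, h5]
    rw [integral_complex_ofReal]
    push_cast
    ring
  exact_mod_cast h2

end SpinNoise

end

noncomputable section

namespace SpinNoise

open Matrix ComplexConjugate
open scoped Matrix.Norms.L2Operator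

/-- The Dirichlet kernel. -/
def dirichlet (n : ℕ) (x y : ℝ) : ℂ := ∑ k : Fin n, ex (k : ℤ) x * ex (-(k : ℤ)) y

lemma measurable_dirichlet (n : ℕ) : Measurable fun z : ℝ × ℝ => dirichlet n z.1 z.2 := by
  unfold dirichlet; fun_prop

lemma norm_dirichlet_le (n : ℕ) (x y : ℝ) : ‖dirichlet n x y‖ ≤ n := by
  refine (norm_sum_le _ _).trans ?_
  simp [norm_ex]

/-- The geometric sum telescopes, so the bound is free of `n`. The factor `‖ex 1 x - ex 1 y‖` is
supplied by the increments of rational symbols. -/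
lemma norm_dirichlet_mul_le (n : ℕ) (x y : ℝ) :
    ‖ex 1 x - ex 1 y‖ * ‖dirichlet n x y‖ ≤ 2 := by
  have h1 : dirichlet n x y = ∑ k ∈ Finset.range n, (ex 1 x * ex (-1) y) ^ k := by
    rw [dirichlet, Finset.sum_range]
    refine Finset.sum_congr rfl fun k _ => ?_
    rw [mul_pow, ex_natCast, ← conj_ex, ← conj_ex, ex_natCast, map_pow]
  have h2 : ‖ex 1 x - ex 1 y‖ = ‖ex 1 x * ex (-1) y - 1‖ := by
    have : ex 1 x * ex (-1) y - 1 = (ex 1 x - ex 1 y) * ex (-1) y := by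
      rw [sub_mul, ← ex_add 1 (-1) y]; simp [ex_zero]
    rw [this, norm_mul, norm_ex, mul_one]
  rw [h2, h1, mul_comm, ← norm_mul, geom_sum_mul]
  refine (norm_sub_le _ _).trans ?_
  simp [norm_ex]
  norm_num

lemma integrable_energy_kernel {C : ℝ} {f : ℝ → ℂ} (hf : Bdd C f) (n : ℕ) :
    Integrable (fun z : ℝ × ℝ => ‖f z.1 - f z.2‖ ^ 2 * ‖dirichlet n z.1 z.2‖ ^ 2)
      (circ.prod circ) := by
  have h1 : Measurable fun z : ℝ × ℝ => f z.1 := hf.meas.comp measurable_fst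
  have h2 : Measurable fun z : ℝ × ℝ => f z.2 := hf.meas.comp measurable_snd
  refine Integrable.of_bound (((h1.sub h2).norm.pow_const 2).mul
    ((measurable_dirichlet n).norm.pow_const 2)).aestronglyMeasurable ((C + C) ^ 2 * n ^ 2)
    (ae_of_all _ fun z => ?_)
  rw [Real.norm_of_nonneg (by positivity)]
  have h3 : ‖f z.1 - f z.2‖ ≤ C + C :=
    (norm_sub_le _ _).trans (add_le_add (hf.bound _) (hf.bound _))
  have h4 := norm_dirichlet_le n z.1 z.2
  gcongr

/-- Douglas-type formula: the energy as a double integral of squared differences. -/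
lemma two_mul_energy {C : ℝ} {f : ℝ → ℂ} (hf : Bdd C f) (n : ℕ) :
    2 * energy n f
      = ∫ z : ℝ × ℝ, ‖f z.1 - f z.2‖ ^ 2 * ‖dirichlet n z.1 z.2‖ ^ 2 ∂(circ.prod circ) := by
  have hQ : Bdd (C * C) (fun x => f x * conj (f x)) := hf.mul hf.star
  -- For each pair of indices the integrand is a sum of four products of a function of `x` and a
  -- function of `y`. After Fubini the first and last contribute `∫ |f|²` on the diagonal, the
  -- middle two contribute minus a squared Fourier coefficient each.
  let a : Fin n × Fin n → Fin 4 → ℝ → ℂ := fun p =>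
    ![fun x => f x * conj (f x) * ex ((p.1 : ℤ) - p.2) x,
      fun x => -(f x * ex ((p.1 : ℤ) - p.2) x),
      fun x => -(conj (f x) * ex ((p.1 : ℤ) - p.2) x),
      fun x => ex ((p.1 : ℤ) - p.2) x]
  let b : Fin n × Fin n → Fin 4 → ℝ → ℂ := fun p =>
    ![fun x => ex ((p.2 : ℤ) - p.1) x,
      fun x => conj (f x) * ex ((p.2 : ℤ) - p.1) x,
      fun x => f x * ex ((p.2 : ℤ) - p.1) x,
      fun x => f x * conj (f x) * ex ((p.2 : ℤ) - p.1) x]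
  have ha : ∀ p q, Integrable (a p q) circ := by
    intro p q
    fin_cases q
    · exact (hQ.mul (Bdd.ex _)).integrable
    · exact (hf.mul (Bdd.ex _)).integrable.neg
    · exact (hf.star.mul (Bdd.ex _)).integrable.neg
    · exact (Bdd.ex _).integrable
  have hb : ∀ p q, Integrable (b p q) circ := by
    intro p q
    fin_cases q
    · exact (Bdd.ex _).integrable
    · exact (hf.star.mul (Bdd.ex _)).integrable
    · exact (hf.mul (Bdd.ex _)).integrable
    · exact (hQ.mul (Bdd.ex _)).integrable
  have h1 : ∀ z : ℝ × ℝ, ((‖f z.1 - f z.2‖ ^ 2 * ‖dirichlet n z.1 z.2‖ ^ 2 : ℝ) : ℂ)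
      = ∑ p : Fin n × Fin n, ∑ q, a p q z.1 * b p q z.2 := by
    intro z
    have hD : ((‖dirichlet n z.1 z.2‖ ^ 2 : ℝ) : ℂ)
        = ∑ p : Fin n × Fin n, ex ((p.1 : ℤ) - p.2) z.1 * ex ((p.2 : ℤ) - p.1) z.2 := by
      rw [← Complex.normSq_eq_norm_sq, ← Complex.mul_conj, dirichlet, map_sum,
        Finset.sum_mul_sum, Fintype.sum_prod_type]
      refine Finset.sum_congr rfl fun i _ => Finset.sum_congr rfl fun j _ => ?_
      rw [map_mul, conj_ex, conj_ex, sub_eq_add_neg, sub_eq_add_neg, ex_add, ex_add, neg_neg]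
      ring
    rw [Complex.ofReal_mul, hD, ← Complex.normSq_eq_norm_sq, ← Complex.mul_conj, Finset.mul_sum]
    refine Finset.sum_congr rfl fun p _ => ?_
    simp only [Fin.sum_univ_four, a, b, map_sub, Matrix.cons_val]
    ring
  have h2 : ((∫ z : ℝ × ℝ, ‖f z.1 - f z.2‖ ^ 2 * ‖dirichlet n z.1 z.2‖ ^ 2 ∂(circ.prod circ) : ℝ)
      : ℂ) = ((2 * energy n f : ℝ) : ℂ) := by
    rw [← integral_complex_ofReal]
    simp_rw [h1]
    rw [integral_finsetSum _ fun p _ => integrable_finsetSum _ fun q _ =>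
      (ha p q).mul_prod (hb p q)]
    simp_rw [integral_finsetSum _ fun q _ => (ha _ q).mul_prod (hb _ q), integral_prod_mul]
    have hc : ∀ k : ℤ, ∫ x, f x * ex k x ∂circ = coef f (-k) := fun k => by rw [coef, neg_neg]
    have hcc : ∀ k : ℤ, ∫ x, conj (f x) * ex k x ∂circ = conj (coef f k) := fun k => by
      rw [coef, ← integral_conj]
      simp [conj_ex]
    have hS : ((∫ x, ‖f x‖ ^ 2 ∂circ : ℝ) : ℂ) = ∫ x, f x * conj (f x) ∂circ := by
      rw [← integral_complex_ofReal]
      simp_rw [← Complex.normSq_eq_norm_sq, ← Complex.mul_conj]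
    have h3 : ∀ p : Fin n × Fin n, ∑ q, (∫ x, a p q x ∂circ) * ∫ x, b p q x ∂circ
        = (if p.1 = p.2 then 2 * ∫ x, f x * conj (f x) ∂circ else 0)
          - ((‖coef f ((p.2 : ℤ) - p.1)‖ ^ 2 : ℝ) : ℂ)
          - ((‖coef f ((p.1 : ℤ) - p.2)‖ ^ 2 : ℝ) : ℂ) := by
      intro p
      have e1 : ((p.1 : ℤ) - p.2 = 0) = (p.1 = p.2) := by simp [sub_eq_zero, Fin.ext_iff]
      have e2 : ((p.2 : ℤ) - p.1 = 0) = (p.1 = p.2) := by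
        simp [sub_eq_zero, Fin.ext_iff, eq_comm]
      simp only [Fin.sum_univ_four, a, b, Matrix.cons_val, integral_neg, hc, hcc, integral_ex,
        neg_sub, e1, e2, ← Complex.normSq_eq_norm_sq, ← Complex.mul_conj]
      split_ifs with h
      · simp only [h, sub_self, ex_zero, mul_one]
        ring
      · ring
    simp_rw [h3, Fintype.sum_prod_type, Finset.sum_sub_distrib]
    rw [energy]
    push_cast
    rw [hS, Finset.sum_comm (f := fun i j : Fin n => ((‖coef f ((j : ℤ) - i)‖ : ℂ)) ^ 2)]
    simp
    ring
  exact_mod_cast h2.symm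

/-- The weight `‖dirichlet‖²` is nonnegative, so a pointwise estimate of increments passes to
energies. Sums, products, conjugates and reciprocals of symbols are all treated this way. -/
lemma energy_le {C : ℝ} {F f g : ℝ → ℂ} (hF : Bdd C F) (hf : Bdd C f) (hg : Bdd C g) (n : ℕ)
    {a b : ℝ} (h : ∀ x y, ‖F x - F y‖ ^ 2 ≤ a * ‖f x - f y‖ ^ 2 + b * ‖g x - g y‖ ^ 2) :
    energy n F ≤ a * energy n f + b * energy n g := by
  have hi := (integrable_energy_kernel hf n).const_mul a
  have hj := (integrable_energy_kernel hg n).const_mul b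
  have := integral_mono (integrable_energy_kernel hF n) (hi.add hj) fun z => by
    change ‖F z.1 - F z.2‖ ^ 2 * ‖dirichlet n z.1 z.2‖ ^ 2 ≤
      a * (‖f z.1 - f z.2‖ ^ 2 * ‖dirichlet n z.1 z.2‖ ^ 2)
      + b * (‖g z.1 - g z.2‖ ^ 2 * ‖dirichlet n z.1 z.2‖ ^ 2)
    have := mul_le_mul_of_nonneg_right (h z.1 z.2) (sq_nonneg ‖dirichlet n z.1 z.2‖)
    linarith
  rw [integral_add' hi hj, integral_const_mul, integral_const_mul, ← two_mul_energy hF,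
    ← two_mul_energy hf, ← two_mul_energy hg] at this
  linarith

lemma energy_nonneg {C : ℝ} {f : ℝ → ℂ} (hf : Bdd C f) (n : ℕ) : 0 ≤ energy n f := by
  have := two_mul_energy hf n
  have h : 0 ≤ ∫ z : ℝ × ℝ, ‖f z.1 - f z.2‖ ^ 2 * ‖dirichlet n z.1 z.2‖ ^ 2 ∂(circ.prod circ) :=
    integral_nonneg fun z => by positivity
  linarith

/-- The Dirichlet kernel is absorbed by `‖ex 1 x - ex 1 y‖`, leaving the separated weight `4 p(x)²
p(y)²`, whose double integral is independent of `n`. -/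
lemma energy_le_of_kernel {C K : ℝ} {f : ℝ → ℂ} (hf : Bdd C f) {p : ℝ → ℝ} (hp : Measurable p)
    (hpK : ∀ x, |p x| ≤ K)
    (h : ∀ x y, ‖f x - f y‖ ≤ ‖ex 1 x - ex 1 y‖ * (p x * p y)) (n : ℕ) :
    energy n f ≤ 2 * (∫ x, p x ^ 2 ∂circ) ^ 2 := by
  have hi : Integrable (fun x => p x ^ 2) circ :=
    Integrable.of_bound (hp.pow_const 2).aestronglyMeasurable (K ^ 2) (ae_of_all _ fun x => by
      rw [norm_pow]
      exact pow_le_pow_left₀ (norm_nonneg _) (hpK x) 2)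
  have := integral_mono (integrable_energy_kernel hf n) ((hi.mul_prod hi).const_mul 4) fun z => by
    change ‖f z.1 - f z.2‖ ^ 2 * ‖dirichlet n z.1 z.2‖ ^ 2 ≤ 4 * (p z.1 ^ 2 * p z.2 ^ 2)
    have h0 := norm_dirichlet_mul_le n z.1 z.2
    have h1 := pow_le_pow_left₀ (norm_nonneg _) (h z.1 z.2) 2
    have h2 := pow_le_pow_left₀ (by positivity) h0 2
    calc ‖f z.1 - f z.2‖ ^ 2 * ‖dirichlet n z.1 z.2‖ ^ 2
        ≤ (‖ex 1 z.1 - ex 1 z.2‖ * (p z.1 * p z.2)) ^ 2 * ‖dirichlet n z.1 z.2‖ ^ 2 := by gcongr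
      _ = (‖ex 1 z.1 - ex 1 z.2‖ * ‖dirichlet n z.1 z.2‖) ^ 2 * (p z.1 ^ 2 * p z.2 ^ 2) := by ring
      _ ≤ 2 ^ 2 * (p z.1 ^ 2 * p z.2 ^ 2) := by gcongr
      _ = 4 * (p z.1 ^ 2 * p z.2 ^ 2) := by ring
  rw [integral_const_mul, ← two_mul_energy hf] at this
  rw [integral_prod_mul (fun x => p x ^ 2) (fun y => p y ^ 2)] at this
  nlinarith

/-! ### Products of Toeplitz matrices -/

lemma coef_mul_ex (f : ℝ → ℂ) (j k : ℤ) : coef (fun x => f x * ex j x) k = coef f (k - j) := by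
  simp only [coef, mul_assoc, ← ex_add]
  congr! 4
  ring

/-- The defect of multiplicativity of Toeplitz matrices is trace-class, with a bound by the
energies of the symbols. -/
lemma norm_trace_mul_toep_defect_le {C D : ℝ} {f g : ℝ → ℂ} (hf : Bdd C f) (hg : Bdd D g) {n : ℕ}
    (X : Matrix (Fin n) (Fin n) ℂ) :
    ‖(X * (toep n (fun x => f x * g x) - toep n f * toep n g)).trace‖
      ≤ ‖X‖ * ((energy n f + energy n g) / 2) := by
  -- `L i` and `R j` are the components of the translated symbols outside the frequencies retained
  -- by the `n × n` truncation. The defect has entries `∫ L i * R j`, and the squared norms of the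
  -- `L i` and of the `R j` sum to the two energies.
  let L : Fin n → ℝ → ℂ := fun i x => f x * ex (-(i : ℤ)) x
    - ∑ k : Fin n, coef (fun x => f x * ex (-(i : ℤ)) x) (-(k : ℤ)) * ex (-(k : ℤ)) x
  let R : Fin n → ℝ → ℂ := fun j x => g x * ex (j : ℤ) x
    - ∑ k : Fin n, coef (fun x => g x * ex (j : ℤ) x) (k : ℤ) * ex (k : ℤ) x
  have hfe : ∀ i : Fin n, Bdd (C * 1) (fun x => f x * ex (-(i : ℤ)) x) := fun i => hf.mul (Bdd.ex _)
  have hge : ∀ j : Fin n, Bdd (D * 1) (fun x => g x * ex (j : ℤ) x) := fun j => hg.mul (Bdd.ex _)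
  have hL : ∀ i, Bdd _ (L i) := fun i =>
    (hfe i).sub (Bdd.sum fun k _ => (Bdd.const _).mul (Bdd.ex _))
  have hR : ∀ j, Bdd _ (R j) := fun j =>
    (hge j).sub (Bdd.sum fun k _ => (Bdd.const _).mul (Bdd.ex _))
  have hLe : ∑ i, ∫ x, ‖L i x‖ ^ 2 ∂circ = energy n f := by
    have : ∀ i : Fin n, ∫ x, ‖L i x‖ ^ 2 ∂circ = ∫ x, ‖f x‖ ^ 2 ∂circ
        - ∑ k : Fin n, ‖coef f ((i : ℤ) - k)‖ ^ 2 := fun i => by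
      rw [integral_normSq_sub_projection (hfe i) (fun k => -(k : ℤ))
        (fun a b h => by simpa [Fin.ext_iff] using h)]
      simp only [norm_mul, norm_ex, mul_one, coef_mul_ex]
      congr! 5
      ring
    simp_rw [this, Finset.sum_sub_distrib]
    simp [energy]
  have hRe : ∑ j, ∫ x, ‖R j x‖ ^ 2 ∂circ = energy n g := by
    have : ∀ j : Fin n, ∫ x, ‖R j x‖ ^ 2 ∂circ = ∫ x, ‖g x‖ ^ 2 ∂circ
        - ∑ k : Fin n, ‖coef g ((k : ℤ) - j)‖ ^ 2 := fun j => by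
      rw [integral_normSq_sub_projection (hge j) (fun k => (k : ℤ))
        (fun a b h => by simpa [Fin.ext_iff] using h)]
      simp only [norm_mul, norm_ex, mul_one, coef_mul_ex]
    simp_rw [this, Finset.sum_sub_distrib]
    rw [Finset.sum_comm]
    simp [energy]
  have hW : ∀ i j, (toep n (fun x => f x * g x) - toep n f * toep n g) i j
      = ∫ x, L i x * R j x ∂circ := by
    intro i j
    have e : ∀ x, L i x * R j x = f x * g x * ex ((j : ℤ) - i) x
        - (∑ k : Fin n, coef g ((k : ℤ) - j) * (f x * ex ((k : ℤ) - i) x))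
        - (∑ k : Fin n, coef f ((i : ℤ) - k) * (g x * ex ((j : ℤ) - k) x))
        + ∑ k : Fin n, ∑ l : Fin n,
          coef f ((i : ℤ) - k) * coef g ((l : ℤ) - j) * ex ((l : ℤ) - k) x := by
      intro x
      simp only [L, R, coef_mul_ex]
      rw [sub_mul, mul_sub, mul_sub, Finset.sum_mul_sum, Finset.mul_sum, Finset.sum_mul]
      have e1 : ∀ k : Fin n, f x * ex (-(i : ℤ)) x * (coef g ((k : ℤ) - j) * ex (k : ℤ) x)
          = coef g ((k : ℤ) - j) * (f x * ex ((k : ℤ) - i) x) := fun k => by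
        rw [sub_eq_add_neg (k : ℤ) (i : ℤ), ex_add]; ring
      have e2 : ∀ k : Fin n, coef f (-(k : ℤ) - -(i : ℤ)) * ex (-(k : ℤ)) x * (g x * ex (j : ℤ) x)
          = coef f ((i : ℤ) - k) * (g x * ex ((j : ℤ) - k) x) := fun k => by
        rw [sub_eq_add_neg (j : ℤ) (k : ℤ), ex_add, neg_sub_neg]; ring
      have e3 : ∀ k l : Fin n, coef f (-(k : ℤ) - -(i : ℤ)) * ex (-(k : ℤ)) x
            * (coef g ((l : ℤ) - j) * ex (l : ℤ) x)
          = coef f ((i : ℤ) - k) * coef g ((l : ℤ) - j) * ex ((l : ℤ) - k) x := fun k l => by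
        rw [sub_eq_add_neg (l : ℤ) (k : ℤ), ex_add, neg_sub_neg]; ring
      simp only [e1, e2, e3]
      rw [sub_eq_add_neg (j : ℤ) (i : ℤ), ex_add]
      ring
    have hI1 : ∀ k : Fin n, Integrable (fun x => coef g ((k : ℤ) - j) * (f x * ex ((k : ℤ) - i) x))
        circ := fun k => (hf.mul (Bdd.ex _)).integrable.const_mul _
    have hI2 : ∀ k : Fin n, Integrable (fun x => coef f ((i : ℤ) - k) * (g x * ex ((j : ℤ) - k) x))
        circ := fun k => (hg.mul (Bdd.ex _)).integrable.const_mul _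
    have hI3 : ∀ k l : Fin n, Integrable (fun x => coef f ((i : ℤ) - k) * coef g ((l : ℤ) - j)
        * ex ((l : ℤ) - k) x) circ := fun k l => (Bdd.ex _).integrable.const_mul _
    simp_rw [e]
    rw [integral_sub_sub_add ((hf.mul hg).mul (Bdd.ex _)).integrable
      (integrable_finsetSum Finset.univ fun k _ => hI1 k)
      (integrable_finsetSum Finset.univ fun k _ => hI2 k)
      (integrable_finsetSum Finset.univ fun k _ =>
        integrable_finsetSum Finset.univ fun l _ => hI3 k l),
      integral_finsetSum _ fun k _ => hI1 k, integral_finsetSum _ fun k _ => hI2 k,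
      integral_finsetSum _ fun k _ => integrable_finsetSum _ fun l _ => hI3 k l]
    simp_rw [integral_finsetSum _ fun l _ => hI3 _ l, integral_const_mul, integral_ex]
    have e4 : ∀ k l : Fin n, ((l : ℤ) - k = 0) = (k = l) := fun k l => by
      simp [sub_eq_zero, Fin.ext_iff, eq_comm]
    simp only [e4, Matrix.sub_apply, toep, of_apply, Matrix.mul_apply, coef, mul_ite, mul_one,
      mul_zero, Finset.sum_ite_eq, Finset.mem_univ, if_true, neg_sub]
    simp only [mul_comm]
    ring
  -- Pairing the defect with `X` gives the integral of a bilinear form with matrix `X`. Pointwise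
  -- Cauchy–Schwarz and the arithmetic–geometric mean inequality bound it by the operator norm of
  -- `X`.
  have hpt : ∀ x, ‖∑ i, R i x * (X *ᵥ fun j => L j x) i‖
      ≤ ‖X‖ * ((∑ i, ‖L i x‖ ^ 2 + ∑ i, ‖R i x‖ ^ 2) / 2) := by
    intro x
    have h1 : ‖∑ i, R i x * (X *ᵥ fun j => L j x) i‖
        ≤ ∑ i, ‖R i x‖ * ‖(X *ᵥ fun j => L j x) i‖ := by
      refine (norm_sum_le _ _).trans (le_of_eq ?_)
      simp only [norm_mul]
    have h2 := Finset.sum_mul_sq_le_sq_mul_sq Finset.univ (fun i => ‖R i x‖)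
      (fun i => ‖(X *ᵥ fun j => L j x) i‖)
    have h3 := sum_sq_mulVec_le X (fun j => L j x)
    refine h1.trans (abs_le_of_sq_le_sq' ?_ (by positivity)).2
    have h4 : (∑ i, ‖R i x‖ ^ 2) * ∑ i, ‖(X *ᵥ fun j => L j x) i‖ ^ 2
        ≤ (∑ i, ‖R i x‖ ^ 2) * (‖X‖ ^ 2 * ∑ i, ‖L i x‖ ^ 2) := by gcongr
    have h5 : (∑ i, ‖R i x‖ ^ 2) * (‖X‖ ^ 2 * ∑ i, ‖L i x‖ ^ 2)
        ≤ (‖X‖ * ((∑ i, ‖L i x‖ ^ 2 + ∑ i, ‖R i x‖ ^ 2) / 2)) ^ 2 := by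
      have := mul_le_mul_of_nonneg_left (four_mul_le_sq_add (∑ i, ‖L i x‖ ^ 2) (∑ i, ‖R i x‖ ^ 2))
        (sq_nonneg ‖X‖)
      nlinarith
    linarith
  have htr : (X * (toep n (fun x => f x * g x) - toep n f * toep n g)).trace
      = ∫ x, ∑ i, R i x * (X *ᵥ fun j => L j x) i ∂circ := by
    have hI : ∀ i j, Integrable (fun x => X i j * (L j x * R i x)) circ := fun i j =>
      ((hL j).mul (hR i)).integrable.const_mul _
    have e : ∀ x, ∑ i, R i x * (X *ᵥ fun j => L j x) i
        = ∑ i, ∑ j, X i j * (L j x * R i x) := fun x => by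
      refine Finset.sum_congr rfl fun i _ => ?_
      rw [mulVec, dotProduct, Finset.mul_sum]
      exact Finset.sum_congr rfl fun j _ => by ring
    simp_rw [e]
    rw [integral_finsetSum _ fun i _ => integrable_finsetSum _ fun j _ => hI i j]
    simp_rw [integral_finsetSum _ fun j _ => hI _ j, integral_const_mul, ← hW]
    simp [Matrix.trace, Matrix.mul_apply]
  have hIL : ∀ i, Integrable (fun x => ‖L i x‖ ^ 2) circ := fun i => integrable_normSq (hL i)
  have hIR : ∀ i, Integrable (fun x => ‖R i x‖ ^ 2) circ := fun i => integrable_normSq (hR i)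
  have hJL := integrable_finsetSum Finset.univ fun i _ => hIL i
  have hJR := integrable_finsetSum Finset.univ fun i _ => hIR i
  rw [htr]
  refine (norm_integral_le_of_norm_le (((hJL.add hJR).div_const 2).const_mul ‖X‖)
    (ae_of_all _ hpt)).trans (le_of_eq ?_)
  rw [integral_const_mul, integral_div, integral_add' hJL hJR,
    integral_finsetSum _ fun i _ => hIL i,
    integral_finsetSum _ fun i _ => hIR i, hLe, hRe]

end SpinNoise

end

/-! ### Calculus of matrices that are Toeplitz up to a bounded trace-norm error -/

noncomputable section

namespace SpinNoise

open Matrix ComplexConjugate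
open scoped Matrix.Norms.L2Operator

/-- `A` agrees with the Toeplitz matrix of symbol `f` up to an error of bounded trace norm. -/
structure Approx (C : ℝ) {n : ℕ} (A : Matrix (Fin n) (Fin n) ℂ) (f : ℝ → ℂ) : Prop where
  bdd : Bdd C f
  energy_le : energy n f ≤ C
  norm_le : ‖A‖ ≤ C
  trace_le : ∀ X : Matrix (Fin n) (Fin n) ℂ, ‖(X * (A - toep n f)).trace‖ ≤ C * ‖X‖

lemma coef_add {C D : ℝ} {f g : ℝ → ℂ} (hf : Bdd C f) (hg : Bdd D g) (k : ℤ) :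
    coef (fun x => f x + g x) k = coef f k + coef g k := by
  simp only [coef, add_mul]
  exact integral_add (hf.mul (Bdd.ex _)).integrable (hg.mul (Bdd.ex _)).integrable

lemma coef_const_mul (c : ℂ) (f : ℝ → ℂ) (k : ℤ) :
    coef (fun x => c * f x) k = c * coef f k := by
  simp only [coef, mul_assoc, integral_const_mul]

lemma coef_conj (f : ℝ → ℂ) (k : ℤ) : coef (fun x => conj (f x)) k = conj (coef f (-k)) := by
  simp only [coef, ← integral_conj, map_mul, conj_ex, neg_neg]

lemma toep_add {C D : ℝ} {f g : ℝ → ℂ} (hf : Bdd C f) (hg : Bdd D g) (n : ℕ) :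
    toep n (fun x => f x + g x) = toep n f + toep n g := by
  ext i j; exact coef_add hf hg _

lemma toep_const_mul (c : ℂ) (f : ℝ → ℂ) (n : ℕ) :
    toep n (fun x => c * f x) = c • toep n f := by
  ext i j; exact coef_const_mul c f _

lemma toep_conj (f : ℝ → ℂ) (n : ℕ) : toep n (fun x => conj (f x)) = (toep n f)ᴴ := by
  ext i j; simp [toep, coef_conj]

lemma trace_toep (n : ℕ) (f : ℝ → ℂ) : (toep n f).trace = n * ∫ x, f x ∂circ := by
  simp [Matrix.trace, toep, coef, ex_zero]

lemma energy_add_le {C D : ℝ} {f g : ℝ → ℂ} (hf : Bdd C f) (hg : Bdd D g) (n : ℕ) :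
    energy n (fun x => f x + g x) ≤ 2 * energy n f + 2 * energy n g := by
  have hC := hf.nonneg
  have hD := hg.nonneg
  refine energy_le (hf.add hg) (hf.mono (by linarith)) (hg.mono (by linarith)) n fun x y => ?_
  have h : ‖f x + g x - (f y + g y)‖ ≤ ‖f x - f y‖ + ‖g x - g y‖ := by
    rw [add_sub_add_comm]; exact norm_add_le _ _
  nlinarith [pow_le_pow_left₀ (norm_nonneg _) h 2, sq_nonneg (‖f x - f y‖ - ‖g x - g y‖)]

lemma energy_mul_le {C : ℝ} {f g : ℝ → ℂ} (hf : Bdd C f) (hg : Bdd C g) (n : ℕ) :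
    energy n (fun x => f x * g x) ≤ 2 * C ^ 2 * energy n f + 2 * C ^ 2 * energy n g := by
  have hC := hf.nonneg
  refine energy_le (C := C + C * C) ((hf.mul hg).mono (by linarith)) (hf.mono (by nlinarith))
    (hg.mono (by nlinarith)) n fun x y => ?_
  have h : ‖f x * g x - f y * g y‖ ≤ C * ‖f x - f y‖ + C * ‖g x - g y‖ := by
    rw [show f x * g x - f y * g y = (f x - f y) * g x + f y * (g x - g y) by ring]
    refine (norm_add_le _ _).trans ?_
    rw [norm_mul, norm_mul, mul_comm C ‖f x - f y‖]
    have := hg.bound x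
    have := hf.bound y
    gcongr
  nlinarith [pow_le_pow_left₀ (norm_nonneg _) h 2,
    sq_nonneg (C * ‖f x - f y‖ - C * ‖g x - g y‖)]

lemma energy_const_mul_le {C : ℝ} {f : ℝ → ℂ} (hf : Bdd C f) (c : ℂ) (n : ℕ) :
    energy n (fun x => c * f x) ≤ ‖c‖ ^ 2 * energy n f := by
  have hC := hf.nonneg
  have := energy_le (C := C + ‖c‖ * C) (F := fun x => c * f x) (b := 0)
    (((Bdd.const c).mul hf).mono (by linarith))
    (hf.mono (by nlinarith [norm_nonneg c])) (hf.mono (by nlinarith [norm_nonneg c])) n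
    (a := ‖c‖ ^ 2) fun x y => by
      rw [← mul_sub, norm_mul, mul_pow]; simp
  simpa using this

lemma energy_conj_le {C : ℝ} {f : ℝ → ℂ} (hf : Bdd C f) (n : ℕ) :
    energy n (fun x => conj (f x)) ≤ energy n f := by
  have := energy_le (b := 0) (a := 1) hf.star hf hf n fun x y => by
    rw [← map_sub, RCLike.norm_conj]; simp
  simpa using this

lemma energy_const {n : ℕ} (c : ℂ) : energy n (fun _ => c) = 0 := by
  have := two_mul_energy (Bdd.const c) n
  simp at this
  exact this

namespace Approx

variable {n : ℕ} {C D : ℝ} {A B : Matrix (Fin n) (Fin n) ℂ} {f g : ℝ → ℂ}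

lemma nonneg (h : Approx C A f) : 0 ≤ C := h.bdd.nonneg

lemma mono (h : Approx C A f) (hCD : C ≤ D) : Approx D A f :=
  ⟨h.bdd.mono hCD, h.energy_le.trans hCD, h.norm_le.trans hCD, fun X =>
    (h.trace_le X).trans (by gcongr)⟩

lemma toep (hC : 0 < C) (hf : Bdd C f) (he : energy n f ≤ C) : Approx C (toep n f) f :=
  ⟨hf, he, norm_toep_le hC hf n, fun X => by simp; positivity⟩

lemma add (hA : Approx C A f) (hB : Approx D B g) :
    Approx (2 * (C + D)) (A + B) (fun x => f x + g x) := by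
  have hC := hA.nonneg
  have hD := hB.nonneg
  refine ⟨(hA.bdd.add hB.bdd).mono (by linarith), ?_, ?_, fun X => ?_⟩
  · have := energy_add_le hA.bdd hB.bdd n
    linarith [hA.energy_le, hB.energy_le]
  · linarith [norm_add_le A B, hA.norm_le, hB.norm_le]
  · rw [toep_add hA.bdd hB.bdd, add_sub_add_comm, Matrix.mul_add, Matrix.trace_add]
    have h1 := norm_add_le (X * (A - SpinNoise.toep n f)).trace (X * (B - SpinNoise.toep n g)).trace
    nlinarith [hA.trace_le X, hB.trace_le X, norm_nonneg X]

lemma neg (hA : Approx C A f) : Approx C (-A) (fun x => -f x) := by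
  refine ⟨⟨hA.bdd.meas.neg, fun x => by simpa using hA.bdd.bound x⟩, ?_, by simpa using hA.norm_le,
    fun X => ?_⟩
  · have := energy_const_mul_le hA.bdd (-1) n
    simp only [norm_neg, norm_one, one_pow, one_mul, neg_mul] at this
    exact this.trans hA.energy_le
  · have h := toep_const_mul (-1) f n
    simp only [neg_mul, one_mul, neg_smul, one_smul] at h
    have h2 := hA.trace_le X
    rw [h, ← neg_add', ← sub_eq_add_neg, Matrix.mul_neg, Matrix.trace_neg, norm_neg]
    exact h2

/-- Replacing first `A`, then `B`, then the product of Toeplitz matrices gives three errors. The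
first two are moved by cyclicity onto the test matrices `B X` and `X T(f)`; the third is the
Toeplitz defect. The constant `4 C ^ 3` is forced by the energy of the product. -/
lemma mul (hC : 1 ≤ C) (hA : Approx C A f) (hB : Approx C B g) :
    Approx (4 * C ^ 3) (A * B) (fun x => f x * g x) := by
  have hC2 : C ≤ C ^ 2 := by nlinarith
  have hC3 : C ^ 2 ≤ C ^ 3 := by nlinarith [sq_nonneg C]
  refine ⟨(hA.bdd.mul hB.bdd).mono (by nlinarith), ?_, ?_, fun X => ?_⟩
  · have := energy_mul_le hA.bdd hB.bdd n
    nlinarith [hA.energy_le, hB.energy_le]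
  · have := norm_mul_le A B
    nlinarith [hA.norm_le, hB.norm_le, norm_nonneg A, norm_nonneg B]
  · have e : X * (A * B - SpinNoise.toep n (fun x => f x * g x))
        = X * (A - SpinNoise.toep n f) * B
          + X * SpinNoise.toep n f * (B - SpinNoise.toep n g)
          - X * (SpinNoise.toep n (fun x => f x * g x)
            - SpinNoise.toep n f * SpinNoise.toep n g) := by
      noncomm_ring
    have h1 : ‖(X * (A - SpinNoise.toep n f) * B).trace‖ ≤ C * (C * ‖X‖) := by
      rw [Matrix.trace_mul_comm, ← Matrix.mul_assoc]
      refine (hA.trace_le _).trans ?_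
      have := (norm_mul_le B X).trans (mul_le_mul_of_nonneg_right hB.norm_le (norm_nonneg X))
      gcongr
    have h2 : ‖(X * SpinNoise.toep n f * (B - SpinNoise.toep n g)).trace‖ ≤ C * (C * ‖X‖) := by
      refine (hB.trace_le _).trans ?_
      have := (norm_mul_le X (SpinNoise.toep n f)).trans
        (mul_le_mul_of_nonneg_left (norm_toep_le (by linarith) hA.bdd n) (norm_nonneg X))
      rw [mul_comm C ‖X‖]
      gcongr
    have h3 := norm_trace_mul_toep_defect_le hA.bdd hB.bdd X
    have h4 : ‖X‖ * ((energy n f + energy n g) / 2) ≤ ‖X‖ * C := by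
      have := hA.energy_le
      have := hB.energy_le
      gcongr
      linarith
    rw [e, Matrix.trace_sub, Matrix.trace_add]
    refine (norm_sub_le _ _).trans ?_
    have h5 := norm_add_le (X * (A - SpinNoise.toep n f) * B).trace
      (X * SpinNoise.toep n f * (B - SpinNoise.toep n g)).trace
    have h6 : (2 * C ^ 2 + C) * ‖X‖ ≤ 4 * C ^ 3 * ‖X‖ := by gcongr; nlinarith
    linarith

/-- Inverses of Toeplitz matrices. -/
lemma inv (hC : 1 ≤ C) (hf : Bdd C f) (hg : Bdd C g) (hfg : ∀ x, f x * g x = 1)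
    (hfe : energy n f ≤ C) (hge : energy n g ≤ C) (hA : A * SpinNoise.toep n f = 1)
    (hAn : ‖A‖ ≤ C) : Approx (C ^ 2) A g := by
  have hC2 : C ≤ C ^ 2 := by nlinarith
  refine ⟨hg.mono hC2, hge.trans hC2, hAn.trans hC2, fun X => ?_⟩
  -- Since `f g = 1`, one has `A - T(g) = A (1 - T(f) T(g)) = A (T(f g) - T(f) T(g))`, so the
  -- inverse is off by a defect only.
  have e : X * (A - SpinNoise.toep n g) = X * A * (SpinNoise.toep n (fun x => f x * g x)
      - SpinNoise.toep n f * SpinNoise.toep n g) := by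
    simp only [hfg, toep_one]
    rw [Matrix.mul_assoc, Matrix.mul_sub A, ← Matrix.mul_assoc A, hA, Matrix.mul_one,
      Matrix.one_mul]
  rw [e]
  refine (norm_trace_mul_toep_defect_le hf hg _).trans ?_
  have h1 := (norm_mul_le X A).trans (mul_le_mul_of_nonneg_left hAn (norm_nonneg X))
  calc ‖X * A‖ * ((energy n f + energy n g) / 2) ≤ (‖X‖ * C) * C := by
        have := energy_nonneg hf n
        have := energy_nonneg hg n
        gcongr
        linarith
    _ = C ^ 2 * ‖X‖ := by ring

lemma trace_sub_le (hA : Approx C A f) :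
    ‖A.trace - n * ∫ x, f x ∂circ‖ ≤ C := by
  have h := hA.trace_le 1
  rw [Matrix.one_mul, Matrix.trace_sub, trace_toep] at h
  -- Equality fails for `n = 0`, where the identity matrix is zero.
  have h1 : ‖(1 : Matrix (Fin n) (Fin n) ℂ)‖ ≤ 1 := by
    have := norm_toep_le one_pos (f := fun _ => 1) ⟨measurable_const, fun x => by simp⟩ n
    rwa [toep_one] at this
  exact h.trans (mul_le_of_le_one_right hA.nonneg h1)

end Approx

/-- Uniform version of `Approx` for families. -/
def UApprox {ι : Type*} (N : ι → ℕ) (A : ∀ i, Matrix (Fin (N i)) (Fin (N i)) ℂ)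
    (f : ι → ℝ → ℂ) : Prop :=
  ∃ C : ℝ, ∀ i, Approx C (A i) (f i)

namespace UApprox

variable {ι : Type*} {N : ι → ℕ} {A B : ∀ i, Matrix (Fin (N i)) (Fin (N i)) ℂ}
  {f g : ι → ℝ → ℂ}

lemma sub (hA : UApprox N A f) (hB : UApprox N B g) :
    UApprox N (fun i => A i - B i) (fun i x => f i x - g i x) := by
  obtain ⟨C, hC⟩ := hA
  obtain ⟨D, hD⟩ := hB
  refine ⟨2 * (C + D), fun i => ?_⟩
  simp only [sub_eq_add_neg]
  exact (hC i).add (hD i).neg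

lemma mul (hA : UApprox N A f) (hB : UApprox N B g) :
    UApprox N (fun i => A i * B i) (fun i x => f i x * g i x) := by
  obtain ⟨C, hC⟩ := hA
  obtain ⟨D, hD⟩ := hB
  exact ⟨_, fun i => Approx.mul (C := max 1 (max C D)) (le_max_left _ _)
    ((hC i).mono ((le_max_left _ _).trans (le_max_right _ _)))
    ((hD i).mono ((le_max_right _ _).trans (le_max_right _ _)))⟩

lemma one : UApprox N (fun _ => 1) (fun _ _ => 1) :=
  ⟨1, fun i => by
    have := Approx.toep (n := N i) one_pos (f := fun _ => 1)
      ⟨measurable_const, fun x => by simp⟩ (by rw [energy_const]; norm_num)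
    rwa [toep_one] at this⟩

lemma pow (hA : UApprox N A f) (m : ℕ) : UApprox N (fun i => A i ^ m) (fun i x => f i x ^ m) := by
  induction m with
  | zero => simpa using one
  | succ m ih => simpa only [pow_succ] using ih.mul hA

end UApprox

end SpinNoise

end

noncomputable section

namespace SpinNoise

open Matrix ComplexConjugate
open scoped Matrix.Norms.L2Operator

/-! ### Geometric symbols -/

/-- The geometric symbol `∑ z ^ k u ^ k` on the circle. -/
def geo (z : ℂ) (x : ℝ) : ℂ := (1 - z * ex 1 x)⁻¹

section geo

variable {z : ℂ}

lemma norm_mul_ex (z : ℂ) (k : ℤ) (x : ℝ) : ‖z * ex k x‖ = ‖z‖ := by rw [norm_mul, norm_ex, mul_one]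

lemma one_sub_mul_ex_ne_zero (hz : ‖z‖ < 1) (x : ℝ) : 1 - z * ex 1 x ≠ 0 := by
  intro h
  have h2 := norm_mul_ex z 1 x
  rw [← sub_eq_zero.1 h, norm_one] at h2
  linarith

lemma bdd_geo (hz : ‖z‖ < 1) : Bdd (1 - ‖z‖)⁻¹ (geo z) := by
  refine ⟨(measurable_const.sub (measurable_const.mul (measurable_ex 1))).inv, fun x => ?_⟩
  rw [geo, norm_inv]
  have h := norm_sub_norm_le 1 (z * ex 1 x)
  rw [norm_mul_ex, norm_one] at h
  exact inv_anti₀ (by linarith) h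

/-- Termwise integration of the geometric series. The test function `F` is a character when
coefficients are computed and the conjugate of `geo z` when the `L²` norm is. -/
lemma hasSum_integral_mul_geo (hz : ‖z‖ < 1) {C : ℝ} {F : ℝ → ℂ} (hF : Bdd C F) :
    HasSum (fun k : ℕ => z ^ k * ∫ x, F x * ex k x ∂circ) (∫ x, F x * geo z x ∂circ) := by
  have h1 : ∀ k : ℕ, Integrable (fun x => z ^ k * (F x * ex k x)) circ := fun k =>
    (hF.mul (Bdd.ex _)).integrable.const_mul _
  have h2 : Summable fun k : ℕ => ∫ x, ‖z ^ k * (F x * ex k x)‖ ∂circ := by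
    refine Summable.of_nonneg_of_le (fun k => integral_nonneg fun x => norm_nonneg _) (fun k => ?_)
      ((summable_geometric_of_lt_one (norm_nonneg z) hz).mul_right C)
    have : ∫ x, ‖z ^ k * (F x * ex k x)‖ ∂circ ≤ ∫ _, ‖z‖ ^ k * C ∂circ := by
      refine integral_mono (h1 k).norm (integrable_const _) fun x => ?_
      change ‖z ^ k * (F x * ex k x)‖ ≤ _
      rw [norm_mul, norm_pow, norm_mul_ex]
      have := hF.bound x
      gcongr
    simpa using this
  have h3 := hasSum_integral_of_summable_integral_norm h1 h2
  simp_rw [integral_const_mul] at h3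
  have e : (fun x => ∑' k : ℕ, z ^ k * (F x * ex k x)) = fun x => F x * geo z x := by
    ext x
    have : ∀ k : ℕ, z ^ k * (F x * ex k x) = F x * (z * ex 1 x) ^ k := fun k => by
      rw [ex_natCast, mul_pow]; ring
    simp_rw [this, tsum_mul_left]
    rw [tsum_geometric_of_norm_lt_one (by rwa [norm_mul_ex]), geo]
  rwa [e] at h3

lemma coef_geo (hz : ‖z‖ < 1) (k : ℤ) :
    coef (geo z) k = if 0 ≤ k then z ^ k.toNat else 0 := by
  have h := hasSum_integral_mul_geo hz (Bdd.ex (-k))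
  simp_rw [← ex_add, integral_ex] at h
  have h1 : coef (geo z) k = ∫ x, ex (-k) x * geo z x ∂circ := by
    simp only [coef, mul_comm]
  rw [h1]
  refine h.unique ?_
  split_ifs with hk
  · convert hasSum_ite_eq k.toNat (z ^ k.toNat) using 2 with j
    by_cases hj : j = k.toNat
    · rw [if_pos hj, if_pos (by omega), hj, mul_one]
    · rw [if_neg hj, if_neg (by omega), mul_zero]
  · convert hasSum_zero using 1
    ext j
    rw [if_neg (by omega), mul_zero]

lemma integral_normSq_geo (hz : ‖z‖ < 1) :
    ∫ x, ‖geo z x‖ ^ 2 ∂circ = (1 - ‖z‖ ^ 2)⁻¹ := by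
  have h := hasSum_integral_mul_geo hz (bdd_geo hz).star
  have h1 : ∀ k : ℕ, ∫ x, conj (geo z x) * ex k x ∂circ = conj z ^ k := fun k => by
    have : ∀ x, conj (geo z x) * ex k x = conj (geo z x * ex (-(k : ℤ)) x) := fun x => by
      rw [map_mul, conj_ex, neg_neg]
    simp_rw [this]
    rw [integral_conj, ← coef, coef_geo hz]
    simp
  simp_rw [h1, ← mul_pow, Complex.mul_conj, Complex.normSq_eq_norm_sq] at h
  have hlt : ‖z‖ ^ 2 < 1 := by nlinarith [norm_nonneg z]
  have h2 := hasSum_geometric_of_lt_one (sq_nonneg ‖z‖) hlt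
  have h3 := h.unique (by
    have := Complex.hasSum_ofReal.2 h2
    simpa using this)
  have h4 : ∫ x, conj (geo z x) * geo z x ∂circ = ((∫ x, ‖geo z x‖ ^ 2 ∂circ : ℝ) : ℂ) := by
    rw [← integral_complex_ofReal]
    congr 1
    ext x
    rw [mul_comm, Complex.mul_conj, Complex.normSq_eq_norm_sq]
  rw [h4] at h3
  exact_mod_cast h3

/-- The resolvent identity `geo z x - geo z y = z (ex 1 x - ex 1 y) geo z x geo z y` is exactly the
hypothesis of `energy_le_of_kernel`, with `|z|` split evenly between the two factors `p`. -/
lemma energy_geo_le (hz : ‖z‖ < 1) (n : ℕ) :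
    energy n (geo z) ≤ 2 * (‖z‖ / (1 - ‖z‖ ^ 2)) ^ 2 := by
  have h := energy_le_of_kernel (bdd_geo hz) (p := fun x => √‖z‖ * ‖geo z x‖)
    (K := √‖z‖ * (1 - ‖z‖)⁻¹) (measurable_const.mul (bdd_geo hz).meas.norm) (fun x => by
      rw [abs_of_nonneg (by positivity)]
      gcongr
      exact (bdd_geo hz).bound x) (fun x y => by
      have hx := one_sub_mul_ex_ne_zero hz x
      have hy := one_sub_mul_ex_ne_zero hz y
      have e : geo z x - geo z y = z * (ex 1 x - ex 1 y) * geo z x * geo z y := by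
        rw [geo, geo]; field_simp; ring
      rw [e, norm_mul, norm_mul, norm_mul]
      apply le_of_eq
      have := Real.mul_self_sqrt (norm_nonneg z)
      linear_combination (-‖ex 1 x - ex 1 y‖ * ‖geo z x‖ * ‖geo z y‖) * this) n
  refine h.trans (le_of_eq ?_)
  simp_rw [mul_pow, Real.sq_sqrt (norm_nonneg z), integral_const_mul, integral_normSq_geo hz]
  rw [← div_eq_mul_inv]

/-- The Poisson kernel. -/
def pois (z : ℂ) (x : ℝ) : ℝ := (1 - ‖z‖ ^ 2) / ‖1 - z * ex 1 x‖ ^ 2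

lemma pois_eq (hz : ‖z‖ < 1) (x : ℝ) :
    (pois z x : ℂ) = geo z x + conj (geo z x) + (-1) := by
  have hx := one_sub_mul_ex_ne_zero hz x
  have hx' : conj (1 - z * ex 1 x) ≠ 0 := (map_ne_zero _).2 hx
  have h1 : ‖z‖ ^ 2 = ‖z * ex 1 x‖ ^ 2 := by rw [norm_mul_ex]
  rw [pois, h1, geo, map_inv₀]
  push_cast
  rw [← Complex.mul_conj', ← Complex.mul_conj']
  field_simp
  simp only [map_sub, map_mul, map_one]
  ring

lemma pois_nonneg (hz : ‖z‖ < 1) (x : ℝ) : 0 ≤ pois z x := by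
  have : ‖z‖ ^ 2 < 1 := by nlinarith [norm_nonneg z]
  exact div_nonneg (by linarith) (by positivity)

lemma pois_le (hz : ‖z‖ < 1) (x : ℝ) : pois z x ≤ 2 / (1 - ‖z‖) := by
  have h := (bdd_geo hz).bound x
  have h1 : 0 < 1 - ‖z‖ := by linarith
  have h2 : pois z x = (1 - ‖z‖ ^ 2) * ‖geo z x‖ ^ 2 := by
    rw [pois, geo, norm_inv, inv_pow, div_eq_mul_inv]
  rw [h2]
  calc (1 - ‖z‖ ^ 2) * ‖geo z x‖ ^ 2 ≤ (1 - ‖z‖ ^ 2) * ((1 - ‖z‖)⁻¹) ^ 2 := by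
        have : 0 ≤ 1 - ‖z‖ ^ 2 := by nlinarith [norm_nonneg z]
        gcongr
    _ = (1 + ‖z‖) / (1 - ‖z‖) := by field_simp; ring
    _ ≤ 2 / (1 - ‖z‖) := by gcongr; linarith

lemma bdd_pois (hz : ‖z‖ < 1) : Bdd (2 / (1 - ‖z‖)) (fun x => (pois z x : ℂ)) := by
  refine ⟨?_, fun x => ?_⟩
  · simp_rw [pois_eq hz]
    exact ((bdd_geo hz).meas.add (bdd_geo hz).star.meas).add measurable_const
  · rw [Complex.norm_real, Real.norm_of_nonneg (pois_nonneg hz x)]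
    exact pois_le hz x

lemma energy_pois_le (hz : ‖z‖ < 1) (n : ℕ) :
    energy n (fun x => (pois z x : ℂ)) ≤ 8 * (‖z‖ / (1 - ‖z‖ ^ 2)) ^ 2 := by
  have h1 : 0 < 1 - ‖z‖ := by linarith
  have h := energy_le (C := 2 / (1 - ‖z‖)) (a := 4) (b := 0) (bdd_pois hz)
    ((bdd_geo hz).mono (by rw [inv_eq_one_div]; gcongr; norm_num))
    ((bdd_geo hz).mono (by rw [inv_eq_one_div]; gcongr; norm_num)) n fun x y => by
      rw [pois_eq hz, pois_eq hz]
      have e : geo z x + conj (geo z x) + -1 - (geo z y + conj (geo z y) + -1)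
          = (geo z x - geo z y) + conj (geo z x - geo z y) := by rw [map_sub]; ring
      have h2 := norm_add_le (geo z x - geo z y) (conj (geo z x - geo z y))
      rw [RCLike.norm_conj] at h2
      rw [e]
      nlinarith [pow_le_pow_left₀ (norm_nonneg _) h2 2]
  have := energy_geo_le hz n
  linarith

lemma coef_pois (hz : ‖z‖ < 1) (k : ℤ) :
    coef (fun x => (pois z x : ℂ)) k = if 0 ≤ k then z ^ k.toNat else conj z ^ (-k).toNat := by
  simp_rw [pois_eq hz]
  have hc : coef (fun _ => (-1 : ℂ)) k = if k = 0 then -1 else 0 := by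
    have := coef_const_mul (-1) (fun _ => 1) k
    rw [coef_one] at this
    simpa using this
  rw [coef_add (f := fun x => geo z x + conj (geo z x)) (g := fun _ => -1)
    ((bdd_geo hz).add (bdd_geo hz).star) (Bdd.const (-1)),
    coef_add (bdd_geo hz) (bdd_geo hz).star, coef_conj, coef_geo hz, coef_geo hz, hc]
  rcases lt_trichotomy k 0 with hk | hk | hk
  · simp [hk.ne, not_le.2 hk, hk.le]
  · simp [hk]
  · simp [hk.ne', not_le.2 hk, hk.le]

end geo

end SpinNoise

end

noncomputable section

namespace SpinNoise

open Matrix ComplexConjugate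
open scoped Matrix.Norms.L2Operator

/-! ### Symbols of the covariance matrices and of the filter -/

/-- The pole of the symbol of the covariance matrix. -/
def pole (s : Sensor) (ωL Δ : ℝ) : ℂ :=
  Complex.exp (((-s.γ * Δ : ℝ) : ℂ) + (ωL * Δ : ℝ) * Complex.I)

/-- The normalized symbol of the signal part of the covariance matrix. -/
def phi (s : Sensor) (ωL Δ x : ℝ) : ℝ :=
  Δ * (s.gD ^ 2 * (s.Q / (2 * s.γ))) / (2 * s.Sph)
    * (pois (pole s ωL Δ) x + pois (pole s (-ωL) Δ) x)

/-- The normalized symbol of the covariance matrix. -/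
def symb (s : Sensor) (ωL Δ x : ℝ) : ℝ := 1 + phi s ωL Δ x

/-- The normalized covariance matrix, over the complex numbers. -/
def normCov (s : Sensor) (ωL Δ : ℝ) (n : ℕ) : Matrix (Fin n) (Fin n) ℂ :=
  ((Δ / s.Sph : ℝ) : ℂ) • (covMat s ωL Δ n).map Complex.ofReal

/-- The inverse of the normalized covariance matrix. -/
def normCovInv (s : Sensor) (ωL Δ : ℝ) (n : ℕ) : Matrix (Fin n) (Fin n) ℂ :=
  ((s.Sph / Δ : ℝ) : ℂ) • ((covMat s ωL Δ n)⁻¹).map Complex.ofReal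

lemma norm_pole (s : Sensor) (ωL Δ : ℝ) : ‖pole s ωL Δ‖ = Real.exp (-s.γ * Δ) := by
  rw [pole, Complex.norm_exp]
  simp

section

variable {s : Sensor} {Δ : ℝ}

lemma norm_pole_lt_one (hγ : 0 < s.γ) (hΔ : 0 < Δ) (ωL : ℝ) : ‖pole s ωL Δ‖ < 1 := by
  rw [norm_pole, Real.exp_lt_one_iff]
  nlinarith [mul_pos hγ hΔ]

lemma coef_pois_pole (hγ : 0 < s.γ) (hΔ : 0 < Δ) (ωL : ℝ) (k : ℤ) :
    coef (fun x => (pois (pole s ωL Δ) x : ℂ)) k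
      = Real.exp (-s.γ * |(k : ℝ)| * Δ) * Complex.exp ((k * ωL * Δ : ℝ) * Complex.I) := by
  rw [coef_pois (norm_pole_lt_one hγ hΔ ωL)]
  split_ifs with hk
  · lift k to ℕ using hk
    rw [Int.toNat_natCast, pole, ← Complex.exp_nat_mul, Complex.ofReal_exp, ← Complex.exp_add]
    congr 1
    rw [abs_of_nonneg (by positivity)]
    push_cast
    ring
  · obtain ⟨j, rfl⟩ : ∃ j : ℕ, k = -(j : ℤ) := ⟨(-k).toNat, by omega⟩
    rw [neg_neg, Int.toNat_natCast, pole, ← Complex.exp_conj, ← Complex.exp_nat_mul,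
      Complex.ofReal_exp, ← Complex.exp_add]
    congr 1
    rw [abs_of_nonpos (by simp)]
    simp only [map_add, map_mul, Complex.conj_ofReal, Complex.conj_I]
    push_cast
    ring

lemma bdd_phi_aux (hγ : 0 < s.γ) (hΔ : 0 < Δ) (ωL : ℝ) :
    Bdd (2 / (1 - Real.exp (-s.γ * Δ)) + 2 / (1 - Real.exp (-s.γ * Δ)))
      (fun x => (pois (pole s ωL Δ) x : ℂ) + pois (pole s (-ωL) Δ) x) := by
  have h1 := bdd_pois (norm_pole_lt_one hγ hΔ ωL)
  have h2 := bdd_pois (norm_pole_lt_one hγ hΔ (-ωL))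
  rw [norm_pole] at h1 h2
  exact h1.add h2

lemma ofReal_symb (s : Sensor) (ωL Δ x : ℝ) : ((symb s ωL Δ x : ℝ) : ℂ)
    = 1 + ((Δ * (s.gD ^ 2 * (s.Q / (2 * s.γ))) / (2 * s.Sph) : ℝ) : ℂ)
      * ((pois (pole s ωL Δ) x : ℂ) + pois (pole s (-ωL) Δ) x) := by
  rw [symb, phi]; push_cast; ring

/-- The poles at `±ωL` add up to the cosine of the autocovariance, and the shot noise on the
diagonal becomes the constant `1`. This normalisation is what makes the symbol at least `1`. -/
lemma toep_symb (hγ : 0 < s.γ) (hSph : 0 < s.Sph) (hΔ : 0 < Δ) (ωL : ℝ) (n : ℕ) :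
    toep n (fun x => (symb s ωL Δ x : ℂ)) = normCov s ωL Δ n := by
  have hb := bdd_phi_aux hγ hΔ ωL
  simp_rw [ofReal_symb]
  rw [toep_add (f := fun _ => 1) (g := fun x => _ * _) (Bdd.const 1) ((Bdd.const _).mul hb),
    toep_one, toep_const_mul, toep_add (bdd_pois (norm_pole_lt_one hγ hΔ ωL))
    (bdd_pois (norm_pole_lt_one hγ hΔ (-ωL)))]
  ext i j
  simp only [Matrix.add_apply, Matrix.smul_apply, toep, of_apply, coef_pois_pole hγ hΔ, normCov,
    Matrix.map_apply, covMat, autocov, Matrix.one_apply, smul_eq_mul]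
  set k : ℤ := (i : ℤ) - j with hk
  have hij : (i = j) = (k = 0) := by simp [hk, sub_eq_zero, Fin.ext_iff]
  have hcos : Complex.exp ((k * ωL * Δ : ℝ) * Complex.I)
      + Complex.exp ((k * -ωL * Δ : ℝ) * Complex.I) = 2 * (Real.cos (k * ωL * Δ) : ℂ) := by
    rw [Complex.ofReal_cos, Complex.two_cos]
    congr 2
    push_cast
    ring
  rw [← mul_add, hcos]
  simp only [hij]
  have : (Δ : ℂ) ≠ 0 := by exact_mod_cast hΔ.ne'
  have : (s.Sph : ℂ) ≠ 0 := by exact_mod_cast hSph.ne'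
  have : (s.γ : ℂ) ≠ 0 := by exact_mod_cast hγ.ne'
  split_ifs
  · push_cast
    field_simp
    ring
  · push_cast
    field_simp
    ring

lemma phi_nonneg (hγ : 0 < s.γ) (hQ : 0 < s.Q) (hSph : 0 < s.Sph) (hΔ : 0 < Δ) (ωL x : ℝ) :
    0 ≤ phi s ωL Δ x := by
  have h1 := pois_nonneg (norm_pole_lt_one hγ hΔ ωL) x
  have h2 := pois_nonneg (norm_pole_lt_one hγ hΔ (-ωL)) x
  rw [phi]
  positivity

/-- The amplitude `Δ` of the signal part compensates the approach of its pole to the unit circle.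
All uniformity in small `Δ` of the covariance symbols rests on this. -/
lemma div_one_sub_exp_le (hγ : 0 < s.γ) (hΔ : 0 < Δ) :
    Δ / (1 - Real.exp (-s.γ * Δ)) ≤ (1 + s.γ * Δ) / s.γ := by
  have h1 : Real.exp (-s.γ * Δ) < 1 := by
    rw [Real.exp_lt_one_iff]; nlinarith [mul_pos hγ hΔ]
  have h2 : Real.exp (-s.γ * Δ) * Real.exp (s.γ * Δ) = 1 := by
    rw [← Real.exp_add]; simp
  have h3 := Real.add_one_le_exp (s.γ * Δ)
  have h4 := Real.exp_pos (-s.γ * Δ)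
  rw [div_le_div_iff₀ (by linarith) hγ]
  nlinarith [mul_le_mul_of_nonneg_left h3 h4.le]

/-- Uniform bounds for the symbols and their reciprocals. -/
lemma exists_symb_bound (hγ : 0 < s.γ) (hQ : 0 < s.Q) (hSph : 0 < s.Sph) (Δ₀ : ℝ) :
    ∃ C : ℝ, 1 ≤ C ∧ ∀ ωL Δ : ℝ, 0 < Δ → Δ ≤ Δ₀ → ∀ n : ℕ,
      Bdd C (fun x => (symb s ωL Δ x : ℂ)) ∧ energy n (fun x => (symb s ωL Δ x : ℂ)) ≤ C ∧
      Bdd C (fun x => (symb s ωL Δ x : ℂ)⁻¹) ∧ energy n (fun x => (symb s ωL Δ x : ℂ)⁻¹) ≤ C := by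
  set c := (s.gD ^ 2 * (s.Q / (2 * s.γ))) / (2 * s.Sph) with hc
  have hc0 : 0 ≤ c := by positivity
  set e := (1 + s.γ * Δ₀) / s.γ with he
  -- The first entry bounds the sup norm and the second the energy; `e` bounds `Δ / (1 - exp (-γ
  -- Δ))` and neither entry involves `ωL`.
  refine ⟨max (1 + c * (e * 4)) (1 + c ^ 2 * (32 * e ^ 2)), ?_, ?_⟩
  · refine le_trans ?_ (le_max_right _ _)
    have : 0 ≤ c ^ 2 * (32 * e ^ 2) := by positivity
    linarith
  intro ωL Δ hΔ hΔ₀ n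
  have hp1 := norm_pole_lt_one hγ hΔ ωL
  have hp2 := norm_pole_lt_one hγ hΔ (-ωL)
  have hb := bdd_phi_aux hγ hΔ ωL
  have hr1 : Real.exp (-s.γ * Δ) < 1 := by rw [← norm_pole s ωL Δ]; exact hp1
  have hr0 := Real.exp_pos (-s.γ * Δ)
  have hD : Δ / (1 - Real.exp (-s.γ * Δ)) ≤ e := (div_one_sub_exp_le hγ hΔ).trans (by
    rw [he]; gcongr)
  have hDpos : 0 < Δ / (1 - Real.exp (-s.γ * Δ)) := div_pos hΔ (by linarith)
  have hsymb : ∀ x, 1 ≤ symb s ωL Δ x := fun x => by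
    have := phi_nonneg hγ hQ hSph hΔ ωL x
    rw [symb]; linarith
  have hcΔ : Δ * (s.gD ^ 2 * (s.Q / (2 * s.γ))) / (2 * s.Sph) = c * Δ := by rw [hc]; ring
  have hB : Bdd (1 + c * (e * 4)) (fun x => (symb s ωL Δ x : ℂ)) := by
    have h1 := (Bdd.const 1).add ((Bdd.const ((c * Δ : ℝ) : ℂ)).mul hb)
    simp_rw [ofReal_symb, hcΔ]
    refine h1.mono ?_
    rw [norm_one, Complex.norm_real, Real.norm_of_nonneg (by positivity)]
    have : c * Δ * (2 / (1 - Real.exp (-s.γ * Δ)) + 2 / (1 - Real.exp (-s.γ * Δ)))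
        = c * (Δ / (1 - Real.exp (-s.γ * Δ)) * 4) := by ring
    rw [this]
    gcongr
  have hE : energy n (fun x => (symb s ωL Δ x : ℂ)) ≤ c ^ 2 * (32 * e ^ 2) := by
    have hpe : ∀ ω : ℝ, energy n (fun x => (pois (pole s ω Δ) x : ℂ))
        ≤ 8 * (1 / (1 - Real.exp (-s.γ * Δ))) ^ 2 := fun ω => by
      refine (energy_pois_le (norm_pole_lt_one hγ hΔ ω) n).trans ?_
      rw [norm_pole]
      have h3 : 0 < 1 - Real.exp (-s.γ * Δ) ^ 2 := by nlinarith
      have h4 : Real.exp (-s.γ * Δ) / (1 - Real.exp (-s.γ * Δ) ^ 2)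
          ≤ 1 / (1 - Real.exp (-s.γ * Δ)) := by
        rw [div_le_div_iff₀ h3 (by linarith)]
        nlinarith
      have h5 : 0 ≤ Real.exp (-s.γ * Δ) / (1 - Real.exp (-s.γ * Δ) ^ 2) := by positivity
      gcongr
    have h1 := energy_add_le (bdd_pois hp1) (bdd_pois hp2) n
    have h2 := energy_const_mul_le hb ((c * Δ : ℝ) : ℂ) n
    have h3 := energy_add_le (Bdd.const 1) ((Bdd.const ((c * Δ : ℝ) : ℂ)).mul hb) n
    rw [energy_const] at h3
    have h0 := energy_le (b := 0) (a := 1) hB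
      (((Bdd.const ((c * Δ : ℝ) : ℂ)).mul hb).mono (D := 1 + c * (e * 4)) (by
        rw [Complex.norm_real, Real.norm_of_nonneg (by positivity)]
        have : c * Δ * (2 / (1 - Real.exp (-s.γ * Δ)) + 2 / (1 - Real.exp (-s.γ * Δ)))
            = c * (Δ / (1 - Real.exp (-s.γ * Δ)) * 4) := by ring
        rw [this]
        have : c * (Δ / (1 - Real.exp (-s.γ * Δ)) * 4) ≤ c * (e * 4) := by gcongr
        linarith)) hB n fun x y => by
          rw [ofReal_symb, ofReal_symb, hcΔ, add_sub_add_left_eq_sub]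
          simp
    rw [Complex.norm_real, Real.norm_of_nonneg (by positivity)] at h2
    have h4 : energy n (fun x => (pois (pole s ωL Δ) x : ℂ) + pois (pole s (-ωL) Δ) x)
        ≤ 32 * (1 / (1 - Real.exp (-s.γ * Δ))) ^ 2 := by
      linarith [hpe ωL, hpe (-ωL)]
    calc _ ≤ (c * Δ) ^ 2 * energy n
            (fun x => (pois (pole s ωL Δ) x : ℂ) + pois (pole s (-ωL) Δ) x) := by linarith
      _ ≤ (c * Δ) ^ 2 * (32 * (1 / (1 - Real.exp (-s.γ * Δ))) ^ 2) := by gcongr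
      _ = c ^ 2 * (32 * (Δ / (1 - Real.exp (-s.γ * Δ))) ^ 2) := by ring
      _ ≤ c ^ 2 * (32 * e ^ 2) := by gcongr
  have hC1 : (1 : ℝ) ≤ 1 + c * (e * 4) := by
    have : 0 ≤ e := hDpos.le.trans hD
    have : 0 ≤ c * (e * 4) := by positivity
    linarith
  have hBi : Bdd (1 + c * (e * 4)) (fun x => (symb s ωL Δ x : ℂ)⁻¹) := by
    refine ⟨hB.meas.inv, fun x => ?_⟩
    rw [norm_inv, Complex.norm_real, Real.norm_of_nonneg (by linarith [hsymb x])]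
    exact (inv_le_one_of_one_le₀ (hsymb x)).trans hC1
  -- Inversion is 1-Lipschitz on `[1, ∞)`, so it does not increase the energy.
  have hEi : energy n (fun x => (symb s ωL Δ x : ℂ)⁻¹) ≤ c ^ 2 * (32 * e ^ 2) := by
    have := energy_le (b := 0) (a := 1) hBi hB hB n fun x y => by
      have hx : (symb s ωL Δ x : ℂ) ≠ 0 := by
        exact_mod_cast (by linarith [hsymb x] : (0 : ℝ) < _).ne'
      have hy : (symb s ωL Δ y : ℂ) ≠ 0 := by
        exact_mod_cast (by linarith [hsymb y] : (0 : ℝ) < _).ne'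
      rw [inv_sub_inv hx hy, norm_div, norm_mul, Complex.norm_real, Complex.norm_real,
        Real.norm_of_nonneg (by linarith [hsymb x]), Real.norm_of_nonneg (by linarith [hsymb y]),
        norm_sub_rev, zero_mul, add_zero, one_mul]
      refine pow_le_pow_left₀ (by have := hsymb x; have := hsymb y; positivity) ?_ 2
      exact div_le_self (norm_nonneg _) (one_le_mul_of_one_le_of_one_le (hsymb x) (hsymb y))
    linarith
  exact ⟨hB.mono (le_max_left _ _), (by linarith : _ ≤ 1 + c ^ 2 * (32 * e ^ 2)).trans
    (le_max_right _ _), hBi.mono (le_max_left _ _),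
    (by linarith : _ ≤ 1 + c ^ 2 * (32 * e ^ 2)).trans (le_max_right _ _)⟩

lemma bdd_symb (hγ : 0 < s.γ) (hQ : 0 < s.Q) (hSph : 0 < s.Sph) (hΔ : 0 < Δ) (ωL : ℝ) :
    ∃ C, Bdd C (fun x => (symb s ωL Δ x : ℂ)) := by
  obtain ⟨C, -, h⟩ := exists_symb_bound hγ hQ hSph Δ
  exact ⟨C, (h ωL Δ hΔ le_rfl 0).1⟩

/-- The symbol is at least `1`, so the form dominates the one of symbol `1`, which is Parseval.
Positive definiteness and the norm bound for the inverse both follow. -/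
lemma sum_sq_le_re_normCov (hγ : 0 < s.γ) (hQ : 0 < s.Q) (hSph : 0 < s.Sph) (hΔ : 0 < Δ) (ωL : ℝ)
    {n : ℕ} (v : Fin n → ℂ) :
    ∑ i, ‖v i‖ ^ 2 ≤ (star v ⬝ᵥ normCov s ωL Δ n *ᵥ v).re := by
  obtain ⟨C, hC⟩ := bdd_symb hγ hQ hSph hΔ ωL
  rw [← toep_symb hγ hSph hΔ, star_dotProduct_toep_mulVec hC]
  have e : ∀ x, (symb s ωL Δ x : ℂ) * (conj (poly v x) * poly v x)
      = ((symb s ωL Δ x * ‖poly v x‖ ^ 2 : ℝ) : ℂ) := fun x => by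
    rw [mul_comm (conj _), Complex.mul_conj']; push_cast; rfl
  have hi := (hC.mul ((bdd_poly v).star.mul (bdd_poly v))).integrable.re
  simp_rw [e] at hi ⊢
  rw [integral_complex_ofReal, Complex.ofReal_re, ← integral_normSq_poly]
  refine integral_mono (integrable_normSq (bdd_poly v))
    (by simpa only [RCLike.re_eq_complex_re, Complex.ofReal_re] using hi) fun x => ?_
  have := phi_nonneg hγ hQ hSph hΔ ωL x
  change ‖poly v x‖ ^ 2 ≤ symb s ωL Δ x * ‖poly v x‖ ^ 2
  rw [symb]
  nlinarith [sq_nonneg ‖poly v x‖]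

lemma isHermitian_covMat (s : Sensor) (ωL Δ : ℝ) (n : ℕ) : (covMat s ωL Δ n).IsHermitian := by
  ext i j
  simp only [conjTranspose_apply, covMat, of_apply, star_trivial, autocov]
  have h0 : ((j : ℤ) - i = 0) = ((i : ℤ) - j = 0) := by
    simp [sub_eq_zero, eq_comm]
  have h1 : |(((j : ℤ) - i : ℤ) : ℝ)| = |(((i : ℤ) - j : ℤ) : ℝ)| := by
    push_cast; exact abs_sub_comm _ _
  have h2 : Real.cos ((((j : ℤ) - i : ℤ) : ℝ) * ωL * Δ)
      = Real.cos ((((i : ℤ) - j : ℤ) : ℝ) * ωL * Δ) := by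
    rw [← Real.cos_neg]; congr 1; push_cast; ring
  simp only [h0, h1, h2]

lemma posDef_covMat (hγ : 0 < s.γ) (hQ : 0 < s.Q) (hSph : 0 < s.Sph) (hΔ : 0 < Δ) (ωL : ℝ) (n : ℕ) :
    (covMat s ωL Δ n).PosDef := by
  refine Matrix.PosDef.of_dotProduct_mulVec_pos (isHermitian_covMat s ωL Δ n) fun {x} hx => ?_
  have h := sum_sq_le_re_normCov hγ hQ hSph hΔ ωL (fun i => (x i : ℂ))
  have e : star (fun i => (x i : ℂ)) ⬝ᵥ normCov s ωL Δ n *ᵥ (fun i => (x i : ℂ))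
      = ((Δ / s.Sph * (x ⬝ᵥ covMat s ωL Δ n *ᵥ x) : ℝ) : ℂ) := by
    simp only [normCov, dotProduct, mulVec, Matrix.smul_apply, Matrix.map_apply, Pi.star_apply,
      RCLike.star_def, Complex.conj_ofReal, smul_eq_mul]
    push_cast
    simp only [Finset.mul_sum]
    refine Finset.sum_congr rfl fun i _ => Finset.sum_congr rfl fun j _ => by ring
  rw [e, Complex.ofReal_re] at h
  have hpos : 0 < ∑ i, ‖(x i : ℂ)‖ ^ 2 := by
    obtain ⟨i, hi⟩ := Function.ne_iff.1 hx
    refine Finset.sum_pos' (fun i _ => by positivity) ⟨i, Finset.mem_univ i, ?_⟩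
    have : (x i : ℂ) ≠ 0 := by exact_mod_cast hi
    positivity
  rw [star_trivial]
  exact pos_of_mul_pos_right (hpos.trans_le h) (by positivity)

lemma normCovInv_mul_normCov (hγ : 0 < s.γ) (hQ : 0 < s.Q) (hSph : 0 < s.Sph) (hΔ : 0 < Δ)
    (ωL : ℝ) (n : ℕ) : normCovInv s ωL Δ n * normCov s ωL Δ n = 1 := by
  have h := (posDef_covMat hγ hQ hSph hΔ ωL n).isUnit
  rw [normCovInv, normCov, Matrix.smul_mul, Matrix.mul_smul, smul_smul, ← Complex.ofReal_mul,
    div_mul_div_cancel₀ hΔ.ne', div_self hSph.ne', Complex.ofReal_one, one_smul]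
  have e := (Matrix.map_mul (L := (covMat s ωL Δ n)⁻¹) (M := covMat s ωL Δ n)
    (f := Complex.ofRealHom)).symm
  rw [Matrix.nonsing_inv_mul _ ((Matrix.isUnit_iff_isUnit_det _).1 h)] at e
  refine e.trans ?_
  simp

lemma norm_normCovInv_le (hγ : 0 < s.γ) (hQ : 0 < s.Q) (hSph : 0 < s.Sph) (hΔ : 0 < Δ)
    (ωL : ℝ) (n : ℕ) : ‖normCovInv s ωL Δ n‖ ≤ 1 := by
  have hinv := mul_eq_one_comm.1 (normCovInv_mul_normCov hγ hQ hSph hΔ ωL n)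
  refine norm_le_of_forall_sum_sq zero_le_one fun w => ?_
  set v := normCovInv s ωL Δ n *ᵥ w with hv
  have hw : normCov s ωL Δ n *ᵥ v = w := by rw [hv, mulVec_mulVec, hinv, one_mulVec]
  have h := sum_sq_le_re_normCov hγ hQ hSph hΔ ωL v
  rw [hw] at h
  have h2 : (star v ⬝ᵥ w).re ≤ ∑ i, (‖v i‖ ^ 2 / 2 + ‖w i‖ ^ 2 / 2) := by
    rw [dotProduct, Complex.re_sum]
    refine Finset.sum_le_sum fun i _ => (Complex.re_le_norm _).trans ?_
    rw [norm_mul, Pi.star_apply, norm_star]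
    nlinarith [sq_nonneg (‖v i‖ - ‖w i‖)]
  rw [Finset.sum_add_distrib, ← Finset.sum_div, ← Finset.sum_div] at h2
  linarith

/-- The symbol of the filter. -/
def filtSymb (α : ℝ) (x : ℝ) : ℂ := ((√α * (1 - 1 / α) : ℝ) : ℂ) * geo α x + ((√α / α : ℝ) : ℂ)

variable {α : ℝ}

lemma norm_ofReal_lt_one (h0 : 0 < α) (h1 : α < 1) : ‖(α : ℂ)‖ < 1 := by
  rwa [Complex.norm_real, Real.norm_of_nonneg h0.le]

/-- For `k ≥ 1` the geometric part contributes `√α (1 - 1/α) α ^ k = √α (α - 1) α ^ (k - 1)`; the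
additive constant `√α / α` corrects the diagonal to `√α`. -/
lemma toep_filtSymb (h0 : 0 < α) (h1 : α < 1) (n : ℕ) :
    toep n (filtSymb α) = (filterMat α n).map Complex.ofReal := by
  have hα := norm_ofReal_lt_one h0 h1
  have hα0 : (α : ℂ) ≠ 0 := by exact_mod_cast h0.ne'
  unfold filtSymb
  rw [toep_add (f := fun x => _ * _) (g := fun _ => _) ((Bdd.const _).mul (bdd_geo hα))
    (Bdd.const _),
    toep_const_mul]
  have := toep_const_mul ((√α / α : ℝ) : ℂ) (fun _ => 1) n
  simp only [mul_one] at this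
  rw [this, toep_one]
  ext i j
  simp only [Matrix.add_apply, Matrix.smul_apply, toep, of_apply, coef_geo hα, filterMat,
    Matrix.map_apply, smul_eq_mul, Matrix.one_apply]
  rcases lt_trichotomy i j with h | h | h
  · have : ¬ (0 : ℤ) ≤ (i : ℤ) - j := by have : (i : ℕ) < j := h; omega
    simp only [if_neg this, if_neg h.ne, if_neg (not_lt.2 h.le)]
    simp
  · subst h
    simp
    field_simp
    ring
  · have h' : (j : ℕ) < i := h
    have h2 : (0 : ℤ) ≤ (i : ℤ) - j := by omega
    have h3 : ((i : ℤ) - j).toNat = (i - j - 1 : ℕ) + 1 := by omega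
    simp only [if_pos h2, if_neg h.ne', if_pos h, h3, pow_succ]
    push_cast
    field_simp
    ring

lemma filtSymb_eq (h0 : 0 < α) (h1 : α < 1) (x : ℝ) :
    filtSymb α x = (√α : ℂ) * (1 - ex 1 x) / (1 - α * ex 1 x) := by
  have h := one_sub_mul_ex_ne_zero (norm_ofReal_lt_one h0 h1) x
  have hα0 : (α : ℂ) ≠ 0 := by exact_mod_cast h0.ne'
  rw [filtSymb, geo]
  push_cast
  field_simp
  ring

/-- The gain `√α` of the filter makes the numerator `|1 - α u|² - α |1 - u|²` constant on the circle
`|u| = 1`. The result is nonnegative, which bounds the filter symbol by `1`, and it is the sampled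
form of `b² / (ω² + b²)`. -/
lemma one_sub_normSq_filtSymb (h0 : 0 < α) (h1 : α < 1) (x : ℝ) :
    1 - ‖filtSymb α x‖ ^ 2 = (1 - α) ^ 2 / ‖1 - α * ex 1 x‖ ^ 2 := by
  have h := one_sub_mul_ex_ne_zero (norm_ofReal_lt_one h0 h1) x
  have h2 : 0 < ‖1 - α * ex 1 x‖ ^ 2 := by positivity
  rw [filtSymb_eq h0 h1, norm_div, norm_mul, div_pow, mul_pow, Complex.norm_real,
    Real.norm_of_nonneg
    (Real.sqrt_nonneg _), Real.sq_sqrt h0.le, eq_div_iff h2.ne', sub_mul, div_mul_cancel₀ _ h2.ne',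
    one_mul]
  have e : ∀ a : ℝ, ‖1 - a * ex 1 x‖ ^ 2 = 1 - 2 * a * (ex 1 x).re + a ^ 2 := fun a => by
    have hn : (ex 1 x).re * (ex 1 x).re + (ex 1 x).im * (ex 1 x).im = 1 := by
      rw [← Complex.normSq_apply, Complex.normSq_eq_norm_sq, norm_ex, one_pow]
    rw [← Complex.normSq_eq_norm_sq, Complex.normSq_apply]
    simp
    linear_combination a ^ 2 * hn
  have e1 := e 1
  rw [Complex.ofReal_one, one_mul] at e1
  rw [e, e1]
  ring

lemma bdd_filtSymb (h0 : 0 < α) (h1 : α < 1) : Bdd 1 (filtSymb α) := by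
  refine ⟨?_, fun x => ?_⟩
  · exact (measurable_const.mul (bdd_geo (norm_ofReal_lt_one h0 h1)).meas).add measurable_const
  · have := one_sub_normSq_filtSymb h0 h1 x
    have h2 : 0 ≤ (1 - α) ^ 2 / ‖1 - α * ex 1 x‖ ^ 2 := by positivity
    nlinarith [norm_nonneg (filtSymb α x)]

/-- The prefactor contributes `(1 - α)² / α` and cancels the growth of the geometric energy; what
remains is `2 α / (1 + α)²`, bounded even as `α → 1`. -/
lemma energy_filtSymb_le (h0 : 0 < α) (h1 : α < 1) (n : ℕ) : energy n (filtSymb α) ≤ 2 := by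
  have hα := norm_ofReal_lt_one h0 h1
  have hnα : ‖(α : ℂ)‖ = α := by rw [Complex.norm_real, Real.norm_of_nonneg h0.le]
  have hp : 0 < (1 - α)⁻¹ := by rw [inv_pos]; linarith
  have h := energy_le (C := 1 + (1 - ‖(α : ℂ)‖)⁻¹) (b := 0) (a := (√α * (1 - 1 / α)) ^ 2)
    ((bdd_filtSymb h0 h1).mono (by rw [hnα]; linarith))
    ((bdd_geo hα).mono (by linarith)) ((bdd_geo hα).mono (by linarith)) n fun x y => by
      rw [filtSymb, filtSymb, add_sub_add_right_eq_sub, ← mul_sub, norm_mul, mul_pow,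
        Complex.norm_real, Real.norm_eq_abs, sq_abs, zero_mul, add_zero]
  have h2 := energy_geo_le hα n
  rw [hnα] at h2
  have h3 : (√α * (1 - 1 / α)) ^ 2 * (2 * (α / (1 - α ^ 2)) ^ 2) = 2 * α / (1 + α) ^ 2 := by
    have : 1 - α ≠ 0 := by linarith
    have h4 : 1 - α ^ 2 = (1 - α) * (1 + α) := by ring
    rw [mul_pow, Real.sq_sqrt h0.le, h4]
    field_simp
    ring
  have h5 : 2 * α / (1 + α) ^ 2 ≤ 2 := by
    rw [div_le_iff₀ (by positivity)]; nlinarith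
  have h6 := mul_le_mul_of_nonneg_left h2 (sq_nonneg (√α * (1 - 1 / α)))
  linarith

end

end SpinNoise

end

noncomputable section

namespace SpinNoise

open Matrix ComplexConjugate
open scoped Matrix.Norms.L2Operator

/-! ### The error as a quadratic form -/

lemma highPass_eq_sum (α : ℝ) (u : ℕ → ℝ) (k : ℕ) :
    highPass α u k = √α * u k + ∑ j ∈ Finset.range k, √α * (α - 1) * α ^ (k - j - 1) * u j := by
  induction k with
  | zero => simp [highPass]
  | succ k ih =>
    rw [highPass, ih, Finset.sum_range_succ]
    have : ∑ j ∈ Finset.range k, √α * (α - 1) * α ^ (k + 1 - j - 1) * u j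
        = α * ∑ j ∈ Finset.range k, √α * (α - 1) * α ^ (k - j - 1) * u j := by
      rw [Finset.mul_sum]
      refine Finset.sum_congr rfl fun j hj => ?_
      have hj' := Finset.mem_range.1 hj
      rw [show k + 1 - j - 1 = (k - j - 1) + 1 by omega, pow_succ]
      ring
    rw [this, show k + 1 - k - 1 = 0 by omega]
    ring

lemma filtered_eq_mulVec (α : ℝ) {n : ℕ} (x : EuclideanSpace ℝ (Fin n)) :
    (filtered α x).ofLp = filterMat α n *ᵥ x.ofLp := by
  ext i
  simp only [filtered, highPass_eq_sum, i.isLt, dif_pos, mulVec, dotProduct, filterMat, of_apply]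
  set u : ℕ → ℝ := fun k => if hk : k < n then x.ofLp ⟨k, hk⟩ else 0 with hu
  have hux : ∀ j : Fin n, x.ofLp j = u j := fun j => by simp [hu]
  set w : ℕ → ℝ := fun j => (if (i : ℕ) = j then √α
      else if j < i then √α * (α - 1) * α ^ ((i : ℕ) - j - 1) else 0) * u j with hw
  have h1 : ∀ j : Fin n, (if i = j then √α
      else if j < i then √α * (α - 1) * α ^ ((i : ℕ) - (j : ℕ) - 1) else 0) * x.ofLp j = w j := by
    intro j
    rw [hux]
    simp only [hw, Fin.ext_iff, Fin.lt_def]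
  rw [Finset.sum_congr rfl fun j _ => h1 j, ← Finset.sum_range]
  have h2 : ∑ j ∈ Finset.range n, w j = ∑ j ∈ Finset.range ((i : ℕ) + 1), w j := by
    refine (Finset.sum_subset (Finset.range_subset_range.2 (by omega)) fun j _ hj => ?_).symm
    have : ¬ j < (i : ℕ) + 1 := by simpa using hj
    simp only [hw]
    rw [if_neg (by omega), if_neg (by omega), zero_mul]
  rw [h2, Finset.sum_range_succ, add_comm]
  congr 1
  · refine Finset.sum_congr rfl fun j hj => ?_
    have := Finset.mem_range.1 hj
    simp only [hw]
    rw [if_neg (by omega), if_pos this]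
  · simp only [hw, if_true, hux]

section

variable {s : Sensor} {Δ : ℝ}

/-- Both terms use the same pair of densities, so the log-determinants cancel and only the quadratic
forms survive. -/
lemma llr_sub_llr (hγ : 0 < s.γ) (hQ : 0 < s.Q) (hSph : 0 < s.Sph) (hΔ : 0 < Δ) (ωL : Fin 2 → ℝ)
    {n : ℕ} (x y : EuclideanSpace ℝ (Fin n)) :
    llr s ωL Δ x - llr s ωL Δ y
      = 1 / 2 * (x.ofLp ⬝ᵥ llrMat s ωL Δ n *ᵥ x.ofLp)
        - 1 / 2 * (y.ofLp ⬝ᵥ llrMat s ωL Δ n *ᵥ y.ofLp) := by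
  have hpos : ∀ ω : ℝ, 0 < √((2 * Real.pi) ^ n * (covMat s ω Δ n).det) := fun ω => by
    have := (posDef_covMat hγ hQ hSph hΔ ω n).det_pos
    positivity
  have hl : ∀ (ω : ℝ) (z : EuclideanSpace ℝ (Fin n)), Real.log (gaussDensity (covMat s ω Δ n) z)
      = -(1 / 2) * (z.ofLp ⬝ᵥ (covMat s ω Δ n)⁻¹ *ᵥ z.ofLp)
        - Real.log (√((2 * Real.pi) ^ n * (covMat s ω Δ n).det)) := fun ω z => by
    rw [gaussDensity, Real.log_div (Real.exp_pos _).ne' (hpos ω).ne', Real.log_exp]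
  have hne : ∀ (ω : ℝ) (z : EuclideanSpace ℝ (Fin n)), gaussDensity (covMat s ω Δ n) z ≠ 0 :=
    fun ω z => (div_pos (Real.exp_pos _) (hpos ω)).ne'
  rw [llr, llr, Real.log_div (hne _ _) (hne _ _), Real.log_div (hne _ _) (hne _ _)]
  simp only [hl, llrMat, sub_mulVec, dotProduct_sub]
  ring

lemma filterError_eq (hγ : 0 < s.γ) (hQ : 0 < s.Q) (hSph : 0 < s.Sph) (hΔ : 0 < Δ) (ωL : Fin 2 → ℝ)
    (b : ℝ) {n : ℕ} (x : EuclideanSpace ℝ (Fin n)) :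
    filterError s ωL b Δ x = 1 / 2 * (x.ofLp ⬝ᵥ errorMat s ωL b Δ n *ᵥ x.ofLp) := by
  rw [filterError, llr_sub_llr hγ hQ hSph hΔ, filtered_eq_mulVec, errorMat, sub_mulVec,
    dotProduct_sub, mul_sub]
  congr 2
  rw [← mulVec_mulVec, ← mulVec_mulVec, Matrix.dotProduct_mulVec x.ofLp, vecMul_transpose]

lemma isHermitian_errorMat (s : Sensor) (ωL : Fin 2 → ℝ) (b Δ : ℝ) (n : ℕ) :
    (errorMat s ωL b Δ n).IsHermitian := by
  have h : (llrMat s ωL Δ n).IsHermitian :=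
    (isHermitian_covMat s (ωL 0) Δ n).inv.sub (isHermitian_covMat s (ωL 1) Δ n).inv
  have := isHermitian_conjTranspose_mul_mul (filterMat (strength b Δ) n) h
  rw [conjTranspose_eq_transpose_of_trivial] at this
  exact h.sub this

lemma cumulant_filterError (hγ : 0 < s.γ) (hQ : 0 < s.Q) (hSph : 0 < s.Sph) (hΔ : 0 < Δ)
    (ωL : Fin 2 → ℝ) (b : ℝ) (n : ℕ) (h : Fin 2) :
    0 ∈ interior (integrableExpSet (filterError s ωL b Δ (n := n)) (signalLaw s (ωL h) Δ n)) ∧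
      ∀ m : ℕ, 1 ≤ m → cumulant m (filterError s ωL b Δ (n := n)) (signalLaw s (ωL h) Δ n)
        = ((m - 1).factorial : ℝ) / 2
          * ((errorMat s ωL b Δ n * covMat s (ωL h) Δ n) ^ m).trace :=
  cumulant_quadraticForm (posDef_covMat hγ hQ hSph hΔ (ωL h) n).posSemidef
    (isHermitian_errorMat s ωL b Δ n) fun x => filterError_eq hγ hQ hSph hΔ ωL b x

lemma integral_filterError (hγ : 0 < s.γ) (hQ : 0 < s.Q) (hSph : 0 < s.Sph) (hΔ : 0 < Δ)
    (ωL : Fin 2 → ℝ) (b : ℝ) (n : ℕ) (h : Fin 2) :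
    ∫ x, filterError s ωL b Δ x ∂(signalLaw s (ωL h) Δ n)
      = cumulant 1 (filterError s ωL b Δ (n := n)) (signalLaw s (ωL h) Δ n) := by
  have : IsProbabilityMeasure (signalLaw s (ωL h) Δ n) := by
    unfold signalLaw; infer_instance
  rw [cumulant, iteratedDeriv_one, deriv_cgf_zero (cumulant_filterError hγ hQ hSph hΔ ωL b n h).1]
  simp

lemma variance_filterError (hγ : 0 < s.γ) (hQ : 0 < s.Q) (hSph : 0 < s.Sph) (hΔ : 0 < Δ)
    (ωL : Fin 2 → ℝ) (b : ℝ) (n : ℕ) (h : Fin 2) :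
    variance (filterError s ωL b Δ (n := n)) (signalLaw s (ωL h) Δ n)
      = cumulant 2 (filterError s ωL b Δ (n := n)) (signalLaw s (ωL h) Δ n) := by
  have : IsProbabilityMeasure (signalLaw s (ωL h) Δ n) := by
    unfold signalLaw; infer_instance
  have h0 := (cumulant_filterError hγ hQ hSph hΔ ωL b n h).1
  have hm : AEMeasurable (filterError s ωL b Δ (n := n)) (signalLaw s (ωL h) Δ n) := by
    rw [funext fun x => filterError_eq (n := n) hγ hQ hSph hΔ ωL b x]
    exact Continuous.aemeasurable (by fun_prop)
  rw [cumulant, iteratedDeriv_two_cgf_eq_integral h0, variance_eq_integral hm,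
    deriv_cgf_zero h0]
  simp

end

/-! ### Traces of powers up to bounded errors -/

/-- The symbol of the error matrix times the covariance matrix. -/
def errSymb (s : Sensor) (ωL : Fin 2 → ℝ) (b Δ : ℝ) (h : Fin 2) (x : ℝ) : ℝ :=
  (1 - strength b Δ) ^ 2 / ‖1 - strength b Δ * ex 1 x‖ ^ 2
    * ((symb s (ωL 0) Δ x)⁻¹ - (symb s (ωL 1) Δ x)⁻¹) * symb s (ωL h) Δ x

lemma strength_pos (b Δ : ℝ) : 0 < strength b Δ := Real.exp_pos _

lemma strength_lt_one {b Δ : ℝ} (hb : 0 < b) (hΔ : 0 < Δ) : strength b Δ < 1 := by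
  rw [strength, Real.exp_lt_one_iff]; nlinarith [mul_pos hb hΔ]

lemma map_errorMat_mul_covMat {s : Sensor} (hSph : 0 < s.Sph) (ωL : Fin 2 → ℝ) (b : ℝ)
    {Δ : ℝ} (hΔ : 0 < Δ) (n : ℕ) (h : Fin 2) :
    (errorMat s ωL b Δ n * covMat s (ωL h) Δ n).map Complex.ofReal
      = (normCovInv s (ωL 0) Δ n - normCovInv s (ωL 1) Δ n
        - ((filterMat (strength b Δ) n).map Complex.ofReal)ᴴ
          * (normCovInv s (ωL 0) Δ n - normCovInv s (ωL 1) Δ n)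
          * (filterMat (strength b Δ) n).map Complex.ofReal) * normCov s (ωL h) Δ n := by
  have hB : ((filterMat (strength b Δ) n).map Complex.ofReal)ᴴ
      = (filterMat (strength b Δ) n)ᵀ.map Complex.ofReal := by
    ext i j; simp
  have hf : ∀ A : Matrix (Fin n) (Fin n) ℝ, A.map Complex.ofReal
      = Complex.ofRealHom.mapMatrix A := fun A => rfl
  have hc : ((s.Sph / Δ : ℝ) : ℂ) * ((Δ / s.Sph : ℝ) : ℂ) = 1 := by
    rw [← Complex.ofReal_mul, div_mul_div_cancel₀ hΔ.ne', div_self hSph.ne', Complex.ofReal_one]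
  rw [hB, normCovInv, normCovInv, normCov, ← smul_sub]
  simp only [hf]
  simp only [Matrix.mul_smul, Matrix.smul_mul, ← smul_sub, smul_smul]
  rw [mul_comm, hc, one_smul]
  simp only [← map_sub, ← map_mul]
  rfl

/-- The `UApprox` calculus is applied to the polynomial expression of the error matrix in
covariances, their inverses and the filter. The constant is chosen before the Larmor frequencies,
which is what later allows a bound uniform in `ω_c`. -/
lemma exists_trace_bound {s : Sensor} (hγ : 0 < s.γ) (hQ : 0 < s.Q) (hSph : 0 < s.Sph)
    {b : ℝ} (hb : 0 < b) (Δ₀ : ℝ) (m : ℕ) :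
    ∃ C : ℝ, ∀ (ωL : Fin 2 → ℝ) (Δ : ℝ), 0 < Δ → Δ ≤ Δ₀ → ∀ (n : ℕ) (h : Fin 2),
      |((errorMat s ωL b Δ n * covMat s (ωL h) Δ n) ^ m).trace
        - n * ∫ x, errSymb s ωL b Δ h x ^ m ∂circ| ≤ C := by
  obtain ⟨C₀, hC₀, hsy⟩ := exists_symb_bound hγ hQ hSph Δ₀
  -- All parameters form one index set, so that each operation of the calculus yields a single
  -- constant for all of them.
  let ι := (Fin 2 → ℝ) × Ioc 0 Δ₀ × ℕ × Fin 2
  let N : ι → ℕ := fun i => i.2.2.1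
  have hcov : ∀ k : ι → Fin 2, UApprox N (fun i => normCov s (i.1 (k i)) i.2.1 i.2.2.1)
      (fun i x => (symb s (i.1 (k i)) i.2.1 x : ℂ)) := fun k => ⟨C₀, fun i => by
    obtain ⟨h1, h2, -, -⟩ := hsy (i.1 (k i)) i.2.1 i.2.1.2.1 i.2.1.2.2 i.2.2.1
    beta_reduce
    rw [← toep_symb hγ hSph i.2.1.2.1]
    exact Approx.toep (by linarith) h1 h2⟩
  have hinv : ∀ k : Fin 2, UApprox N (fun i => normCovInv s (i.1 k) i.2.1 i.2.2.1)
      (fun i x => (symb s (i.1 k) i.2.1 x : ℂ)⁻¹) := fun k => ⟨C₀ ^ 2, fun i => by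
    obtain ⟨h1, h2, h3, h4⟩ := hsy (i.1 k) i.2.1 i.2.1.2.1 i.2.1.2.2 i.2.2.1
    refine Approx.inv hC₀ h1 h3 (fun x => ?_) h2 h4 ?_ ?_
    · have := phi_nonneg hγ hQ hSph i.2.1.2.1 (i.1 k) x
      refine mul_inv_cancel₀ ?_
      rw [symb]
      exact_mod_cast (by linarith : (0 : ℝ) < _).ne'
    · rw [toep_symb hγ hSph i.2.1.2.1]
      exact normCovInv_mul_normCov hγ hQ hSph i.2.1.2.1 _ _
    · exact (norm_normCovInv_le hγ hQ hSph i.2.1.2.1 _ _).trans hC₀⟩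
  have hα := fun i : ι => strength_lt_one hb i.2.1.2.1
  have hB : UApprox N (fun i => (filterMat (strength b i.2.1) i.2.2.1).map Complex.ofReal)
      (fun i => filtSymb (strength b i.2.1)) := ⟨2, fun i => by
    beta_reduce
    rw [← toep_filtSymb (strength_pos _ _) (hα i)]
    exact Approx.toep two_pos ((bdd_filtSymb (strength_pos _ _) (hα i)).mono one_le_two)
      (energy_filtSymb_le (strength_pos _ _) (hα i) _)⟩
  have hB' : UApprox N (fun i => ((filterMat (strength b i.2.1) i.2.2.1).map Complex.ofReal)ᴴ)
      (fun i x => conj (filtSymb (strength b i.2.1) x)) := ⟨2, fun i => by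
    beta_reduce
    rw [← toep_filtSymb (strength_pos _ _) (hα i), ← toep_conj]
    have hbd := bdd_filtSymb (strength_pos b i.2.1) (hα i)
    exact Approx.toep two_pos (hbd.star.mono one_le_two)
      ((energy_conj_le hbd _).trans (energy_filtSymb_le (strength_pos _ _) (hα i) _))⟩
  have hG := (hinv 0).sub (hinv 1)
  obtain ⟨C, hC⟩ := ((hG.sub ((hB'.mul hG).mul hB)).mul (hcov fun i => i.2.2.2)).pow m
  refine ⟨C, fun ωL Δ hΔ hΔ₀ n h => ?_⟩
  have h1 := (hC (ωL, ⟨Δ, hΔ, hΔ₀⟩, n, h)).trace_sub_le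
  simp only [N] at h1
  rw [← map_errorMat_mul_covMat hSph ωL b hΔ n h] at h1
  have e : ∀ x, ((((symb s (ωL 0) Δ x : ℂ)⁻¹ - (symb s (ωL 1) Δ x : ℂ)⁻¹
      - conj (filtSymb (strength b Δ) x) * ((symb s (ωL 0) Δ x : ℂ)⁻¹ - (symb s (ωL 1) Δ x : ℂ)⁻¹)
        * filtSymb (strength b Δ) x) * (symb s (ωL h) Δ x : ℂ)) ^ m)
      = ((errSymb s ωL b Δ h x ^ m : ℝ) : ℂ) := fun x => by
    rw [errSymb, ← one_sub_normSq_filtSymb (strength_pos _ _) (strength_lt_one hb hΔ)]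
    push_cast
    rw [← Complex.mul_conj']
    ring
  simp_rw [e] at h1
  rw [integral_complex_ofReal] at h1
  have e2 : ((errorMat s ωL b Δ n * covMat s (ωL h) Δ n).map Complex.ofReal ^ m).trace
      = (((errorMat s ωL b Δ n * covMat s (ωL h) Δ n) ^ m).trace : ℂ) := by
    have hf : ∀ A : Matrix (Fin n) (Fin n) ℝ, A.map Complex.ofReal
      = Complex.ofRealHom.mapMatrix A := fun A => rfl
    rw [hf, ← map_pow, ← hf]
    simp [Matrix.trace]
  rw [e2] at h1
  rw [← Real.norm_eq_abs, ← Complex.norm_real]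
  push_cast at h1 ⊢
  exact h1

end SpinNoise

end

noncomputable section

namespace SpinNoise

/-! ### Comparison of the sampled and the continuous spectra -/

lemma sinh_le_mul_cosh {v : ℝ} (hv : 0 ≤ v) : Real.sinh v ≤ v * Real.cosh v := by
  have h := (convex_Icc 0 v).image_sub_le_mul_sub_of_deriv_le (f := Real.sinh) (C := Real.cosh v)
    Real.continuous_sinh.continuousOn Real.differentiable_sinh.differentiableOn (fun x hx => by
      rw [interior_Icc] at hx
      rw [Real.deriv_sinh, Real.cosh_le_cosh, abs_of_pos hx.1, abs_of_nonneg hv]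
      exact hx.2.le) 0 ⟨le_rfl, hv⟩ v ⟨hv, le_rfl⟩ hv
  rw [Real.sinh_zero] at h
  linarith

/-- The sampled version of `a ^ 2` in Lorentzians. -/
def sampSinh (a Δ : ℝ) : ℝ := (2 * Real.sinh (a * Δ / 2) / Δ) ^ 2

/-- The sampled version of `y ^ 2` in Lorentzians. -/
def sampSin (y Δ : ℝ) : ℝ := (2 * Real.sin (y * Δ / 2) / Δ) ^ 2

lemma sampSin_nonneg (y Δ : ℝ) : 0 ≤ sampSin y Δ := sq_nonneg _

section

variable {a Δ Δ₀ : ℝ}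

lemma sq_le_sampSinh (ha : 0 < a) (hΔ : 0 < Δ) : a ^ 2 ≤ sampSinh a Δ := by
  have h := Real.self_le_sinh_iff.2 (by positivity : 0 ≤ a * Δ / 2)
  refine pow_le_pow_left₀ ha.le ?_ 2
  rw [le_div_iff₀ hΔ]
  linarith

lemma cosh_le_of_le (ha : 0 < a) (hΔ : 0 < Δ) (hΔ₀ : Δ ≤ Δ₀) {c : ℝ} (hc0 : 0 ≤ c) (hc : c ≤ 1) :
    Real.cosh (c * (a * Δ)) ≤ Real.cosh (a * Δ₀) := by
  have h0 : 0 < Δ₀ := hΔ.trans_le hΔ₀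
  rw [Real.cosh_le_cosh, abs_of_nonneg (by positivity), abs_of_nonneg (by positivity)]
  calc c * (a * Δ) ≤ 1 * (a * Δ₀) := by gcongr
    _ = a * Δ₀ := one_mul _

lemma sinh_le (ha : 0 < a) (hΔ : 0 < Δ) (hΔ₀ : Δ ≤ Δ₀) :
    Real.sinh (a * Δ / 2) ≤ a * Δ / 2 * Real.cosh (a * Δ₀) := by
  refine (sinh_le_mul_cosh (by positivity)).trans ?_
  have := cosh_le_of_le ha hΔ hΔ₀ (c := 1 / 2) (by norm_num) (by norm_num)
  rw [show 1 / 2 * (a * Δ) = a * Δ / 2 by ring] at this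
  gcongr

lemma sampSinh_le (ha : 0 < a) (hΔ : 0 < Δ) (hΔ₀ : Δ ≤ Δ₀) :
    sampSinh a Δ ≤ a ^ 2 + Real.cosh (a * Δ₀) ^ 2 * a ^ 4 * Δ ^ 2 := by
  set v := a * Δ / 2 with hv
  have hv0 : 0 ≤ v := by positivity
  have h1 := sinh_le_mul_cosh hv0
  have h2 := sinh_le ha hΔ hΔ₀
  rw [← hv] at h2
  have h3 : 0 ≤ Real.sinh v := Real.sinh_nonneg_iff.2 hv0
  have h4 : Real.sinh v ^ 2 ≤ v ^ 2 + v ^ 4 * Real.cosh (a * Δ₀) ^ 2 := by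
    have e1 : Real.sinh v ^ 2 ≤ (v * Real.cosh v) ^ 2 := pow_le_pow_left₀ h3 h1 2
    have e2 : Real.sinh v ^ 2 ≤ (v * Real.cosh (a * Δ₀)) ^ 2 := pow_le_pow_left₀ h3 h2 2
    have e3 := Real.cosh_sq v
    nlinarith [mul_le_mul_of_nonneg_left e2 (sq_nonneg v)]
  have e : sampSinh a Δ = 4 / Δ ^ 2 * Real.sinh v ^ 2 := by rw [sampSinh]; ring
  have e' : a ^ 2 + Real.cosh (a * Δ₀) ^ 2 * a ^ 4 * Δ ^ 2 / 4
      = 4 / Δ ^ 2 * (v ^ 2 + v ^ 4 * Real.cosh (a * Δ₀) ^ 2) := by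
    rw [hv]; field_simp; ring
  have h5 : sampSinh a Δ ≤ a ^ 2 + Real.cosh (a * Δ₀) ^ 2 * a ^ 4 * Δ ^ 2 / 4 := by
    rw [e, e']; gcongr
  have : 0 ≤ Real.cosh (a * Δ₀) ^ 2 * a ^ 4 * Δ ^ 2 := by positivity
  linarith

lemma le_sinh_div (hΔ : 0 < Δ) (ha : 0 < a) : a ≤ Real.sinh (a * Δ) / Δ := by
  rw [le_div_iff₀ hΔ]
  exact Real.self_le_sinh_iff.2 (by positivity)

lemma sinh_div_le (ha : 0 < a) (hΔ : 0 < Δ) (hΔ₀ : Δ ≤ Δ₀) :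
    Real.sinh (a * Δ) / Δ ≤ a + Real.cosh (a * Δ₀) ^ 2 * a ^ 3 * Δ ^ 2 := by
  rw [div_le_iff₀ hΔ]
  have h1 := sinh_le_mul_cosh (by positivity : 0 ≤ a * Δ)
  have h2 := sinh_le ha hΔ hΔ₀
  have h3 : 0 ≤ Real.sinh (a * Δ / 2) := Real.sinh_nonneg_iff.2 (by positivity)
  have h4 : Real.cosh (a * Δ) = 1 + 2 * Real.sinh (a * Δ / 2) ^ 2 := by
    have := Real.cosh_two_mul (a * Δ / 2)
    rw [Real.cosh_sq] at this
    rw [show 2 * (a * Δ / 2) = a * Δ by ring] at this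
    linarith
  have h5 := pow_le_pow_left₀ h3 h2 2
  calc Real.sinh (a * Δ) ≤ a * Δ * (1 + 2 * Real.sinh (a * Δ / 2) ^ 2) := by rw [← h4]; exact h1
    _ ≤ a * Δ * (1 + 2 * (a * Δ / 2 * Real.cosh (a * Δ₀)) ^ 2) := by gcongr
    _ = a * Δ + Real.cosh (a * Δ₀) ^ 2 * a ^ 3 * Δ ^ 2 * Δ / 2 := by ring
    _ ≤ (a + Real.cosh (a * Δ₀) ^ 2 * a ^ 3 * Δ ^ 2) * Δ := by
      have : 0 ≤ Real.cosh (a * Δ₀) ^ 2 * a ^ 3 * Δ ^ 2 * Δ := by positivity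
      linarith

lemma sampSin_le (hΔ : 0 < Δ) (y : ℝ) : sampSin y Δ ≤ y ^ 2 := by
  have h : Real.sin (y * Δ / 2) ^ 2 ≤ (y * Δ / 2) ^ 2 :=
    sq_le_sq.2 Real.abs_sin_le_abs
  have e : sampSin y Δ = 4 / Δ ^ 2 * Real.sin (y * Δ / 2) ^ 2 := by rw [sampSin]; ring
  rw [e]
  calc 4 / Δ ^ 2 * Real.sin (y * Δ / 2) ^ 2 ≤ 4 / Δ ^ 2 * (y * Δ / 2) ^ 2 := by gcongr
    _ = y ^ 2 := by field_simp; ring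

lemma sin_sq_ge {u : ℝ} (hu : |u| ≤ 1) : u ^ 2 - u ^ 4 ≤ Real.sin u ^ 2 := by
  rcases eq_or_ne u 0 with rfl | h0
  · simp
  have hpos : 0 < |u| := abs_pos.2 h0
  have h := Real.sin_gt_sub_cube hpos
  have h1 : 0 ≤ |u| - |u| ^ 3 / 6 := by
    have : |u| ^ 3 ≤ |u| := by
      calc |u| ^ 3 = |u| * |u| ^ 2 := by ring
        _ ≤ |u| * 1 := by gcongr; exact pow_le_one₀ hpos.le hu
        _ = |u| := mul_one _
    linarith
  have h2 := pow_le_pow_left₀ h1 h.le 2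
  have h3 : Real.sin |u| ^ 2 = Real.sin u ^ 2 := by
    rcases abs_cases u with ⟨h, -⟩ | ⟨h, -⟩ <;> rw [h]
    rw [Real.sin_neg, neg_sq]
  rw [h3] at h2
  have h4 : |u| ^ 2 = u ^ 2 := sq_abs u
  have h5 : (|u| - |u| ^ 3 / 6) ^ 2 = |u| ^ 2 - (|u| ^ 2) ^ 2 / 3 + (|u| ^ 2) ^ 3 / 36 := by ring
  rw [h5, h4] at h2
  nlinarith [sq_nonneg (u ^ 2), sq_nonneg u, pow_nonneg (sq_nonneg u) 3]

lemma sampSin_ge (hΔ : 0 < Δ) {y : ℝ} (hy : |y * Δ| ≤ 2) :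
    y ^ 2 - y ^ 4 * Δ ^ 2 / 4 ≤ sampSin y Δ := by
  have hu : |y * Δ / 2| ≤ 1 := by rw [abs_div, abs_two]; linarith
  have e : sampSin y Δ = 4 / Δ ^ 2 * Real.sin (y * Δ / 2) ^ 2 := by rw [sampSin]; ring
  rw [e]
  calc y ^ 2 - y ^ 4 * Δ ^ 2 / 4 = 4 / Δ ^ 2 * ((y * Δ / 2) ^ 2 - (y * Δ / 2) ^ 4) := by
        field_simp; ring
    _ ≤ _ := by gcongr; exact sin_sq_ge hu

/-- Jordan's inequality holds up to the Nyquist frequency. It preserves the `ω⁻²` decay of the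
filter response on the whole sampled band. -/
lemma le_sampSin (hΔ : 0 < Δ) {y : ℝ} (hy : |y * Δ| ≤ Real.pi) :
    4 / Real.pi ^ 2 * y ^ 2 ≤ sampSin y Δ := by
  have hu : |y * Δ / 2| ≤ Real.pi / 2 := by rw [abs_div, abs_two]; linarith
  have h := Real.mul_le_sin (abs_nonneg _) hu
  have h2 := pow_le_pow_left₀ (by have := Real.pi_pos; positivity) h 2
  have h3 : Real.sin |y * Δ / 2| ^ 2 = Real.sin (y * Δ / 2) ^ 2 := by
    rcases abs_cases (y * Δ / 2) with ⟨h, -⟩ | ⟨h, -⟩ <;> rw [h]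
    rw [Real.sin_neg, neg_sq]
  have e : sampSin y Δ = 4 / Δ ^ 2 * Real.sin (y * Δ / 2) ^ 2 := by rw [sampSin]; ring
  rw [h3, mul_pow, sq_abs] at h2
  rw [e]
  calc 4 / Real.pi ^ 2 * y ^ 2 = 4 / Δ ^ 2 * ((2 / Real.pi) ^ 2 * (y * Δ / 2) ^ 2) := by
        field_simp
    _ ≤ _ := by gcongr

lemma sq_div_four_le_sampSin (hΔ : 0 < Δ) {y : ℝ} (hy : |y * Δ| ≤ 2) :
    y ^ 2 / 4 ≤ sampSin y Δ := by
  refine le_trans ?_ (le_sampSin hΔ (hy.trans Real.two_le_pi))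
  have h : Real.pi ^ 2 ≤ 16 := by nlinarith [Real.pi_le_four, Real.pi_pos]
  have : (1 : ℝ) / 4 ≤ 4 / Real.pi ^ 2 := by
    rw [div_le_div_iff₀ (by norm_num) (by have := Real.pi_pos; positivity)]; linarith
  nlinarith [sq_nonneg y]

/-- The sampled Lorentzian is close to the Lorentzian. -/
lemma abs_sampled_lorentzian_sub_le (ha : 0 < a) (hΔ : 0 < Δ) (hΔ₀ : Δ ≤ Δ₀) {y : ℝ}
    (hy : |y * Δ| ≤ 2) :
    |Real.sinh (a * Δ) / Δ / (sampSinh a Δ + sampSin y Δ) - a / (a ^ 2 + y ^ 2)|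
      ≤ 4 * (2 * Real.cosh (a * Δ₀) ^ 2 + 1) * a * Δ ^ 2 := by
  set K := Real.cosh (a * Δ₀) ^ 2 with hK
  set p := sampSinh a Δ
  set q := sampSin y Δ
  set t := Real.sinh (a * Δ) / Δ
  have hK0 : 0 ≤ K := sq_nonneg _
  have hp1 : a ^ 2 ≤ p := sq_le_sampSinh ha hΔ
  have hp2 : p ≤ a ^ 2 + K * a ^ 4 * Δ ^ 2 := sampSinh_le ha hΔ hΔ₀
  have ht1 : a ≤ t := le_sinh_div hΔ ha
  have ht2 : t ≤ a + K * a ^ 3 * Δ ^ 2 := sinh_div_le ha hΔ hΔ₀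
  have hq1 : y ^ 2 / 4 ≤ q := sq_div_four_le_sampSin hΔ hy
  have hq2 : y ^ 2 - y ^ 4 * Δ ^ 2 / 4 ≤ q := sampSin_ge hΔ hy
  have hq3 : q ≤ y ^ 2 := sampSin_le hΔ y
  have hay : 0 < a ^ 2 + y ^ 2 := by positivity
  have hpq : (a ^ 2 + y ^ 2) / 4 ≤ p + q := by nlinarith
  have hpq0 : 0 < p + q := by linarith
  have e : t / (p + q) - a / (a ^ 2 + y ^ 2)
      = ((t - a) * (a ^ 2 + y ^ 2) - a * (p - a ^ 2) + a * (y ^ 2 - q))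
        / ((p + q) * (a ^ 2 + y ^ 2)) := by
    field_simp
    ring
  -- The numerator is allowed `(a ^ 2 + y ^ 2) ^ 2`, which the denominator `(p + q) (a ^ 2 + y ^ 2)`
  -- dominates up to the factor `4`; hence an error uniform in `y`.
  have hnum : |(t - a) * (a ^ 2 + y ^ 2) - a * (p - a ^ 2) + a * (y ^ 2 - q)|
      ≤ (2 * K + 1) * a * Δ ^ 2 * (a ^ 2 + y ^ 2) ^ 2 := by
    have n1 : (t - a) * (a ^ 2 + y ^ 2) ≤ K * a ^ 3 * Δ ^ 2 * (a ^ 2 + y ^ 2) := by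
      gcongr; linarith
    have n1' : 0 ≤ (t - a) * (a ^ 2 + y ^ 2) := mul_nonneg (by linarith) hay.le
    have n2 : a * (p - a ^ 2) ≤ a * (K * a ^ 4 * Δ ^ 2) := by gcongr; linarith
    have n2' : 0 ≤ a * (p - a ^ 2) := mul_nonneg ha.le (by linarith)
    have n3 : a * (y ^ 2 - q) ≤ a * (y ^ 4 * Δ ^ 2 / 4) := by gcongr; linarith
    have n3' : 0 ≤ a * (y ^ 2 - q) := mul_nonneg ha.le (by linarith)
    have m1 : K * a ^ 3 * Δ ^ 2 * (a ^ 2 + y ^ 2) ≤ K * a * Δ ^ 2 * (a ^ 2 + y ^ 2) ^ 2 := by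
      have : 0 ≤ K * a * Δ ^ 2 * (a ^ 2 + y ^ 2) * y ^ 2 := by positivity
      nlinarith
    have m2 : a * (K * a ^ 4 * Δ ^ 2) ≤ K * a * Δ ^ 2 * (a ^ 2 + y ^ 2) ^ 2 := by
      have : 0 ≤ K * a * Δ ^ 2 * (2 * a ^ 2 * y ^ 2 + y ^ 4) := by positivity
      nlinarith
    have m3 : a * (y ^ 4 * Δ ^ 2 / 4) ≤ a * Δ ^ 2 * (a ^ 2 + y ^ 2) ^ 2 := by
      have : 0 ≤ a * Δ ^ 2 * (2 * a ^ 2 * y ^ 2 + a ^ 4 + 3 / 4 * y ^ 4) := by positivity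
      nlinarith
    rw [abs_le]
    constructor <;> linarith
  rw [e, abs_div, abs_of_pos (mul_pos hpq0 hay), div_le_iff₀ (mul_pos hpq0 hay)]
  refine hnum.trans ?_
  calc (2 * K + 1) * a * Δ ^ 2 * (a ^ 2 + y ^ 2) ^ 2
      = 4 * (2 * K + 1) * a * Δ ^ 2 * ((a ^ 2 + y ^ 2) / 4 * (a ^ 2 + y ^ 2)) := by ring
    _ ≤ _ := by gcongr

/-- The sampled filter response is close to the continuous one. -/
lemma abs_sampled_filter_sub_le (ha : 0 < a) (hΔ : 0 < Δ) (hΔ₀ : Δ ≤ Δ₀) {y : ℝ}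
    (hy : |y * Δ| ≤ 2) :
    |sampSinh a Δ / (sampSinh a Δ + sampSin y Δ) - a ^ 2 / (y ^ 2 + a ^ 2)|
      ≤ 4 * (Real.cosh (a * Δ₀) ^ 2 + 1) * a ^ 2 * Δ ^ 2 := by
  set K := Real.cosh (a * Δ₀) ^ 2 with hK
  set p := sampSinh a Δ
  set q := sampSin y Δ
  have hK0 : 0 ≤ K := sq_nonneg _
  have hp1 : a ^ 2 ≤ p := sq_le_sampSinh ha hΔ
  have hp2 : p ≤ a ^ 2 + K * a ^ 4 * Δ ^ 2 := sampSinh_le ha hΔ hΔ₀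
  have hq1 : y ^ 2 / 4 ≤ q := sq_div_four_le_sampSin hΔ hy
  have hq2 : y ^ 2 - y ^ 4 * Δ ^ 2 / 4 ≤ q := sampSin_ge hΔ hy
  have hq3 : q ≤ y ^ 2 := sampSin_le hΔ y
  have hay : 0 < y ^ 2 + a ^ 2 := by positivity
  have hpq : (y ^ 2 + a ^ 2) / 4 ≤ p + q := by nlinarith
  have hpq0 : 0 < p + q := by linarith
  have e : p / (p + q) - a ^ 2 / (y ^ 2 + a ^ 2)
      = ((p - a ^ 2) * y ^ 2 + a ^ 2 * (y ^ 2 - q)) / ((p + q) * (y ^ 2 + a ^ 2)) := by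
    field_simp
    ring
  have hnum : |(p - a ^ 2) * y ^ 2 + a ^ 2 * (y ^ 2 - q)|
      ≤ (K + 1) * a ^ 2 * Δ ^ 2 * (y ^ 2 + a ^ 2) ^ 2 := by
    have n1 : (p - a ^ 2) * y ^ 2 ≤ K * a ^ 4 * Δ ^ 2 * y ^ 2 := by gcongr; linarith
    have n1' : 0 ≤ (p - a ^ 2) * y ^ 2 := mul_nonneg (by linarith) (sq_nonneg _)
    have n3 : a ^ 2 * (y ^ 2 - q) ≤ a ^ 2 * (y ^ 4 * Δ ^ 2 / 4) := by gcongr; linarith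
    have n3' : 0 ≤ a ^ 2 * (y ^ 2 - q) := mul_nonneg (sq_nonneg _) (by linarith)
    have m1 : K * a ^ 4 * Δ ^ 2 * y ^ 2 ≤ K * a ^ 2 * Δ ^ 2 * (y ^ 2 + a ^ 2) ^ 2 := by
      have : 0 ≤ K * a ^ 2 * Δ ^ 2 * (y ^ 4 + a ^ 2 * y ^ 2 + a ^ 4) := by positivity
      nlinarith
    have m3 : a ^ 2 * (y ^ 4 * Δ ^ 2 / 4) ≤ a ^ 2 * Δ ^ 2 * (y ^ 2 + a ^ 2) ^ 2 := by
      have : 0 ≤ a ^ 2 * Δ ^ 2 * (2 * a ^ 2 * y ^ 2 + a ^ 4 + 3 / 4 * y ^ 4) := by positivity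
      nlinarith
    rw [abs_le]
    constructor <;> linarith
  rw [e, abs_div, abs_of_pos (mul_pos hpq0 hay), div_le_iff₀ (mul_pos hpq0 hay)]
  refine hnum.trans ?_
  calc (K + 1) * a ^ 2 * Δ ^ 2 * (y ^ 2 + a ^ 2) ^ 2
      = 4 * (K + 1) * a ^ 2 * Δ ^ 2 * ((y ^ 2 + a ^ 2) / 4 * (y ^ 2 + a ^ 2)) := by ring
    _ ≤ _ := by gcongr

end

/-- Half-angle formulas turn the distance to a pole into a sum of squares. With `a` and `x + ψ`
proportional to `Δ`, this becomes the denominator of a Lorentzian as `Δ → 0`. -/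
lemma normSq_one_sub_exp_mul_ex (a ψ x : ℝ) :
    ‖1 - Complex.exp (((-a : ℝ) : ℂ) + (ψ : ℝ) * Complex.I) * ex 1 x‖ ^ 2
      = 4 * Real.exp (-a) * (Real.sinh (a / 2) ^ 2 + Real.sin ((x + ψ) / 2) ^ 2) := by
  have e : Complex.exp (((-a : ℝ) : ℂ) + (ψ : ℝ) * Complex.I) * ex 1 x
      = (Real.exp (-a) : ℂ) * Complex.exp (((x + ψ : ℝ) : ℂ) * Complex.I) := by
    rw [ex, ← Complex.exp_add, Complex.ofReal_exp, ← Complex.exp_add]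
    congr 1
    push_cast
    ring
  rw [e, Complex.exp_mul_I, ← Complex.ofReal_cos, ← Complex.ofReal_sin,
    ← Complex.normSq_eq_norm_sq, Complex.normSq_apply]
  simp only [Complex.sub_re, Complex.sub_im, Complex.one_re, Complex.one_im, Complex.mul_re,
    Complex.mul_im, Complex.add_re, Complex.add_im, Complex.ofReal_re, Complex.ofReal_im,
    Complex.I_re, Complex.I_im]
  have h1 := Real.cosh_two_mul (a / 2)
  rw [Real.cosh_sq, show 2 * (a / 2) = a by ring, Real.cosh_eq] at h1
  have h2 := Real.sin_sq_eq_half_sub ((x + ψ) / 2)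
  rw [show 2 * ((x + ψ) / 2) = x + ψ by ring] at h2
  have h3 := Real.sin_sq_add_cos_sq (x + ψ)
  have h4 : Real.exp a * Real.exp (-a) = 1 := by rw [← Real.exp_add]; simp
  rw [h2]
  linear_combination (Real.exp (-a)) ^ 2 * h3 + 2 * Real.exp (-a) * h1 - h4

lemma pois_pole_eq (s : Sensor) {Δ : ℝ} (hΔ : 0 < Δ) (ωL ω : ℝ) :
    Δ * pois (pole s ωL Δ) (ω * Δ)
      = 2 * (Real.sinh (s.γ * Δ) / Δ / (sampSinh s.γ Δ + sampSin (ω + ωL) Δ)) := by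
  have h := normSq_one_sub_exp_mul_ex (s.γ * Δ) (ωL * Δ) (ω * Δ)
  rw [show -(s.γ * Δ) = -s.γ * Δ by ring] at h
  rw [pois, norm_pole, pole, h, sampSinh, sampSin, Real.sinh_eq (s.γ * Δ),
    show ω * Δ + ωL * Δ = (ω + ωL) * Δ by ring, ← neg_mul]
  have h4 : Real.exp (-s.γ * Δ) * Real.exp (s.γ * Δ) = 1 := by rw [← Real.exp_add]; simp
  have h5 : 1 - Real.exp (-s.γ * Δ) ^ 2
      = Real.exp (-s.γ * Δ) * (Real.exp (s.γ * Δ) - Real.exp (-s.γ * Δ)) := by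
    linear_combination -h4
  rw [h5]
  set S := Real.sinh (s.γ * Δ / 2) ^ 2 + Real.sin ((ω + ωL) * Δ / 2) ^ 2 with hS
  have e1 : (2 * Real.sinh (s.γ * Δ / 2) / Δ) ^ 2 + (2 * Real.sin ((ω + ωL) * Δ / 2) / Δ) ^ 2
      = 4 / Δ ^ 2 * S := by rw [hS]; ring
  rw [e1]
  have := (Real.exp_pos (-s.γ * Δ)).ne'
  -- No sign of `γ` is assumed, so the denominator may vanish; both sides are then `0` by the
  -- convention for division.
  rcases eq_or_ne S 0 with h0 | h0
  · simp [h0]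
  · field_simp

lemma filter_response_eq {b Δ : ℝ} (hΔ : 0 < Δ) (ω : ℝ) :
    (1 - strength b Δ) ^ 2 / ‖1 - strength b Δ * ex 1 (ω * Δ)‖ ^ 2
      = sampSinh b Δ / (sampSinh b Δ + sampSin ω Δ) := by
  have h := normSq_one_sub_exp_mul_ex (b * Δ) 0 (ω * Δ)
  rw [Complex.ofReal_zero, zero_mul, add_zero, ← Complex.ofReal_exp,
    show -(b * Δ) = -b * Δ by ring, add_zero] at h
  rw [strength, h, sampSinh, sampSin]
  have h4 : Real.exp (-b * Δ) * Real.exp (b * Δ) = 1 := by rw [← Real.exp_add]; simp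
  have h1 := Real.cosh_two_mul (b * Δ / 2)
  rw [Real.cosh_sq, show 2 * (b * Δ / 2) = b * Δ by ring, Real.cosh_eq, ← neg_mul] at h1
  have h5 : (1 - Real.exp (-b * Δ)) ^ 2
      = 4 * Real.exp (-b * Δ) * Real.sinh (b * Δ / 2) ^ 2 := by
    linear_combination -h4 + 2 * Real.exp (-b * Δ) * h1
  rw [h5]
  have := (Real.exp_pos (-b * Δ)).ne'
  set S := Real.sinh (b * Δ / 2) ^ 2 + Real.sin (ω * Δ / 2) ^ 2 with hS
  have e1 : (2 * Real.sinh (b * Δ / 2) / Δ) ^ 2 + (2 * Real.sin (ω * Δ / 2) / Δ) ^ 2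
      = 4 / Δ ^ 2 * S := by rw [hS]; ring
  rw [e1]
  rcases eq_or_ne S 0 with h0 | h0
  · simp [h0]
  · field_simp
    norm_num

end SpinNoise

end

/-! ### The error symbol against the continuous integrand -/

noncomputable section

namespace SpinNoise

/-- The signal part of the continuous-time spectral density, relative to the shot noise. -/
def phiBar (s : Sensor) (ωL ω : ℝ) : ℝ :=
  s.gD ^ 2 * (s.Q / (2 * s.γ)) / s.Sph
    * (s.γ / (s.γ ^ 2 + (ω + ωL) ^ 2) + s.γ / (s.γ ^ 2 + (ω + -ωL) ^ 2))

section

variable {s : Sensor}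

lemma psd_eq (hγ : 0 < s.γ) (hSph : 0 < s.Sph) (ωL ω : ℝ) :
    psd s ωL ω = s.Sph * (1 + phiBar s ωL ω) := by
  have h1 : 0 < s.γ ^ 2 + (ω + ωL) ^ 2 := by positivity
  have h2 : 0 < s.γ ^ 2 + (ω - ωL) ^ 2 := by positivity
  rw [psd, phiBar, ← sub_eq_add_neg]
  field_simp
  ring

lemma phiBar_nonneg (hγ : 0 < s.γ) (hQ : 0 < s.Q) (hSph : 0 < s.Sph) (ωL ω : ℝ) :
    0 ≤ phiBar s ωL ω := by
  rw [phiBar]; positivity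

lemma lorentzian_le (hγ : 0 < s.γ) (y : ℝ) : s.γ / (s.γ ^ 2 + y ^ 2) ≤ 1 / s.γ := by
  rw [div_le_div_iff₀ (by positivity) hγ]; nlinarith [sq_nonneg y]

lemma phiBar_le (hγ : 0 < s.γ) (hQ : 0 < s.Q) (hSph : 0 < s.Sph) (ωL ω : ℝ) :
    phiBar s ωL ω ≤ s.gD ^ 2 * (s.Q / (2 * s.γ)) / s.Sph * (1 / s.γ + 1 / s.γ) := by
  rw [phiBar]
  exact mul_le_mul_of_nonneg_left (add_le_add (lorentzian_le hγ _) (lorentzian_le hγ _))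
    (by positivity)

/-- The ratio of spectral densities entering the error. -/
def psdRatio (s : Sensor) (ωL : Fin 2 → ℝ) (h : Fin 2) (ω : ℝ) : ℝ :=
  psd s (ωL h) ω / psd s (ωL 0) ω - psd s (ωL h) ω / psd s (ωL 1) ω

/-- This is the expression found in `errSymb`, with `1 + phiBar` in place of `symb`, so the
comparison reduces to the stability of one rational function. -/
lemma psdRatio_eq (hγ : 0 < s.γ) (hQ : 0 < s.Q) (hSph : 0 < s.Sph) (ωL : Fin 2 → ℝ) (h : Fin 2)
    (ω : ℝ) : psdRatio s ωL h ω = ((1 + phiBar s (ωL 0) ω)⁻¹ - (1 + phiBar s (ωL 1) ω)⁻¹)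
      * (1 + phiBar s (ωL h) ω) := by
  have h0 := phiBar_nonneg hγ hQ hSph (ωL 0) ω
  have h1 := phiBar_nonneg hγ hQ hSph (ωL 1) ω
  have h0' : 1 + phiBar s (ωL 0) ω ≠ 0 := by linarith
  have h1' : 1 + phiBar s (ωL 1) ω ≠ 0 := by linarith
  rw [psdRatio, psd_eq hγ hSph, psd_eq hγ hSph, psd_eq hγ hSph]
  field_simp

end

lemma abs_inv_sub_inv_le {f g : ℝ} (hf : 1 ≤ f) (hg : 1 ≤ g) : |f⁻¹ - g⁻¹| ≤ |f - g| := by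
  rw [inv_sub_inv (by linarith) (by linarith), abs_div, abs_sub_comm,
    abs_of_pos (by positivity : 0 < f * g)]
  exact div_le_self (abs_nonneg _) (one_le_mul_of_one_le_of_one_le hf hg)

lemma abs_inv_sub_inv_le_one {f g : ℝ} (hf : 1 ≤ f) (hg : 1 ≤ g) : |f⁻¹ - g⁻¹| ≤ 1 := by
  have h1 : f⁻¹ ≤ 1 := inv_le_one_of_one_le₀ hf
  have h2 : g⁻¹ ≤ 1 := inv_le_one_of_one_le₀ hg
  have h3 : 0 ≤ f⁻¹ := by positivity
  have h4 : 0 ≤ g⁻¹ := by positivity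
  rw [abs_le]; constructor <;> linarith

/-- Inversion is 1-Lipschitz on `[1, ∞)`: the two inverses contribute `2 R e`, the outer factor
contributes `e`. -/
lemma abs_ratio_sub_ratio_le {R e : ℝ} {f g : Fin 2 → ℝ} (hf : ∀ i, 1 ≤ f i)
    (hg : ∀ i, 1 ≤ g i) (hfR : ∀ i, f i ≤ R) (he : ∀ i, |f i - g i| ≤ e) (h : Fin 2) :
    |((f 0)⁻¹ - (f 1)⁻¹) * f h - ((g 0)⁻¹ - (g 1)⁻¹) * g h| ≤ (2 * R + 1) * e := by
  have e1 : ((f 0)⁻¹ - (f 1)⁻¹) * f h - ((g 0)⁻¹ - (g 1)⁻¹) * g h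
      = (((f 0)⁻¹ - (g 0)⁻¹) - ((f 1)⁻¹ - (g 1)⁻¹)) * f h
        + ((g 0)⁻¹ - (g 1)⁻¹) * (f h - g h) := by ring
  have he0 : 0 ≤ e := (abs_nonneg _).trans (he 0)
  rw [e1]
  refine (abs_add_le _ _).trans ?_
  rw [abs_mul, abs_mul]
  have h1 : |((f 0)⁻¹ - (g 0)⁻¹) - ((f 1)⁻¹ - (g 1)⁻¹)| ≤ e + e :=
    (abs_sub _ _).trans (add_le_add ((abs_inv_sub_inv_le (hf 0) (hg 0)).trans (he 0))
      ((abs_inv_sub_inv_le (hf 1) (hg 1)).trans (he 1)))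
  have h2 : |f h| ≤ R := by rw [abs_of_nonneg (by linarith [hf h])]; exact hfR h
  have h3 := abs_inv_sub_inv_le_one (hg 0) (hg 1)
  have h4 := he h
  calc _ ≤ (e + e) * R + 1 * e := by gcongr
    _ = _ := by ring

section

variable {s : Sensor} {b Δ₀ : ℝ}

lemma exists_symb_le (hγ : 0 < s.γ) (hQ : 0 < s.Q) (hSph : 0 < s.Sph) (Δ₀ : ℝ) :
    ∃ R : ℝ, 1 ≤ R ∧ (∀ ωL Δ x : ℝ, 0 < Δ → Δ ≤ Δ₀ → symb s ωL Δ x ≤ R) ∧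
      ∀ ωL ω : ℝ, 1 + phiBar s ωL ω ≤ R := by
  obtain ⟨C, hC1, hC⟩ := exists_symb_bound hγ hQ hSph Δ₀
  refine ⟨max C (1 + s.gD ^ 2 * (s.Q / (2 * s.γ)) / s.Sph * (1 / s.γ + 1 / s.γ)),
    hC1.trans (le_max_left _ _), fun ωL Δ x hΔ hΔ₀ => ?_, fun ωL ω => ?_⟩
  · have := (hC ωL Δ hΔ hΔ₀ 0).1.bound x
    rw [Complex.norm_real] at this
    exact (Real.le_norm_self _).trans (this.trans (le_max_left _ _))
  · have := phiBar_le hγ hQ hSph ωL ω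
    exact le_trans (by linarith) (le_max_right _ _)

lemma errSymb_eq {b Δ : ℝ} (hΔ : 0 < Δ) (ωL : Fin 2 → ℝ) (h : Fin 2) (ω : ℝ) :
    errSymb s ωL b Δ h (ω * Δ) = sampSinh b Δ / (sampSinh b Δ + sampSin ω Δ)
      * (((symb s (ωL 0) Δ (ω * Δ))⁻¹ - (symb s (ωL 1) Δ (ω * Δ))⁻¹)
        * symb s (ωL h) Δ (ω * Δ)) := by
  rw [errSymb, filter_response_eq hΔ, mul_assoc]

lemma errorIntegrand_eq (s : Sensor) (ωL : Fin 2 → ℝ) (b : ℝ) (h : Fin 2) (m : ℕ) (ω : ℝ) :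
    errorIntegrand s ωL b h m ω = (b ^ 2 / (ω ^ 2 + b ^ 2) * psdRatio s ωL h ω) ^ m := rfl

lemma one_le_symb (hγ : 0 < s.γ) (hQ : 0 < s.Q) (hSph : 0 < s.Sph) {Δ : ℝ} (hΔ : 0 < Δ)
    (ωL x : ℝ) : 1 ≤ symb s ωL Δ x := by
  have := phi_nonneg hγ hQ hSph hΔ ωL x
  rw [symb]; linarith

lemma abs_mul_ratio_le {R w : ℝ} {f : Fin 2 → ℝ} (hf : ∀ i, 1 ≤ f i) (hfR : ∀ i, f i ≤ R)
    (hw : 0 ≤ w) (h : Fin 2) : |w * (((f 0)⁻¹ - (f 1)⁻¹) * f h)| ≤ R * w := by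
  rw [abs_mul, abs_mul, abs_of_nonneg hw, abs_of_nonneg (by linarith [hf h] : 0 ≤ f h)]
  have h1 := abs_inv_sub_inv_le_one (hf 0) (hf 1)
  have h2 := hfR h
  have h3 := hf h
  calc w * (|(f 0)⁻¹ - (f 1)⁻¹| * f h) ≤ w * (1 * R) := by gcongr
    _ = R * w := by ring

lemma sampled_filter_nonneg_le_one (hb : 0 < b) {Δ : ℝ} (hΔ : 0 < Δ) (ω : ℝ) :
    0 ≤ sampSinh b Δ / (sampSinh b Δ + sampSin ω Δ) ∧
      sampSinh b Δ / (sampSinh b Δ + sampSin ω Δ) ≤ 1 := by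
  have h1 : 0 < sampSinh b Δ := (by positivity : 0 < b ^ 2).trans_le (sq_le_sampSinh hb hΔ)
  have h2 := sampSin_nonneg ω Δ
  exact ⟨by positivity, by rw [div_le_one (by positivity)]; linarith⟩

lemma sampled_filter_le (hb : 0 < b) {Δ : ℝ} (hΔ : 0 < Δ) (hΔ₀ : Δ ≤ Δ₀) {ω : ℝ} (hω : 0 < ω)
    (h : ω * Δ ≤ Real.pi) :
    sampSinh b Δ / (sampSinh b Δ + sampSin ω Δ)
      ≤ (1 + (b ^ 2 + Real.cosh (b * Δ₀) ^ 2 * b ^ 4 * Δ₀ ^ 2) * Real.pi ^ 2 / 4)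
        * (1 + ω ^ 2)⁻¹ := by
  set P := b ^ 2 + Real.cosh (b * Δ₀) ^ 2 * b ^ 4 * Δ₀ ^ 2 with hP
  set p := sampSinh b Δ
  set q := sampSin ω Δ
  have hp0 : 0 < p := (by positivity : 0 < b ^ 2).trans_le (sq_le_sampSinh hb hΔ)
  have hpP : p ≤ P := (sampSinh_le hb hΔ hΔ₀).trans (by rw [hP]; gcongr)
  have hq : 4 / Real.pi ^ 2 * ω ^ 2 ≤ q := le_sampSin hΔ (by rwa [abs_of_pos (by positivity)])
  have hq0 : 0 ≤ q := sampSin_nonneg ω Δ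
  have hpi := Real.pi_pos
  rw [← div_eq_mul_inv, div_le_div_iff₀ (by positivity) (by positivity)]
  have h1 : ω ^ 2 ≤ q * Real.pi ^ 2 / 4 := by
    have : ω ^ 2 = 4 / Real.pi ^ 2 * ω ^ 2 * Real.pi ^ 2 / 4 := by field_simp
    rw [this]; gcongr
  have h2 : p * ω ^ 2 ≤ P * (q * Real.pi ^ 2 / 4) := by gcongr
  have h3 : 0 ≤ P * Real.pi ^ 2 / 4 * p := by have := hp0.le.trans hpP; positivity
  nlinarith

lemma filter_le (hb : 0 < b) (ω : ℝ) :
    b ^ 2 / (ω ^ 2 + b ^ 2) ≤ (1 + b ^ 2) * (1 + ω ^ 2)⁻¹ := by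
  rw [← div_eq_mul_inv, div_le_div_iff₀ (by positivity) (by positivity)]
  nlinarith [sq_nonneg ω, sq_nonneg (b * b)]

lemma abs_pow_le_of_le {R D x : ℝ} {m : ℕ} (hm : 1 ≤ m) (hR : |x| ≤ R) (hD : |x| ≤ D) :
    |x ^ m| ≤ R ^ (m - 1) * D := by
  obtain ⟨k, rfl⟩ : ∃ k, m = k + 1 := ⟨m - 1, by omega⟩
  have hR0 : 0 ≤ R := (abs_nonneg x).trans hR
  rw [abs_pow, pow_succ, Nat.add_sub_cancel]
  gcongr

lemma abs_phi_sub_phiBar_le (hγ : 0 < s.γ) (hQ : 0 < s.Q) (hSph : 0 < s.Sph) {Δ : ℝ} (hΔ : 0 < Δ)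
    (hΔ₀ : Δ ≤ Δ₀) {ωL ω : ℝ} (h1 : |ω * Δ| ≤ 1) (h2 : |ωL * Δ| ≤ 1) :
    |phi s ωL Δ (ω * Δ) - phiBar s ωL ω|
      ≤ s.gD ^ 2 * (s.Q / (2 * s.γ)) / s.Sph
        * (8 * (2 * Real.cosh (s.γ * Δ₀) ^ 2 + 1) * s.γ) * Δ ^ 2 := by
  have e : phi s ωL Δ (ω * Δ) = s.gD ^ 2 * (s.Q / (2 * s.γ)) / s.Sph
      * (Real.sinh (s.γ * Δ) / Δ / (sampSinh s.γ Δ + sampSin (ω + ωL) Δ)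
        + Real.sinh (s.γ * Δ) / Δ / (sampSinh s.γ Δ + sampSin (ω + -ωL) Δ)) := by
    have e1 := pois_pole_eq s hΔ ωL ω
    have e2 := pois_pole_eq s hΔ (-ωL) ω
    rw [phi]
    linear_combination s.gD ^ 2 * (s.Q / (2 * s.γ)) / (2 * s.Sph) * (e1 + e2)
  have h3 : ∀ σ : ℝ, |σ * Δ| ≤ 1 → |(ω + σ) * Δ| ≤ 2 := fun σ hσ => by
    rw [add_mul]; exact (abs_add_le _ _).trans (by linarith)
  have h4 := abs_sampled_lorentzian_sub_le hγ hΔ hΔ₀ (h3 ωL h2)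
  have h5 := abs_sampled_lorentzian_sub_le hγ hΔ hΔ₀ (h3 (-ωL) (by rwa [neg_mul, abs_neg]))
  have hc : 0 ≤ s.gD ^ 2 * (s.Q / (2 * s.γ)) / s.Sph := by positivity
  rw [e, phiBar, ← mul_sub, abs_mul, abs_of_nonneg hc, mul_assoc _ (_ * _) (Δ ^ 2)]
  gcongr
  rw [add_sub_add_comm]
  refine (abs_add_le _ _).trans ?_
  linarith

/-- Pointwise comparison of the symbol of the sampled error with the continuous integrand. -/
lemma exists_pointwise_bound (hγ : 0 < s.γ) (hQ : 0 < s.Q) (hSph : 0 < s.Sph) (hb : 0 < b)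
    (hΔ₀ : 0 < Δ₀) (ωL : Fin 2 → ℝ) {m : ℕ} (hm : 1 ≤ m) :
    ∃ K D : ℝ, 0 ≤ K ∧ (∀ (h : Fin 2) (ω : ℝ), |errorIntegrand s ωL b h m ω| ≤ D * (1 + ω ^ 2)⁻¹) ∧
      ∀ (h : Fin 2) (Δ : ℝ), 0 < Δ → Δ ≤ Δ₀ → ∀ ω : ℝ, 0 < ω →
      |(if ω * Δ ≤ Real.pi then errSymb s ωL b Δ h (ω * Δ) ^ m else 0)
        - errorIntegrand s ωL b h m ω| ≤ K * (Δ ^ 2 * (1 + (Δ * ω) ^ 2)⁻¹ + Δ * (1 + ω ^ 2)⁻¹) := by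
  obtain ⟨R, hR1, hRs, hRp⟩ := exists_symb_le hγ hQ hSph Δ₀
  obtain ⟨W, hW⟩ : ∃ r, r = (1 + (b ^ 2 + Real.cosh (b * Δ₀) ^ 2 * b ^ 4 * Δ₀ ^ 2)
    * Real.pi ^ 2 / 4) := ⟨_, rfl⟩
  obtain ⟨D, hD⟩ : ∃ r, r = R ^ (m - 1) * (R * (W + (1 + b ^ 2))) := ⟨_, rfl⟩
  obtain ⟨M, hM⟩ : ∃ r, r = |ωL 0| + |ωL 1| := ⟨_, rfl⟩
  obtain ⟨c, hc⟩ : ∃ r, r = s.gD ^ 2 * (s.Q / (2 * s.γ)) / s.Sph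
        * (8 * (2 * Real.cosh (s.γ * Δ₀) ^ 2 + 1) * s.γ) := ⟨_, rfl⟩
  obtain ⟨B, hB⟩ : ∃ r, r = 4 * (Real.cosh (b * Δ₀) ^ 2 + 1) * b ^ 2 := ⟨_, rfl⟩
  have hR0 : 0 < R := by linarith
  have hW0 : 0 ≤ W := by rw [hW]; positivity
  have hD0 : 0 ≤ D := by rw [hD]; positivity
  have hM0 : 0 ≤ M := by rw [hM]; positivity
  have hc0 : 0 ≤ c := by rw [hc]; positivity
  have hB0 : 0 ≤ B := by rw [hB]; positivity
  have hG : ∀ (h : Fin 2) (ω : ℝ), |b ^ 2 / (ω ^ 2 + b ^ 2) * psdRatio s ωL h ω|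
      ≤ R * (b ^ 2 / (ω ^ 2 + b ^ 2)) := fun h ω => by
    rw [psdRatio_eq hγ hQ hSph]
    exact abs_mul_ratio_le (f := fun i => 1 + phiBar s (ωL i) ω)
      (fun i => by linarith [phiBar_nonneg hγ hQ hSph (ωL i) ω]) (fun i => hRp _ _)
      (by positivity) h
  have hw1 : ∀ ω : ℝ, b ^ 2 / (ω ^ 2 + b ^ 2) ≤ 1 := fun ω => by
    rw [div_le_one (by positivity)]; nlinarith [sq_nonneg ω]
  have hGR : ∀ (h : Fin 2) (ω : ℝ), |b ^ 2 / (ω ^ 2 + b ^ 2) * psdRatio s ωL h ω| ≤ R :=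
    fun h ω => (hG h ω).trans (mul_le_of_le_one_right hR0.le (hw1 ω))
  have hGD : ∀ (h : Fin 2) (ω : ℝ), |errorIntegrand s ωL b h m ω| ≤ D * (1 + ω ^ 2)⁻¹ := by
    intro h ω
    rw [errorIntegrand_eq]
    refine (abs_pow_le_of_le hm (hGR h ω) (hG h ω)).trans ?_
    rw [hD, mul_assoc, mul_assoc]
    have := filter_le hb ω
    gcongr
    exact this.trans (mul_le_mul_of_nonneg_right (by linarith) (by positivity))
  obtain ⟨K₃, hK₃⟩ : ∃ r, r = 2 * (m * R ^ (m - 1) * (R * B + (2 * R + 1) * c)) := ⟨_, rfl⟩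
  have hK₃0 : 0 ≤ K₃ := by rw [hK₃]; positivity
  -- The summands serve three regimes: `ω Δ > 1`, `M Δ > 1` (sampling too coarse for the Larmor
  -- frequencies), and the rest, where Taylor estimates apply. The dependence on the Larmor
  -- frequencies enters through `M`.
  refine ⟨4 * D + 2 * D * M + K₃, D, by positivity, hGD, fun h Δ hΔ hΔΔ₀ ω hω => ?_⟩
  have hE : |errSymb s ωL b Δ h (ω * Δ)|
      ≤ R * (sampSinh b Δ / (sampSinh b Δ + sampSin ω Δ)) := by
    rw [errSymb_eq hΔ]
    exact abs_mul_ratio_le (f := fun i => symb s (ωL i) Δ (ω * Δ))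
      (fun i => one_le_symb hγ hQ hSph hΔ _ _) (fun i => hRs _ _ _ hΔ hΔΔ₀)
      (sampled_filter_nonneg_le_one hb hΔ ω).1 h
  have hER : |errSymb s ωL b Δ h (ω * Δ)| ≤ R :=
    hE.trans (mul_le_of_le_one_right hR0.le (sampled_filter_nonneg_le_one hb hΔ ω).2)
  have hED : |if ω * Δ ≤ Real.pi then errSymb s ωL b Δ h (ω * Δ) ^ m else 0|
      ≤ D * (1 + ω ^ 2)⁻¹ := by
    split_ifs with hle
    · refine (abs_pow_le_of_le hm hER hE).trans ?_
      rw [hD, mul_assoc, mul_assoc]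
      have := sampled_filter_le hb hΔ hΔΔ₀ hω hle
      rw [← hW] at this
      have hb2 : 0 ≤ 1 + b ^ 2 := by positivity
      gcongr
      exact this.trans (mul_le_mul_of_nonneg_right (by linarith) (by positivity))
    · rw [abs_zero]; positivity
  have hT1 : 0 ≤ Δ ^ 2 * (1 + (Δ * ω) ^ 2)⁻¹ := by positivity
  have hT2 : 0 ≤ Δ * (1 + ω ^ 2)⁻¹ := by positivity
  have h2D : |(if ω * Δ ≤ Real.pi then errSymb s ωL b Δ h (ω * Δ) ^ m else 0)
      - errorIntegrand s ωL b h m ω| ≤ 2 * D * (1 + ω ^ 2)⁻¹ :=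
    (abs_sub _ _).trans (by linarith [hGD h ω])
  -- At high frequency both terms are small separately, of order `ω⁻²`, and `Δ² / (1 + (Δ ω)²)` is
  -- of the same size.
  by_cases hc1 : 1 < ω * Δ
  · have h3 : (1 + ω ^ 2)⁻¹ ≤ 2 * (Δ ^ 2 * (1 + (Δ * ω) ^ 2)⁻¹) := by
      rw [← div_eq_mul_inv, inv_eq_one_div, mul_div_assoc', div_le_div_iff₀ (by positivity)
        (by positivity)]
      nlinarith [sq_nonneg Δ]
    calc _ ≤ 2 * D * (1 + ω ^ 2)⁻¹ := h2D
      _ ≤ 2 * D * (2 * (Δ ^ 2 * (1 + (Δ * ω) ^ 2)⁻¹)) := by gcongr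
      _ = 4 * D * (Δ ^ 2 * (1 + (Δ * ω) ^ 2)⁻¹) := by ring
      _ ≤ (4 * D + 2 * D * M + K₃) * (Δ ^ 2 * (1 + (Δ * ω) ^ 2)⁻¹ + Δ * (1 + ω ^ 2)⁻¹) := by
        have : 0 ≤ 2 * D * M := by positivity
        gcongr <;> linarith
  -- Here no closeness is available; the trivial bound is multiplied by `M Δ > 1`.
  by_cases hc2 : 1 < M * Δ
  · calc _ ≤ 2 * D * (1 + ω ^ 2)⁻¹ * 1 := by rw [mul_one]; exact h2D
      _ ≤ 2 * D * (1 + ω ^ 2)⁻¹ * (M * Δ) := by gcongr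
      _ = 2 * D * M * (Δ * (1 + ω ^ 2)⁻¹) := by ring
      _ ≤ (4 * D + 2 * D * M + K₃) * (Δ ^ 2 * (1 + (Δ * ω) ^ 2)⁻¹ + Δ * (1 + ω ^ 2)⁻¹) := by
        have : 0 ≤ 2 * D * M := by positivity
        gcongr <;> linarith
  rw [not_lt] at hc1 hc2
  have hω1 : |ω * Δ| ≤ 1 := by rwa [abs_of_pos (by positivity)]
  have hωL : ∀ i, |ωL i * Δ| ≤ 1 := fun i => by
    rw [abs_mul, abs_of_pos hΔ]
    refine le_trans ?_ hc2
    have : |ωL i| ≤ M := by fin_cases i <;> simp [hM]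
    gcongr
  rw [if_pos (hc1.trans (by linarith [Real.two_le_pi])), errorIntegrand_eq]
  have hkey : ∀ {w v X Y : ℝ}, |w - v| ≤ B * Δ ^ 2 → |v| ≤ 1 → |X| ≤ R →
      |X - Y| ≤ (2 * R + 1) * (c * Δ ^ 2) →
      |w * X - v * Y| ≤ (R * B + (2 * R + 1) * c) * Δ ^ 2 := by
    intro w v X Y h1 h2 h3 h4
    have e : w * X - v * Y = (w - v) * X + v * (X - Y) := by ring
    rw [e]
    refine (abs_add_le _ _).trans ?_
    rw [abs_mul, abs_mul]
    calc |w - v| * |X| + |v| * |X - Y| ≤ B * Δ ^ 2 * R + 1 * ((2 * R + 1) * (c * Δ ^ 2)) := by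
          gcongr
      _ = _ := by ring
  have hEG : |errSymb s ωL b Δ h (ω * Δ) - b ^ 2 / (ω ^ 2 + b ^ 2) * psdRatio s ωL h ω|
      ≤ (R * B + (2 * R + 1) * c) * Δ ^ 2 := by
    have h1 := abs_ratio_sub_ratio_le (R := R) (e := c * Δ ^ 2)
      (f := fun i => symb s (ωL i) Δ (ω * Δ)) (g := fun i => 1 + phiBar s (ωL i) ω)
      (fun i => one_le_symb hγ hQ hSph hΔ _ _)
      (fun i => by linarith [phiBar_nonneg hγ hQ hSph (ωL i) ω])
      (fun i => hRs _ _ _ hΔ hΔΔ₀)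
      (fun i => by
        rw [symb, add_sub_add_left_eq_sub, hc]
        exact abs_phi_sub_phiBar_le hγ hQ hSph hΔ hΔΔ₀ hω1 (hωL i)) h
    have h2 := abs_sampled_filter_sub_le hb hΔ hΔΔ₀ (y := ω) (hω1.trans one_le_two)
    rw [← hB] at h2
    have h3 := abs_mul_ratio_le (R := R) (w := 1) (f := fun i => symb s (ωL i) Δ (ω * Δ))
      (fun i => one_le_symb hγ hQ hSph hΔ _ _) (fun i => hRs _ _ _ hΔ hΔΔ₀) zero_le_one h
    rw [one_mul, mul_one] at h3
    rw [errSymb_eq hΔ, psdRatio_eq hγ hQ hSph]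
    beta_reduce at h1 h3
    refine hkey h2 ?_ h3 h1
    rw [abs_of_nonneg (by positivity)]
    exact hw1 ω
  -- For `Δ ω ≤ 1` the uniform error `Δ²` is comparable to `Δ² / (1 + (Δ ω)²)`, which is integrable
  -- over the half-line.
  have h4 : (1 : ℝ) ≤ 2 * (1 + (Δ * ω) ^ 2)⁻¹ := by
    rw [← div_eq_mul_inv, le_div_iff₀ (by positivity)]
    have : (Δ * ω) ^ 2 ≤ 1 := pow_le_one₀ (by positivity) (by linarith)
    linarith
  calc _ ≤ |errSymb s ωL b Δ h (ω * Δ) - b ^ 2 / (ω ^ 2 + b ^ 2) * psdRatio s ωL h ω| * m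
        * max |errSymb s ωL b Δ h (ω * Δ)| |b ^ 2 / (ω ^ 2 + b ^ 2) * psdRatio s ωL h ω|
          ^ (m - 1) := abs_pow_sub_pow_le _ _ _
    _ ≤ (R * B + (2 * R + 1) * c) * Δ ^ 2 * m * R ^ (m - 1) := by
        have := max_le hER (hGR h ω)
        gcongr
    _ = m * R ^ (m - 1) * (R * B + (2 * R + 1) * c) * Δ ^ 2 * 1 := by ring
    _ ≤ m * R ^ (m - 1) * (R * B + (2 * R + 1) * c) * Δ ^ 2 * (2 * (1 + (Δ * ω) ^ 2)⁻¹) := by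
        gcongr
    _ = K₃ * (Δ ^ 2 * (1 + (Δ * ω) ^ 2)⁻¹) := by rw [hK₃]; ring
    _ ≤ (4 * D + 2 * D * M + K₃) * (Δ ^ 2 * (1 + (Δ * ω) ^ 2)⁻¹ + Δ * (1 + ω ^ 2)⁻¹) := by
        have : 0 ≤ 2 * D * M := by positivity
        gcongr <;> linarith

lemma measurable_errSymb (s : Sensor) (ωL : Fin 2 → ℝ) (b Δ : ℝ) (h : Fin 2) :
    Measurable (errSymb s ωL b Δ h) := by
  unfold errSymb symb phi pois; fun_prop

lemma measurable_errorIntegrand (s : Sensor) (ωL : Fin 2 → ℝ) (b : ℝ) (h : Fin 2) (m : ℕ) :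
    Measurable (errorIntegrand s ωL b h m) := by
  unfold errorIntegrand psd; fun_prop

lemma integrableOn_errorIntegrand (hγ : 0 < s.γ) (hQ : 0 < s.Q) (hSph : 0 < s.Sph) (hb : 0 < b)
    (ωL : Fin 2 → ℝ) (h : Fin 2) {m : ℕ} (hm : 1 ≤ m) :
    IntegrableOn (errorIntegrand s ωL b h m) (Ioi 0) := by
  obtain ⟨K, D, -, hD, -⟩ := exists_pointwise_bound hγ hQ hSph hb one_pos ωL hm
  refine Integrable.mono' (integrable_inv_one_add_sq.const_mul D).integrableOn
    (measurable_errorIntegrand s ωL b h m).aestronglyMeasurable (ae_of_all _ fun ω => ?_)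
  exact hD h ω

/-- Reflection conjugates the character and thereby exchanges the poles at `±ωL`, whose
contributions are added symmetrically. -/
lemma errSymb_neg (s : Sensor) (ωL : Fin 2 → ℝ) (b Δ : ℝ) (h : Fin 2) (x : ℝ) :
    errSymb s ωL b Δ h (-x) = errSymb s ωL b Δ h x := by
  have h1 : ∀ z : ℂ, ‖1 - z * ex 1 (-x)‖ = ‖1 - (starRingEnd ℂ) z * ex 1 x‖ := fun z => by
    rw [← RCLike.norm_conj]
    congr 1
    rw [map_sub, map_mul, conj_ex, map_one]
    congr 2
    simp [ex]
  have h2 : ∀ ω : ℝ, (starRingEnd ℂ) (pole s ω Δ) = pole s (-ω) Δ := fun ω => by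
    rw [pole, pole, ← Complex.exp_conj]
    simp
  have h3 : ∀ ω : ℝ, symb s ω Δ (-x) = symb s ω Δ x := fun ω => by
    simp only [symb, phi, pois, h1, h2, neg_neg, norm_pole]
    ring
  simp only [errSymb, h1, h3, Complex.conj_ofReal]

/-- Evenness folds the circle onto `[0, π]`, then `x = ω Δ`. The conditional is the Nyquist cut-off;
it extends the sampled integrand by zero to the half-line of the continuous one. -/
lemma integral_errSymb_pow (s : Sensor) (ωL : Fin 2 → ℝ) (b : ℝ) {Δ : ℝ} (hΔ : 0 < Δ) (h : Fin 2)
    {m : ℕ} (hint : IntervalIntegrable (fun x => errSymb s ωL b Δ h x ^ m) volume 0 Real.pi) :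
    ∫ x, errSymb s ωL b Δ h x ^ m ∂circ
      = Δ / Real.pi * ∫ ω in Ioi (0 : ℝ),
        if ω * Δ ≤ Real.pi then errSymb s ωL b Δ h (ω * Δ) ^ m else 0 := by
  have hpi := Real.pi_pos
  have hneg : ∀ x, errSymb s ωL b Δ h (-x) ^ m = errSymb s ωL b Δ h x ^ m := fun x => by
    rw [errSymb_neg]
  have hint' : IntervalIntegrable (fun x => errSymb s ωL b Δ h x ^ m) volume (-Real.pi) 0 := by
    have := (IntervalIntegrable.iff_comp_neg).1 hint
    simp only [hneg, neg_zero] at this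
    exact this.symm
  have h1 : ∫ x in (-Real.pi)..0, errSymb s ωL b Δ h x ^ m
      = ∫ x in 0..Real.pi, errSymb s ωL b Δ h x ^ m := by
    have := intervalIntegral.integral_comp_neg (fun x => errSymb s ωL b Δ h x ^ m)
      (a := 0) (b := Real.pi)
    simp only [hneg, neg_zero] at this
    exact this.symm
  have h2 : ∫ x in 0..Real.pi, errSymb s ωL b Δ h x ^ m
      = Δ * ∫ ω in 0..(Real.pi / Δ), errSymb s ωL b Δ h (ω * Δ) ^ m := by
    have := intervalIntegral.integral_comp_mul_right (fun x => errSymb s ωL b Δ h x ^ m)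
      (a := 0) (b := Real.pi / Δ) hΔ.ne'
    rw [this, zero_mul, div_mul_cancel₀ _ hΔ.ne', smul_eq_mul, ← mul_assoc, mul_inv_cancel₀ hΔ.ne',
      one_mul]
  have h3 : ∫ ω in Ioi (0 : ℝ), (if ω * Δ ≤ Real.pi then errSymb s ωL b Δ h (ω * Δ) ^ m else 0)
      = ∫ ω in 0..(Real.pi / Δ), errSymb s ωL b Δ h (ω * Δ) ^ m := by
    have e : (fun ω : ℝ => if ω * Δ ≤ Real.pi then errSymb s ωL b Δ h (ω * Δ) ^ m else 0)
        = (Iic (Real.pi / Δ)).indicator fun ω => errSymb s ωL b Δ h (ω * Δ) ^ m := by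
      ext ω
      simp only [indicator, mem_Iic, le_div_iff₀ hΔ]
    rw [e, setIntegral_indicator measurableSet_Iic, Ioi_inter_Iic,
      intervalIntegral.integral_of_le (by positivity)]
  rw [h3, integral_circ, ← intervalIntegral.integral_add_adjacent_intervals hint' hint, h1, h2,
    smul_eq_mul]
  field_simp
  ring

/-- The integral of the sampled symbol converges to the continuous one at rate `Δ`. -/
lemma exists_integral_bound (hγ : 0 < s.γ) (hQ : 0 < s.Q) (hSph : 0 < s.Sph) (hb : 0 < b)
    (hΔ₀ : 0 < Δ₀) (ωL : Fin 2 → ℝ) {m : ℕ} (hm : 1 ≤ m) :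
    ∃ K : ℝ, 0 ≤ K ∧ ∀ (h : Fin 2) (Δ : ℝ), 0 < Δ → Δ ≤ Δ₀ →
      |∫ x, errSymb s ωL b Δ h x ^ m ∂circ
        - Δ / Real.pi * ∫ ω in Ioi (0 : ℝ), errorIntegrand s ωL b h m ω| ≤ K * Δ * Δ := by
  obtain ⟨K, D, hK, hD, hp⟩ := exists_pointwise_bound hγ hQ hSph hb hΔ₀ ωL hm
  obtain ⟨R, hR1, hRs, -⟩ := exists_symb_le hγ hQ hSph Δ₀
  refine ⟨K, hK, fun h Δ hΔ hΔΔ₀ => ?_⟩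
  have hpi := Real.pi_pos
  have hbound : ∀ x, |errSymb s ωL b Δ h x| ≤ R := fun x => by
    have e : x = (x / Δ) * Δ := by field_simp
    have h1 := sampled_filter_nonneg_le_one hb hΔ (x / Δ)
    rw [e, errSymb_eq hΔ]
    exact (abs_mul_ratio_le (R := R) (f := fun i => symb s (ωL i) Δ (x / Δ * Δ))
      (fun i => one_le_symb hγ hQ hSph hΔ _ _) (fun i => hRs _ _ _ hΔ hΔΔ₀) h1.1 h).trans
      (mul_le_of_le_one_right (by linarith) h1.2)
  have hint : IntervalIntegrable (fun x => errSymb s ωL b Δ h x ^ m) volume 0 Real.pi := by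
    rw [intervalIntegrable_iff_integrableOn_Ioc_of_le hpi.le]
    refine Integrable.of_bound (((measurable_errSymb s ωL b Δ h).pow_const m).aestronglyMeasurable)
      (R ^ m) (ae_of_all _ fun x => ?_)
    rw [Real.norm_eq_abs, abs_pow]
    exact pow_le_pow_left₀ (abs_nonneg _) (hbound x) m
  rw [integral_errSymb_pow s ωL b hΔ h hint, ← mul_sub]
  have hi1 : IntegrableOn (fun ω : ℝ => Δ ^ 2 * (1 + (Δ * ω) ^ 2)⁻¹) (Ioi 0) :=
    ((integrable_inv_one_add_sq.comp_mul_left' hΔ.ne').const_mul _).integrableOn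
  have hi2 : IntegrableOn (fun ω : ℝ => Δ * (1 + ω ^ 2)⁻¹) (Ioi 0) :=
    (integrable_inv_one_add_sq.const_mul _).integrableOn
  have hG := integrableOn_errorIntegrand hγ hQ hSph hb ωL h hm
  have hmE : Measurable fun ω : ℝ =>
      if ω * Δ ≤ Real.pi then errSymb s ωL b Δ h (ω * Δ) ^ m else 0 := by
    refine Measurable.ite (measurableSet_le (by fun_prop) measurable_const) ?_ measurable_const
    exact ((measurable_errSymb s ωL b Δ h).comp (measurable_id.mul_const Δ)).pow_const m
  have hdom : ∀ᵐ ω ∂(volume.restrict (Ioi (0 : ℝ))),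
      ‖(if ω * Δ ≤ Real.pi then errSymb s ωL b Δ h (ω * Δ) ^ m else 0)
        - errorIntegrand s ωL b h m ω‖
        ≤ K * (Δ ^ 2 * (1 + (Δ * ω) ^ 2)⁻¹ + Δ * (1 + ω ^ 2)⁻¹) :=
    (ae_restrict_iff' measurableSet_Ioi).2 (ae_of_all _ fun ω hω => hp h Δ hΔ hΔΔ₀ ω hω)
  have hi3 : IntegrableOn (fun ω : ℝ => K * (Δ ^ 2 * (1 + (Δ * ω) ^ 2)⁻¹ + Δ * (1 + ω ^ 2)⁻¹))
    (Ioi 0) := (hi1.add hi2).const_mul K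
  have hE : IntegrableOn (fun ω : ℝ =>
      if ω * Δ ≤ Real.pi then errSymb s ωL b Δ h (ω * Δ) ^ m else 0) (Ioi 0) := by
    have : IntegrableOn (fun ω : ℝ =>
      (if ω * Δ ≤ Real.pi then errSymb s ωL b Δ h (ω * Δ) ^ m else 0)
        - errorIntegrand s ωL b h m ω) (Ioi 0) :=
      Integrable.mono' hi3 (hmE.sub (measurable_errorIntegrand s ωL b h m)).aestronglyMeasurable
        hdom
    have h := this.add hG
    refine h.congr (ae_of_all _ fun ω => ?_)
    simp
  rw [← integral_sub hE hG, abs_mul, abs_of_pos (by positivity)]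
  have h5 := norm_integral_le_of_norm_le hi3 hdom
  -- Each of the two majorants integrates to `π Δ / 2`. With the factor `Δ / π` of the substitution
  -- this gives `K Δ²` per sample.
  have h6 : ∫ ω in Ioi (0 : ℝ), K * (Δ ^ 2 * (1 + (Δ * ω) ^ 2)⁻¹ + Δ * (1 + ω ^ 2)⁻¹)
      = K * (Real.pi * Δ) := by
    rw [integral_const_mul, integral_add hi1 hi2, integral_const_mul, integral_const_mul,
      integral_comp_mul_left_Ioi (fun x => (1 + x ^ 2)⁻¹) 0 hΔ, mul_zero,
      integral_Ioi_inv_one_add_sq, Real.arctan_zero, smul_eq_mul]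
    field_simp
    ring
  rw [h6, Real.norm_eq_abs] at h5
  calc _ ≤ Δ / Real.pi * (K * (Real.pi * Δ)) := by gcongr
    _ = K * Δ * Δ := by field_simp

end

end SpinNoise

end

noncomputable section

namespace SpinNoise

/-! ### Cumulants against the continuous integrals -/

section

variable {s : Sensor} {b Δ₀ : ℝ}

/-- The order of quantifiers matters: `C` comes from the trace calculus and precedes the Larmor
frequencies, whereas `K` comes from the passage to continuous time and depends on them. -/
lemma exists_cumulant_bound (hγ : 0 < s.γ) (hQ : 0 < s.Q) (hSph : 0 < s.Sph) (hb : 0 < b)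
    (hΔ₀ : 0 < Δ₀) {m : ℕ} (hm : 1 ≤ m) :
    ∃ C : ℝ, 0 ≤ C ∧ ∀ ωL : Fin 2 → ℝ, ∃ K : ℝ, 0 ≤ K ∧ ∀ Δ : ℝ, 0 < Δ → Δ ≤ Δ₀ →
      ∀ (n : ℕ) (h : Fin 2),
        |cumulant m (filterError s ωL b Δ (n := n)) (signalLaw s (ωL h) Δ n)
            - (n * Δ) * ((m - 1).factorial : ℝ) / (2 * Real.pi)
              * ∫ ω in Ioi (0 : ℝ), errorIntegrand s ωL b h m ω| ≤ C + K * ((n * Δ) * Δ) := by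
  obtain ⟨C, hC⟩ := exists_trace_bound hγ hQ hSph hb Δ₀ m
  have hC0 : 0 ≤ C := (abs_nonneg _).trans (hC 0 Δ₀ hΔ₀ le_rfl 0 0)
  refine ⟨((m - 1).factorial : ℝ) / 2 * C, by positivity, fun ωL => ?_⟩
  obtain ⟨K, hK0, hK⟩ := exists_integral_bound hγ hQ hSph hb hΔ₀ ωL hm
  refine ⟨((m - 1).factorial : ℝ) / 2 * K, by positivity, fun Δ hΔ hΔΔ₀ n h => ?_⟩
  rw [(cumulant_filterError hγ hQ hSph hΔ ωL b n h).2 m hm]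
  have h1 := hC ωL Δ hΔ hΔΔ₀ n h
  have h2 := hK h Δ hΔ hΔΔ₀
  set T := ((errorMat s ωL b Δ n * covMat s (ωL h) Δ n) ^ m).trace
  set J := ∫ x, errSymb s ωL b Δ h x ^ m ∂circ
  set I := ∫ ω in Ioi (0 : ℝ), errorIntegrand s ωL b h m ω
  have e : ((m - 1).factorial : ℝ) / 2 * T - (n * Δ) * ((m - 1).factorial : ℝ) / (2 * Real.pi) * I
      = ((m - 1).factorial : ℝ) / 2 * ((T - n * J) + n * (J - Δ / Real.pi * I)) := by
    field_simp
    ring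
  rw [e, abs_mul, abs_of_nonneg (by positivity)]
  calc _ ≤ ((m - 1).factorial : ℝ) / 2 * (C + n * (K * Δ * Δ)) := by
        gcongr
        refine (abs_add_le _ _).trans (add_le_add h1 ?_)
        rw [abs_mul, Nat.abs_cast]
        gcongr
    _ = _ := by ring

end

/-! ### Moments of the exponential law -/

lemma measurable_gammaPDF (a r : ℝ) : Measurable (gammaPDF a r) :=
  (measurable_gammaPDFReal a r).ennreal_ofReal

lemma integrable_pow_expMeasure {r : ℝ} (hr : 0 < r) (k : ℕ) :
    Integrable (fun x : ℝ => x ^ k) (expMeasure r) := by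
  rw [expMeasure, gammaMeasure, integrable_withDensity_iff (measurable_gammaPDF 1 r)
    (ae_of_all _ fun _ => ENNReal.ofReal_lt_top)]
  have h := integrableOn_rpow_mul_exp_neg_mul_rpow (s := k) (p := 1) (b := r)
    (by linarith [(Nat.cast_nonneg k : (0 : ℝ) ≤ k)]) one_pos hr
  rw [← integrableOn_Ici_iff_integrableOn_Ioi,
    ← integrable_indicator_iff measurableSet_Ici] at h
  refine (h.const_mul r).congr (ae_of_all _ fun x => ?_)
  have e := exponentialPDF_eq r x
  rw [exponentialPDF, exponentialPDFReal] at e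
  change r * _ = x ^ k * (ENNReal.ofReal (gammaPDFReal 1 r x)).toReal
  rw [e, indicator_apply]
  by_cases hx : 0 ≤ x
  · rw [if_pos (mem_Ici.2 hx), if_pos hx, ENNReal.toReal_ofReal (by positivity), Real.rpow_one,
      Real.rpow_natCast, neg_mul]
    ring
  · rw [if_neg (mt mem_Ici.1 hx), if_neg hx]
    simp

lemma integral_pow_expMeasure {r : ℝ} (hr : 0 < r) (k : ℕ) :
    ∫ x, x ^ k ∂(expMeasure r) = k.factorial / r ^ k := by
  rw [expMeasure, gammaMeasure, integral_withDensity_eq_integral_toReal_smul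
    (measurable_gammaPDF 1 r) (ae_of_all _ fun _ => ENNReal.ofReal_lt_top)]
  have h := Real.integral_rpow_mul_exp_neg_mul_Ioi (a := k + 1) (r := r) (by positivity) hr
  rw [← integral_Ici_eq_integral_Ioi, ← integral_indicator measurableSet_Ici] at h
  have e2 : ∀ x, (gammaPDF 1 r x).toReal • x ^ k
      = r * (Ici 0).indicator (fun t : ℝ => t ^ ((k : ℝ) + 1 - 1) * Real.exp (-(r * t))) x := by
    intro x
    have e := exponentialPDF_eq r x
    rw [exponentialPDF, exponentialPDFReal] at e
    rw [gammaPDF, e, indicator, smul_eq_mul]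
    by_cases hx : 0 ≤ x
    · rw [if_pos (mem_Ici.2 hx), if_pos hx, ENNReal.toReal_ofReal (by positivity),
        add_sub_cancel_right, Real.rpow_natCast]
      ring
    · rw [if_neg (mt mem_Ici.1 hx), if_neg hx]
      simp
  simp_rw [e2]
  rw [integral_const_mul, h, Real.Gamma_nat_eq_factorial, Real.rpow_add_one (by positivity),
    Real.rpow_natCast, one_div, inv_pow]
  field_simp

section

variable {s : Sensor}

lemma psd_pos (hγ : 0 < s.γ) (hQ : 0 < s.Q) (hSph : 0 < s.Sph) (ωL ω : ℝ) : 0 < psd s ωL ω := by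
  rw [psd_eq hγ hSph]
  have := phiBar_nonneg hγ hQ hSph ωL ω
  positivity

/-- The logarithm has no counterpart in the first cumulant of the error; its integral is estimated
separately. -/
lemma spectralMean_eq (hγ : 0 < s.γ) (hQ : 0 < s.Q) (hSph : 0 < s.Sph) (ωL : Fin 2 → ℝ) (h : Fin 2)
    (ω : ℝ) : spectralMean s ωL h ω
      = Real.log (psd s (ωL 0) ω / psd s (ωL 1) ω) + psdRatio s ωL h ω := by
  have hp := psd_pos hγ hQ hSph (ωL h) ω
  have := isProbabilityMeasure_expMeasure (inv_pos.2 hp)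
  have hi := integrable_pow_expMeasure (inv_pos.2 hp) 1
  have hm := integral_pow_expMeasure (inv_pos.2 hp) 1
  simp only [pow_one, Nat.factorial_one, Nat.cast_one, one_div, inv_inv] at hi hm
  simp only [spectralMean, spectralLLR, powerLaw]
  rw [integral_add (integrable_const _) (hi.const_mul _), integral_const_mul, hm, psdRatio]
  simp
  ring

/-- The variance of an exponential law is the square of its mean and the logarithm is constant, so
only the squared ratio of the second cumulant remains. -/
lemma spectralVar_eq (hγ : 0 < s.γ) (hQ : 0 < s.Q) (hSph : 0 < s.Sph) (ωL : Fin 2 → ℝ) (h : Fin 2)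
    (ω : ℝ) : spectralVar s ωL h ω = psdRatio s ωL h ω ^ 2 := by
  have hp := psd_pos hγ hQ hSph (ωL h) ω
  have := isProbabilityMeasure_expMeasure (inv_pos.2 hp)
  have hm := integral_pow_expMeasure (inv_pos.2 hp) 1
  have hm2 := integral_pow_expMeasure (inv_pos.2 hp) 2
  simp only [pow_one, Nat.factorial_one, Nat.cast_one, one_div, inv_inv] at hm
  have hL : MemLp (fun x : ℝ => x) 2 (expMeasure (psd s (ωL h) ω)⁻¹) :=
    (memLp_two_iff_integrable_sq (by fun_prop)).2 (integrable_pow_expMeasure (inv_pos.2 hp) 2)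
  have hv : variance (fun x : ℝ => x) (expMeasure (psd s (ωL h) ω)⁻¹) = psd s (ωL h) ω ^ 2 := by
    rw [variance_eq_sub hL]
    simp only [Pi.pow_apply]
    rw [hm, hm2]
    simp [Nat.factorial]
    ring
  have e : spectralLLR s ωL ω = fun x => Real.log (psd s (ωL 0) ω / psd s (ωL 1) ω)
    + (1 / psd s (ωL 0) ω - 1 / psd s (ωL 1) ω) * x := rfl
  rw [spectralVar, powerLaw, e, variance_const_add (by fun_prop), variance_const_mul, hv, psdRatio]
  ring

end

/-! ### Lorentzians -/

/-- The Lorentzian of width `g`. -/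
def lorentz (g y : ℝ) : ℝ := g / (g ^ 2 + y ^ 2)

lemma lorentz_nonneg {g : ℝ} (hg : 0 < g) (y : ℝ) : 0 ≤ lorentz g y := by
  rw [lorentz]; positivity

lemma lorentz_neg (g y : ℝ) : lorentz g (-y) = lorentz g y := by rw [lorentz, lorentz, neg_sq]

lemma continuous_lorentz {g : ℝ} (hg : 0 < g) : Continuous (lorentz g) := by
  unfold lorentz
  exact continuous_const.div (by fun_prop) fun y => by positivity

lemma lorentz_eq {g : ℝ} (hg : 0 < g) :
    lorentz g = fun y => g⁻¹ * (1 + (g⁻¹ * y) ^ 2)⁻¹ := by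
  ext y
  rw [lorentz]
  field_simp

lemma integrable_lorentz {g : ℝ} (hg : 0 < g) : Integrable (lorentz g) := by
  rw [lorentz_eq hg]
  exact (integrable_inv_one_add_sq.comp_mul_left' (inv_ne_zero hg.ne')).const_mul _

lemma integral_lorentz {g : ℝ} (hg : 0 < g) : ∫ y, lorentz g y = Real.pi := by
  rw [lorentz_eq hg, integral_const_mul,
    Measure.integral_comp_mul_left (fun y : ℝ => (1 + y ^ 2)⁻¹), integral_univ_inv_one_add_sq,
    inv_inv, abs_of_pos hg, smul_eq_mul]
  field_simp

/-! ### Integrability of the spectral moments -/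

section

variable {s : Sensor}

lemma phiBar_eq_lorentz (s : Sensor) (ωL ω : ℝ) :
    phiBar s ωL ω = s.gD ^ 2 * (s.Q / (2 * s.γ)) / s.Sph
      * (lorentz s.γ (ω + ωL) + lorentz s.γ (ω - ωL)) := by
  rw [phiBar, lorentz, lorentz, sub_eq_add_neg]

lemma integrable_phiBar (hγ : 0 < s.γ) (ωL : ℝ) : Integrable (phiBar s ωL) := by
  have e : phiBar s ωL = fun ω => s.gD ^ 2 * (s.Q / (2 * s.γ)) / s.Sph
      * (lorentz s.γ (ω + ωL) + lorentz s.γ (ω - ωL)) := funext (phiBar_eq_lorentz s ωL)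
  rw [e]
  exact (((integrable_lorentz hγ).comp_add_right ωL).add
    ((integrable_lorentz hγ).comp_sub_right ωL)).const_mul _

lemma abs_log_psd_le (hγ : 0 < s.γ) (hQ : 0 < s.Q) (hSph : 0 < s.Sph) (ωL : Fin 2 → ℝ) (ω : ℝ) :
    |Real.log (psd s (ωL 0) ω / psd s (ωL 1) ω)| ≤ phiBar s (ωL 0) ω + phiBar s (ωL 1) ω := by
  have h0 := phiBar_nonneg hγ hQ hSph (ωL 0) ω
  have h1 := phiBar_nonneg hγ hQ hSph (ωL 1) ω
  rw [psd_eq hγ hSph, psd_eq hγ hSph, mul_div_mul_left _ _ hSph.ne',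
    Real.log_div (by positivity) (by positivity)]
  have h2 := Real.log_le_sub_one_of_pos (by positivity : 0 < 1 + phiBar s (ωL 0) ω)
  have h3 := Real.log_le_sub_one_of_pos (by positivity : 0 < 1 + phiBar s (ωL 1) ω)
  have h4 := Real.log_nonneg (by linarith : 1 ≤ 1 + phiBar s (ωL 0) ω)
  have h5 := Real.log_nonneg (by linarith : 1 ≤ 1 + phiBar s (ωL 1) ω)
  rw [abs_le]
  constructor <;> linarith

lemma measurable_psd (s : Sensor) (ωL : ℝ) : Measurable (psd s ωL) := by unfold psd; fun_prop

lemma integrable_log_psd (hγ : 0 < s.γ) (hQ : 0 < s.Q) (hSph : 0 < s.Sph) (ωL : Fin 2 → ℝ) :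
    Integrable fun ω => Real.log (psd s (ωL 0) ω / psd s (ωL 1) ω) :=
  Integrable.mono' ((integrable_phiBar hγ (ωL 0)).add (integrable_phiBar hγ (ωL 1)))
    (((measurable_psd s _).div (measurable_psd s _)).log).aestronglyMeasurable
    (ae_of_all _ fun ω => abs_log_psd_le hγ hQ hSph ωL ω)

lemma measurable_psdRatio (s : Sensor) (ωL : Fin 2 → ℝ) (h : Fin 2) :
    Measurable (psdRatio s ωL h) :=
  ((measurable_psd s _).div (measurable_psd s _)).sub
    ((measurable_psd s _).div (measurable_psd s _))

/-- The first bound controls squares; the second transfers integrability, and later cubic decay,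
from differences of Lorentzians. `R` does not depend on the Larmor frequencies. -/
lemma exists_abs_psdRatio_le (hγ : 0 < s.γ) (hQ : 0 < s.Q) (hSph : 0 < s.Sph) :
    ∃ R : ℝ, 1 ≤ R ∧ ∀ (ωL : Fin 2 → ℝ) (h : Fin 2) (ω : ℝ), |psdRatio s ωL h ω| ≤ R ∧
      |psdRatio s ωL h ω| ≤ R * |phiBar s (ωL 0) ω - phiBar s (ωL 1) ω| := by
  obtain ⟨R, hR1, -, hR⟩ := exists_symb_le hγ hQ hSph 1
  refine ⟨R, hR1, fun ωL h ω => ?_⟩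
  have hφ := fun i => phiBar_nonneg hγ hQ hSph (ωL i) ω
  have h1 := abs_inv_sub_inv_le (f := 1 + phiBar s (ωL 0) ω) (g := 1 + phiBar s (ωL 1) ω)
    (by linarith [hφ 0]) (by linarith [hφ 1])
  have h2 := abs_inv_sub_inv_le_one (f := 1 + phiBar s (ωL 0) ω) (g := 1 + phiBar s (ωL 1) ω)
    (by linarith [hφ 0]) (by linarith [hφ 1])
  rw [add_sub_add_left_eq_sub] at h1
  rw [psdRatio_eq hγ hQ hSph, abs_mul, mul_comm, abs_of_nonneg (a := 1 + phiBar s (ωL h) ω)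
    (by linarith [hφ h])]
  have h3 := hR (ωL h) ω
  constructor
  · calc _ ≤ R * 1 := by gcongr
      _ = R := mul_one R
  · gcongr

lemma integrable_psdRatio (hγ : 0 < s.γ) (hQ : 0 < s.Q) (hSph : 0 < s.Sph) (ωL : Fin 2 → ℝ)
    (h : Fin 2) : Integrable (psdRatio s ωL h) := by
  obtain ⟨R, -, hR⟩ := exists_abs_psdRatio_le hγ hQ hSph
  exact Integrable.mono'
    (((integrable_phiBar hγ (ωL 0)).sub (integrable_phiBar hγ (ωL 1))).abs.const_mul R)
    (measurable_psdRatio s ωL h).aestronglyMeasurable (ae_of_all _ fun ω => (hR ωL h ω).2)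

lemma integrable_psdRatio_sq (hγ : 0 < s.γ) (hQ : 0 < s.Q) (hSph : 0 < s.Sph) (ωL : Fin 2 → ℝ)
    (h : Fin 2) : Integrable fun ω => psdRatio s ωL h ω ^ 2 := by
  obtain ⟨R, -, hR⟩ := exists_abs_psdRatio_le hγ hQ hSph
  refine Integrable.mono' ((integrable_psdRatio hγ hQ hSph ωL h).abs.const_mul R)
    ((measurable_psdRatio s ωL h).pow_const 2).aestronglyMeasurable (ae_of_all _ fun ω => ?_)
  rw [Real.norm_eq_abs, abs_pow, sq]
  exact mul_le_mul_of_nonneg_right (hR ωL h ω).1 (abs_nonneg _)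

lemma integrable_spectralMean (hγ : 0 < s.γ) (hQ : 0 < s.Q) (hSph : 0 < s.Sph) (ωL : Fin 2 → ℝ)
    (h : Fin 2) : Integrable (spectralMean s ωL h) := by
  rw [funext (spectralMean_eq hγ hQ hSph ωL h)]
  exact (integrable_log_psd hγ hQ hSph ωL).add (integrable_psdRatio hγ hQ hSph ωL h)

lemma integrable_spectralVar (hγ : 0 < s.γ) (hQ : 0 < s.Q) (hSph : 0 < s.Sph) (ωL : Fin 2 → ℝ)
    (h : Fin 2) : Integrable (spectralVar s ωL h) := by
  rw [funext (spectralVar_eq hγ hQ hSph ωL h)]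
  exact integrable_psdRatio_sq hγ hQ hSph ωL h

end

end SpinNoise

end

noncomputable section

namespace SpinNoise

/-! ### Large central frequency -/

lemma one_add_sq_le {g : ℝ} (hg : 0 < g) (d v : ℝ) :
    1 + v ^ 2 ≤ ((1 + 2 * d ^ 2) / g ^ 2 + 2) * (g ^ 2 + (v + d) ^ 2) := by
  have h1 : (1 + 2 * d ^ 2) / g ^ 2 * g ^ 2 = 1 + 2 * d ^ 2 := div_mul_cancel₀ _ (by positivity)
  have h2 : 0 ≤ (1 + 2 * d ^ 2) / g ^ 2 * (v + d) ^ 2 := by positivity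
  nlinarith [sq_nonneg (v + 2 * d), sq_nonneg g]

/-- Over a common denominator of degree four the numerator is `-4 g d v`, so the difference decays
like `|v|⁻³`. This gains the one power needed against the linear variation of the filter. -/
lemma exists_abs_lorentz_sub_le {g : ℝ} (hg : 0 < g) (d : ℝ) :
    ∃ A : ℝ, 0 ≤ A ∧ ∀ v : ℝ,
      |lorentz g (v + d) - lorentz g (v - d)| ≤ A * ((1 + |v|) * (1 + v ^ 2))⁻¹ := by
  obtain ⟨M, hM⟩ : ∃ r, r = (1 + 2 * d ^ 2) / g ^ 2 + 2 := ⟨_, rfl⟩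
  have hM0 : 0 < M := by rw [hM]; positivity
  refine ⟨8 * g * |d| * M ^ 2, by positivity, fun v => ?_⟩
  have h1 := one_add_sq_le hg d v
  have h2 := one_add_sq_le hg (-d) v
  rw [neg_sq, ← hM, ← sub_eq_add_neg] at h2
  rw [← hM] at h1
  have e : lorentz g (v + d) - lorentz g (v - d)
      = -(4 * g * d * v) / ((g ^ 2 + (v + d) ^ 2) * (g ^ 2 + (v - d) ^ 2)) := by
    rw [lorentz, lorentz, div_sub_div _ _ (by positivity) (by positivity)]
    ring
  have h3 : |v| * (1 + |v|) ≤ 2 * (1 + v ^ 2) := by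
    nlinarith [sq_abs v, sq_nonneg (|v| - 1), abs_nonneg v]
  have h4 : (1 + v ^ 2) * (1 + v ^ 2)
      ≤ (M * (g ^ 2 + (v + d) ^ 2)) * (M * (g ^ 2 + (v - d) ^ 2)) := by gcongr
  rw [e, abs_div, abs_neg, abs_mul, abs_mul, abs_of_pos (by positivity : 0 < 4 * g),
    abs_of_pos (by positivity : 0 < (g ^ 2 + (v + d) ^ 2) * (g ^ 2 + (v - d) ^ 2)),
    ← div_eq_mul_inv, div_le_div_iff₀ (by positivity) (by positivity)]
  calc 4 * g * |d| * |v| * ((1 + |v|) * (1 + v ^ 2))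
      = 4 * g * |d| * (|v| * (1 + |v|)) * (1 + v ^ 2) := by ring
    _ ≤ 4 * g * |d| * (2 * (1 + v ^ 2)) * (1 + v ^ 2) := by gcongr
    _ = 8 * g * |d| * ((1 + v ^ 2) * (1 + v ^ 2)) := by ring
    _ ≤ 8 * g * |d| * ((M * (g ^ 2 + (v + d) ^ 2)) * (M * (g ^ 2 + (v - d) ^ 2))) := by gcongr
    _ = _ := by ring

lemma centred_zero (ωc δ : ℝ) : centred ωc δ 0 = ωc + δ / 2 := by simp [centred]

lemma centred_one (ωc δ : ℝ) : centred ωc δ 1 = ωc - δ / 2 := by simp [centred]; ring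

lemma half_le_centred {ωc δ : ℝ} (h : |δ| ≤ ωc) (i : Fin 2) : ωc / 2 ≤ centred ωc δ i := by
  have := abs_le.1 h
  fin_cases i
  · simp only [Fin.zero_eta, centred_zero]; linarith
  · simp only [Fin.mk_one, centred_one]; linarith

section

variable {s : Sensor} {b : ℝ}

lemma exists_psdRatio_centred_le (hγ : 0 < s.γ) (hQ : 0 < s.Q) (hSph : 0 < s.Sph) (δ : ℝ) :
    ∃ A : ℝ, 0 ≤ A ∧ ∀ ωc : ℝ, 0 < ωc → ∀ (h : Fin 2) (ω : ℝ), 0 < ω →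
      |psdRatio s (centred ωc δ) h ω| ≤ A * ((1 + |ω - ωc|) * (1 + (ω - ωc) ^ 2))⁻¹ := by
  obtain ⟨R, hR1, hR⟩ := exists_abs_psdRatio_le hγ hQ hSph
  obtain ⟨A, hA0, hA⟩ := exists_abs_lorentz_sub_le hγ (δ / 2)
  obtain ⟨c, hc⟩ : ∃ r, r = s.gD ^ 2 * (s.Q / (2 * s.γ)) / s.Sph := ⟨_, rfl⟩
  have hc0 : 0 ≤ c := by rw [hc]; positivity
  refine ⟨R * (c * (A + A)), by positivity, fun ωc hωc h ω hω => ?_⟩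
  refine (hR _ h ω).2.trans ?_
  have e : phiBar s (centred ωc δ 0) ω - phiBar s (centred ωc δ 1) ω
      = c * ((lorentz s.γ (ω + ωc + δ / 2) - lorentz s.γ (ω + ωc - δ / 2))
        - (lorentz s.γ (ω - ωc + δ / 2) - lorentz s.γ (ω - ωc - δ / 2))) := by
    rw [phiBar_eq_lorentz, phiBar_eq_lorentz, centred_zero, centred_one, hc]
    have e1 : ω - (ωc + δ / 2) = ω - ωc - δ / 2 := by ring
    have e2 : ω - (ωc - δ / 2) = ω - ωc + δ / 2 := by ring
    have e3 : ω + (ωc + δ / 2) = ω + ωc + δ / 2 := by ring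
    have e4 : ω + (ωc - δ / 2) = ω + ωc - δ / 2 := by ring
    rw [e1, e2, e3, e4]
    ring
  -- For `ω > 0` the mirror peak at `-ωc` is farther away, so its contribution obeys the same bound.
  have h1 : |ω - ωc| ≤ |ω + ωc| := by
    rw [abs_of_pos (by positivity : 0 < ω + ωc), abs_le]
    constructor <;> linarith
  have h2 : (ω - ωc) ^ 2 ≤ (ω + ωc) ^ 2 := sq_le_sq.2 h1
  rw [e, abs_mul, abs_of_nonneg hc0, mul_assoc R, mul_assoc c, add_mul]
  gcongr
  refine (abs_sub _ _).trans (add_le_add ((hA _).trans ?_) (hA _))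
  gcongr

/-- Comparison of the filter response with its value at the central frequency. -/
lemma exists_abs_filter_sub_le (hb : 0 < b) :
    ∃ C : ℝ, 0 ≤ C ∧ ∀ ωc ω : ℝ, 1 ≤ ωc → 0 < ω →
      |b ^ 2 / (ω ^ 2 + b ^ 2) - b ^ 2 / ωc ^ 2| * ((1 + |ω - ωc|) * (1 + (ω - ωc) ^ 2))⁻¹
        ≤ C / ωc ^ 3 * ((1 + (ω - ωc) ^ 2)⁻¹ + (1 + ω ^ 2)⁻¹) ∧
      (b ^ 2 / (ω ^ 2 + b ^ 2) + b ^ 2 / ωc ^ 2) * ((1 + |ω - ωc|) * (1 + (ω - ωc) ^ 2))⁻¹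
        ≤ C / ωc ^ 2 := by
  refine ⟨b ^ 2 * (6 + 4 * b ^ 2) + 8 * (1 + 3 * b ^ 2), by positivity, fun ωc ω hωc hω => ?_⟩
  have hc : 0 < ωc := by linarith
  have hu := abs_nonneg (ω - ωc)
  have hp1 : 0 < (1 + (ω - ωc) ^ 2)⁻¹ := by positivity
  have hp2 : 0 < (1 + ω ^ 2)⁻¹ := by positivity
  have hb2 : 0 < b ^ 2 := by positivity
  -- For `ω ≥ ωc / 2` the filter deviates from its central value by at most a multiple of `(1 + |ω -
  -- ωc|) / ωc³`, and the linear factor is absorbed by the kernel. For `ω < ωc / 2` the kernel alone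
  -- is at most `8 / ωc³`, while the filter supplies `(1 + ω²)⁻¹`. The two summands of the constant
  -- belong to these cases.
  rcases le_or_gt (ωc / 2) ω with hle | hlt
  · have hk : ((1 + |ω - ωc|) * (1 + (ω - ωc) ^ 2))⁻¹ ≤ 1 :=
      inv_le_one_of_one_le₀ (one_le_mul_of_one_le_of_one_le (by linarith)
        (by linarith [sq_nonneg (ω - ωc)]))
    have hsq : ωc ^ 2 ≤ 4 * ω ^ 2 := by nlinarith
    constructor
    · have h1 : |b ^ 2 / (ω ^ 2 + b ^ 2) - b ^ 2 / ωc ^ 2|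
          ≤ b ^ 2 * (6 + 4 * b ^ 2) / ωc ^ 3 * (1 + |ω - ωc|) := by
        have e : b ^ 2 / (ω ^ 2 + b ^ 2) - b ^ 2 / ωc ^ 2
            = b ^ 2 * (-((ω - ωc) * (ω + ωc)) - b ^ 2) / ((ω ^ 2 + b ^ 2) * ωc ^ 2) := by
          rw [div_sub_div _ _ (by positivity) (by positivity)]
          ring
        rw [e, abs_div, abs_mul, abs_of_pos hb2,
          abs_of_pos (by positivity : 0 < (ω ^ 2 + b ^ 2) * ωc ^ 2), div_mul_eq_mul_div,
          div_le_div_iff₀ (by positivity) (by positivity)]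
        have h2 : |-((ω - ωc) * (ω + ωc)) - b ^ 2| ≤ |ω - ωc| * (3 * ω) + b ^ 2 := by
          refine (abs_sub _ _).trans ?_
          rw [abs_neg, abs_mul, abs_of_pos hb2, abs_of_pos (by positivity : 0 < ω + ωc)]
          gcongr
          linarith
        have h3 : (|ω - ωc| * (3 * ω) + b ^ 2) * ωc
            ≤ (6 + 4 * b ^ 2) * (1 + |ω - ωc|) * ω ^ 2 := by
          have h4 : ω * ωc ≤ 2 * ω ^ 2 := by nlinarith
          have h5 : ωc ≤ 4 * ω ^ 2 := by nlinarith
          have h6 : |ω - ωc| * (ω * ωc) ≤ |ω - ωc| * (2 * ω ^ 2) := by gcongr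
          have h7 : b ^ 2 * ωc ≤ b ^ 2 * (4 * ω ^ 2) := by gcongr
          have h8 : 0 ≤ b ^ 2 * |ω - ωc| * ω ^ 2 := by positivity
          nlinarith [sq_nonneg ω]
        calc b ^ 2 * |-((ω - ωc) * (ω + ωc)) - b ^ 2| * ωc ^ 3
            ≤ b ^ 2 * (|ω - ωc| * (3 * ω) + b ^ 2) * ωc ^ 3 := by gcongr
          _ = b ^ 2 * ((|ω - ωc| * (3 * ω) + b ^ 2) * ωc) * ωc ^ 2 := by ring
          _ ≤ b ^ 2 * ((6 + 4 * b ^ 2) * (1 + |ω - ωc|) * (ω ^ 2 + b ^ 2)) * ωc ^ 2 := by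
            gcongr _ * ?_ * _
            refine h3.trans ?_
            gcongr
            linarith
          _ = _ := by ring
      calc _ ≤ b ^ 2 * (6 + 4 * b ^ 2) / ωc ^ 3 * (1 + |ω - ωc|)
            * ((1 + |ω - ωc|) * (1 + (ω - ωc) ^ 2))⁻¹ := by gcongr
        _ = b ^ 2 * (6 + 4 * b ^ 2) / ωc ^ 3 * ((1 + (ω - ωc) ^ 2)⁻¹ + 0) := by
          have : 1 + |ω - ωc| ≠ 0 := by positivity
          rw [mul_inv, add_zero]
          field_simp
        _ ≤ _ := by
          gcongr
          have : 0 ≤ 8 * (1 + 3 * b ^ 2) := by positivity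
          linarith
    · have h1 : b ^ 2 / (ω ^ 2 + b ^ 2) ≤ 4 * b ^ 2 / ωc ^ 2 := by
        rw [div_le_div_iff₀ (by positivity) (by positivity)]
        nlinarith
      calc _ ≤ (4 * b ^ 2 / ωc ^ 2 + b ^ 2 / ωc ^ 2) * 1 := by gcongr
        _ = 5 * b ^ 2 / ωc ^ 2 := by ring
        _ ≤ _ := by
          gcongr
          nlinarith
  · have hk : ((1 + |ω - ωc|) * (1 + (ω - ωc) ^ 2))⁻¹ ≤ 8 / ωc ^ 3 := by
      rw [inv_eq_one_div, div_le_div_iff₀ (by positivity) (by positivity), one_mul]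
      have h1 : ωc / 2 ≤ |ω - ωc| := by
        rw [abs_of_neg (by linarith)]; linarith
      have h2 : (ωc / 2) ^ 2 ≤ (ω - ωc) ^ 2 := by
        rw [← sq_abs (ω - ωc)]
        gcongr
      calc ωc ^ 3 = 8 * ((ωc / 2) * (ωc / 2) ^ 2) := by ring
        _ ≤ 8 * ((1 + |ω - ωc|) * (1 + (ω - ωc) ^ 2)) := by
          gcongr <;> linarith
    have hw := filter_le hb ω
    have hw0 : 0 ≤ b ^ 2 / (ω ^ 2 + b ^ 2) := by positivity
    have hv0 : 0 ≤ b ^ 2 / ωc ^ 2 := by positivity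
    constructor
    · have h1 : b ^ 2 / ωc ^ 2 ≤ 2 * b ^ 2 * (1 + ω ^ 2)⁻¹ := by
        rw [← div_eq_mul_inv, div_le_div_iff₀ (by positivity) (by positivity)]
        have : 1 + ω ^ 2 ≤ 2 * ωc ^ 2 := by nlinarith
        nlinarith
      have h2 : |b ^ 2 / (ω ^ 2 + b ^ 2) - b ^ 2 / ωc ^ 2|
          ≤ (1 + 3 * b ^ 2) * (1 + ω ^ 2)⁻¹ := by
        rw [abs_le]
        constructor <;> nlinarith
      calc _ ≤ (1 + 3 * b ^ 2) * (1 + ω ^ 2)⁻¹ * (8 / ωc ^ 3) := by gcongr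
        _ = 8 * (1 + 3 * b ^ 2) / ωc ^ 3 * (0 + (1 + ω ^ 2)⁻¹) := by ring
        _ ≤ _ := by
          gcongr
          have : 0 ≤ b ^ 2 * (6 + 4 * b ^ 2) := by positivity
          linarith
    · have h1 : b ^ 2 / (ω ^ 2 + b ^ 2) ≤ 1 := by
        rw [div_le_one (by positivity)]; nlinarith [sq_nonneg ω]
      have h2 : b ^ 2 / ωc ^ 2 ≤ b ^ 2 := div_le_self hb2.le (one_le_pow₀ hωc)
      calc _ ≤ (1 + b ^ 2) * (8 / ωc ^ 3) := by gcongr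
        _ = 8 * (1 + b ^ 2) / ωc ^ 3 := by ring
        _ ≤ (b ^ 2 * (6 + 4 * b ^ 2) + 8 * (1 + 3 * b ^ 2)) / ωc ^ 3 := by
          gcongr
          nlinarith
        _ ≤ _ := by
          gcongr; norm_num

lemma setIntegral_peaks_le (ωc : ℝ) :
    IntegrableOn (fun ω : ℝ => (1 + (ω - ωc) ^ 2)⁻¹ + (1 + ω ^ 2)⁻¹) (Ioi 0) ∧
      ∫ ω in Ioi (0 : ℝ), ((1 + (ω - ωc) ^ 2)⁻¹ + (1 + ω ^ 2)⁻¹) ≤ 2 * Real.pi := by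
  have h1 := integrable_inv_one_add_sq.comp_sub_right ωc
  have h : Integrable fun ω : ℝ => (1 + (ω - ωc) ^ 2)⁻¹ + (1 + ω ^ 2)⁻¹ :=
    h1.add integrable_inv_one_add_sq
  refine ⟨h.integrableOn, (setIntegral_le_integral h (ae_of_all _ fun ω => ?_)).trans_eq ?_⟩
  · simp only [Pi.zero_apply]; positivity
  · rw [integral_add h1 integrable_inv_one_add_sq,
      integral_sub_right_eq_self (fun ω : ℝ => (1 + ω ^ 2)⁻¹), integral_univ_inv_one_add_sq]
    ring

lemma abs_setIntegral_sub_le {f g : ℝ → ℝ} {B ωc : ℝ} (hB : 0 ≤ B) (hf : IntegrableOn f (Ioi 0))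
    (hg : IntegrableOn g (Ioi 0))
    (h : ∀ ω, 0 < ω → |f ω - g ω| ≤ B * ((1 + (ω - ωc) ^ 2)⁻¹ + (1 + ω ^ 2)⁻¹)) :
    |(∫ ω in Ioi (0 : ℝ), f ω) - ∫ ω in Ioi (0 : ℝ), g ω| ≤ B * (2 * Real.pi) := by
  obtain ⟨h1, h2⟩ := setIntegral_peaks_le ωc
  rw [← integral_sub hf hg]
  refine (norm_integral_le_of_norm_le (f := fun ω => f ω - g ω) (h1.const_mul B)
    ((ae_restrict_iff' measurableSet_Ioi).2 (ae_of_all _ h))).trans ?_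
  rw [integral_const_mul]
  gcongr

/-- For a large central frequency the filter acts on the ratio of spectra as multiplication by
its value there. -/
lemma exists_integral_centred_bound (hγ : 0 < s.γ) (hQ : 0 < s.Q) (hSph : 0 < s.Sph) (hb : 0 < b)
    (δ : ℝ) :
    ∃ C : ℝ, 0 ≤ C ∧ ∀ ωc : ℝ, 1 ≤ ωc → ∀ h : Fin 2,
      |(∫ ω in Ioi (0 : ℝ), errorIntegrand s (centred ωc δ) b h 1 ω)
        - b ^ 2 / ωc ^ 2 * ∫ ω in Ioi (0 : ℝ), psdRatio s (centred ωc δ) h ω| ≤ C / ωc ^ 3 ∧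
      |(∫ ω in Ioi (0 : ℝ), errorIntegrand s (centred ωc δ) b h 2 ω)
        - b ^ 4 / ωc ^ 4 * ∫ ω in Ioi (0 : ℝ), psdRatio s (centred ωc δ) h ω ^ 2|
          ≤ C / ωc ^ 5 := by
  obtain ⟨A, hA0, hA⟩ := exists_psdRatio_centred_le hγ hQ hSph δ
  obtain ⟨C, hC0, hC⟩ := exists_abs_filter_sub_le hb
  refine ⟨A * C * (2 * Real.pi) + A ^ 2 * C ^ 2 * (2 * Real.pi),
    by have := Real.pi_pos; positivity, fun ωc hωc h => ?_⟩
  have hpi := Real.pi_pos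
  have hc : 0 < ωc := by linarith
  rw [← integral_const_mul, ← integral_const_mul]
  constructor
  · have h1 := abs_setIntegral_sub_le (B := A * C / ωc ^ 3) (ωc := ωc) (by positivity)
      (integrableOn_errorIntegrand hγ hQ hSph hb (centred ωc δ) h le_rfl)
      ((integrable_psdRatio hγ hQ hSph (centred ωc δ) h).const_mul (b ^ 2 / ωc ^ 2)).integrableOn
      (fun ω hω => by
        rw [errorIntegrand_eq, pow_one, ← sub_mul, abs_mul]
        calc _ ≤ |b ^ 2 / (ω ^ 2 + b ^ 2) - b ^ 2 / ωc ^ 2|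
              * (A * ((1 + |ω - ωc|) * (1 + (ω - ωc) ^ 2))⁻¹) := by
              gcongr; exact hA ωc hc h ω hω
          _ = A * (|b ^ 2 / (ω ^ 2 + b ^ 2) - b ^ 2 / ωc ^ 2|
              * ((1 + |ω - ωc|) * (1 + (ω - ωc) ^ 2))⁻¹) := by ring
          _ ≤ A * (C / ωc ^ 3 * ((1 + (ω - ωc) ^ 2)⁻¹ + (1 + ω ^ 2)⁻¹)) := by
              exact mul_le_mul_of_nonneg_left (hC ωc ω hωc hω).1 hA0
          _ = _ := by ring)
    refine h1.trans ?_
    rw [div_mul_eq_mul_div]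
    gcongr
    have : 0 ≤ A ^ 2 * C ^ 2 * (2 * Real.pi) := by positivity
    linarith
  · have h1 := abs_setIntegral_sub_le (B := A ^ 2 * C ^ 2 / ωc ^ 5) (ωc := ωc) (by positivity)
      (integrableOn_errorIntegrand hγ hQ hSph hb (centred ωc δ) h one_le_two)
      ((integrable_psdRatio_sq hγ hQ hSph (centred ωc δ) h).const_mul (b ^ 4 / ωc ^ 4)).integrableOn
      (fun ω hω => by
        set w := b ^ 2 / (ω ^ 2 + b ^ 2) with hw
        set v := b ^ 2 / ωc ^ 2 with hv
        set k := ((1 + |ω - ωc|) * (1 + (ω - ωc) ^ 2))⁻¹ with hk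
        set H := psdRatio s (centred ωc δ) h ω with hH
        have hw0 : 0 ≤ w := by positivity
        have hv0 : 0 ≤ v := by positivity
        have hk0 : 0 ≤ k := by positivity
        -- In the factorisation of `w² - v²`, the factor `w - v` yields `ωc⁻³` and an integrable
        -- peak, and `w + v` yields `ωc⁻²`; together they give `ωc⁻⁵`.
        have e : errorIntegrand s (centred ωc δ) b h 2 ω - b ^ 4 / ωc ^ 4 * H ^ 2
            = ((w - v) * H) * ((w + v) * H) := by
          rw [errorIntegrand_eq, ← hw, ← hH, hv]
          ring
        rw [e, abs_mul, abs_mul, abs_mul, abs_of_nonneg (add_nonneg hw0 hv0)]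
        have h2 : |H| ≤ A * k := hA ωc hc h ω hω
        obtain ⟨h3, h4⟩ := hC ωc ω hωc hω
        calc |w - v| * |H| * ((w + v) * |H|) ≤ |w - v| * (A * k) * ((w + v) * (A * k)) := by
              gcongr
          _ = A ^ 2 * ((|w - v| * k) * ((w + v) * k)) := by ring
          _ ≤ A ^ 2 * ((C / ωc ^ 3 * ((1 + (ω - ωc) ^ 2)⁻¹ + (1 + ω ^ 2)⁻¹)) * (C / ωc ^ 2)) := by
              gcongr
          _ = _ := by field_simp)
    refine h1.trans ?_
    rw [div_mul_eq_mul_div]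
    gcongr
    have : 0 ≤ A * C * (2 * Real.pi) := by positivity
    linarith

/-! ### The logarithmic term -/

/-- The half-line seen from two mirror peaks covers the whole line once. The value is therefore
independent of their position `σ`. -/
lemma setIntegral_even_translates {f : ℝ → ℝ} (hf : Integrable f) (heven : ∀ x, f (-x) = f x)
    (σ : ℝ) : ∫ ω in Ioi (0 : ℝ), (f (ω + σ) + f (ω - σ)) = ∫ x, f x := by
  rw [integral_add (hf.comp_add_right σ).integrableOn (hf.comp_sub_right σ).integrableOn]
  have h1 : ∫ ω in Ioi (0 : ℝ), f (ω + σ) = ∫ x in Ioi σ, f x := by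
    have := (measurePreserving_add_right volume σ).setIntegral_preimage_emb
      (measurableEmbedding_addRight σ) f (Ioi σ)
    simpa using this
  have h2 : ∫ ω in Ioi (0 : ℝ), f (ω - σ) = ∫ x in Ioi (-σ), f x := by
    have := (measurePreserving_add_right volume (-σ)).setIntegral_preimage_emb
      (measurableEmbedding_addRight (-σ)) f (Ioi (-σ))
    simpa [sub_eq_add_neg] using this
  have h3 : ∫ x in Ioi σ, f x = ∫ x in Iic (-σ), f x := by
    rw [← integral_comp_neg_Ioi]
    simp only [heven]
  rw [h1, h2, h3, ← compl_Iic, integral_add_compl measurableSet_Iic hf]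

/-- `(1 + x) (1 + y)` and `1 + x + y` differ by the interaction `x y` only. -/
lemma abs_log_mul_sub_log_le {x y : ℝ} (hx : 0 ≤ x) (hy : 0 ≤ y) :
    |Real.log (1 + x) + Real.log (1 + y) - Real.log (1 + (x + y))| ≤ x * y := by
  have hxy : 0 ≤ x * y := by positivity
  rw [← Real.log_mul (by positivity) (by positivity),
    ← Real.log_div (by positivity) (by positivity)]
  have e : (1 + x) * (1 + y) / (1 + (x + y)) = 1 + x * y / (1 + (x + y)) := by
    field_simp
    ring
  have h0 : 0 ≤ x * y / (1 + (x + y)) := by positivity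
  rw [e, abs_of_nonneg (Real.log_nonneg (by linarith))]
  refine (Real.log_le_sub_one_of_pos (by positivity)).trans ?_
  rw [add_sub_cancel_left]
  exact div_le_self hxy (by linarith)

lemma integrable_log_one_add {f : ℝ → ℝ} (hf : Integrable f) (hm : Measurable f)
    (h0 : ∀ x, 0 ≤ f x) : Integrable fun x => Real.log (1 + f x) := by
  refine Integrable.mono' hf (hm.const_add 1).log.aestronglyMeasurable (ae_of_all _ fun x => ?_)
  have := h0 x
  rw [Real.norm_eq_abs, abs_of_nonneg (Real.log_nonneg (by linarith))]
  have := Real.log_le_sub_one_of_pos (by positivity : 0 < 1 + f x)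
  linarith

lemma measurable_phiBar (s : Sensor) (ωL : ℝ) : Measurable (phiBar s ωL) := by
  unfold phiBar; fun_prop

/-- `I` is the full-line integral for a single isolated peak. The interaction with the mirror peak
is a product of two Lorentzians, and on `ω > 0` the mirror one is at most `γ / σ²`. -/
lemma exists_integral_log_phiBar_bound (hγ : 0 < s.γ) (hQ : 0 < s.Q) (hSph : 0 < s.Sph) :
    ∃ I B : ℝ, 0 ≤ B ∧ ∀ σ : ℝ, 0 < σ →
      |(∫ ω in Ioi (0 : ℝ), Real.log (1 + phiBar s σ ω)) - I| ≤ B / σ ^ 2 := by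
  obtain ⟨c, hc⟩ : ∃ r, r = s.gD ^ 2 * (s.Q / (2 * s.γ)) / s.Sph := ⟨_, rfl⟩
  have hc0 : 0 ≤ c := by rw [hc]; positivity
  have hpi := Real.pi_pos
  have hL := lorentz_nonneg hγ
  set f : ℝ → ℝ := fun y => Real.log (1 + c * lorentz s.γ y) with hf
  have hfi : Integrable f := integrable_log_one_add ((integrable_lorentz hγ).const_mul c)
    ((continuous_lorentz hγ).measurable.const_mul c) fun y => mul_nonneg hc0 (hL y)
  refine ⟨∫ y, f y, c ^ 2 * s.γ * Real.pi, by positivity, fun σ hσ => ?_⟩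
  have hs : Integrable fun ω => f (ω + σ) + f (ω - σ) :=
    (hfi.comp_add_right σ).add (hfi.comp_sub_right σ)
  rw [← setIntegral_even_translates hfi (fun y => by simp only [hf, lorentz_neg]) σ, abs_sub_comm,
    ← integral_sub hs.integrableOn
      (integrable_log_one_add (integrable_phiBar hγ σ) (measurable_phiBar s σ)
        (phiBar_nonneg hγ hQ hSph σ)).integrableOn]
  have hi : Integrable fun ω => c ^ 2 * (s.γ / σ ^ 2) * lorentz s.γ (ω - σ) :=
    ((integrable_lorentz hγ).comp_sub_right σ).const_mul _
  refine (norm_integral_le_of_norm_le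
    (f := fun ω => f (ω + σ) + f (ω - σ) - Real.log (1 + phiBar s σ ω)) hi.integrableOn
    ((ae_restrict_iff' measurableSet_Ioi).2 (ae_of_all _ fun ω hω => ?_))).trans
    ((setIntegral_le_integral hi (ae_of_all _ fun ω => ?_)).trans_eq ?_)
  · have hω : 0 < ω := hω
    rw [phiBar_eq_lorentz, ← hc, mul_add, Real.norm_eq_abs]
    refine (abs_log_mul_sub_log_le (mul_nonneg hc0 (hL _)) (mul_nonneg hc0 (hL _))).trans ?_
    have h1 : lorentz s.γ (ω + σ) ≤ s.γ / σ ^ 2 := by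
      rw [lorentz]
      gcongr
      nlinarith [sq_nonneg s.γ, mul_pos hω hσ]
    have h2 := hL (ω - σ)
    calc _ = c ^ 2 * lorentz s.γ (ω + σ) * lorentz s.γ (ω - σ) := by ring
      _ ≤ _ := by gcongr
  · have := hL (ω - σ)
    simp only [Pi.zero_apply]
    positivity
  · rw [integral_const_mul, integral_sub_right_eq_self (lorentz s.γ), integral_lorentz hγ]
    ring

/-- The isolated-peak value is common to both hypotheses and cancels. The interaction is even of
order `ωc⁻²`, but `ωc⁻¹` suffices, since the filter weight adds `ωc⁻²`. -/
lemma exists_integral_log_bound (hγ : 0 < s.γ) (hQ : 0 < s.Q) (hSph : 0 < s.Sph) (δ : ℝ) :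
    ∃ C : ℝ, 0 ≤ C ∧ ∀ ωc : ℝ, 1 ≤ ωc → |δ| ≤ ωc →
      |∫ ω in Ioi (0 : ℝ), Real.log (psd s (centred ωc δ 0) ω / psd s (centred ωc δ 1) ω)|
        ≤ C / ωc := by
  obtain ⟨I, B, hB0, hB⟩ := exists_integral_log_phiBar_bound hγ hQ hSph
  refine ⟨8 * B, by positivity, fun ωc hωc hδ => ?_⟩
  have hc : 0 < ωc := by linarith
  have hi : ∀ i, IntegrableOn (fun ω => Real.log (1 + phiBar s (centred ωc δ i) ω)) (Ioi 0) :=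
    fun i => (integrable_log_one_add (integrable_phiBar hγ _) (measurable_phiBar s _)
        (phiBar_nonneg hγ hQ hSph _)).integrableOn
  have e : ∀ ω, Real.log (psd s (centred ωc δ 0) ω / psd s (centred ωc δ 1) ω)
      = Real.log (1 + phiBar s (centred ωc δ 0) ω)
        - Real.log (1 + phiBar s (centred ωc δ 1) ω) := by
    intro ω
    have h0 := phiBar_nonneg hγ hQ hSph (centred ωc δ 0) ω
    have h1 := phiBar_nonneg hγ hQ hSph (centred ωc δ 1) ω
    rw [psd_eq hγ hSph, psd_eq hγ hSph, mul_div_mul_left _ _ hSph.ne',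
      Real.log_div (by positivity) (by positivity)]
  have hbd : ∀ i, |(∫ ω in Ioi (0 : ℝ), Real.log (1 + phiBar s (centred ωc δ i) ω)) - I|
      ≤ 4 * B / ωc := by
    intro i
    have h1 := half_le_centred hδ i
    have h2 : 0 < centred ωc δ i := by linarith
    refine (hB _ h2).trans ?_
    rw [div_le_div_iff₀ (by positivity) hc, mul_comm 4 B, mul_assoc]
    gcongr
    nlinarith
  simp_rw [e]
  rw [integral_sub (hi 0) (hi 1)]
  calc _ ≤ _ := abs_sub_le _ I _
    _ ≤ 4 * B / ωc + 4 * B / ωc := by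
      rw [abs_sub_comm I]
      exact add_le_add (hbd 0) (hbd 1)
    _ = _ := by ring

/-- Filtering against the moments of the frequency-domain log-likelihood ratio. -/
lemma exists_spectral_bound (hγ : 0 < s.γ) (hQ : 0 < s.Q) (hSph : 0 < s.Sph) (hb : 0 < b) (δ : ℝ) :
    ∃ C : ℝ, 0 ≤ C ∧ ∀ ωc : ℝ, 1 ≤ ωc → |δ| ≤ ωc → ∀ h : Fin 2,
      |(∫ ω in Ioi (0 : ℝ), errorIntegrand s (centred ωc δ) b h 1 ω)
        - b ^ 2 / ωc ^ 2 * ∫ ω in Ioi (0 : ℝ), spectralMean s (centred ωc δ) h ω| ≤ C / ωc ^ 3 ∧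
      |(∫ ω in Ioi (0 : ℝ), errorIntegrand s (centred ωc δ) b h 2 ω)
        - b ^ 4 / ωc ^ 4 * ∫ ω in Ioi (0 : ℝ), spectralVar s (centred ωc δ) h ω|
          ≤ C / ωc ^ 5 := by
  obtain ⟨C, hC0, hC⟩ := exists_integral_centred_bound hγ hQ hSph hb δ
  obtain ⟨B, hB0, hB⟩ := exists_integral_log_bound hγ hQ hSph δ
  refine ⟨C + b ^ 2 * B, by positivity, fun ωc hωc hδ h => ?_⟩
  have hc : 0 < ωc := by linarith
  obtain ⟨h1, h2⟩ := hC ωc hωc h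
  have h3 := hB ωc hωc hδ
  constructor
  · simp_rw [spectralMean_eq hγ hQ hSph]
    rw [integral_add (integrable_log_psd hγ hQ hSph _).integrableOn
      (integrable_psdRatio hγ hQ hSph _ h).integrableOn, mul_add, sub_add_eq_sub_sub_swap]
    refine (abs_sub _ _).trans ?_
    rw [abs_mul, abs_of_nonneg (by positivity : 0 ≤ b ^ 2 / ωc ^ 2)]
    calc _ ≤ C / ωc ^ 3 + b ^ 2 / ωc ^ 2 * (B / ωc) := by gcongr
      _ = _ := by field_simp
  · simp_rw [spectralVar_eq hγ hQ hSph]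
    refine h2.trans ?_
    gcongr
    have : 0 ≤ b ^ 2 * B := by positivity
    linarith

end

end SpinNoise

end

/-! ### Assembly of the three statements -/

theorem mainTheorem5 (s : SpinNoise.Sensor) (hγ : 0 < s.γ) (hQ : 0 < s.Q) (hSph : 0 < s.Sph)
    (b : ℝ) (hb : 0 < b) :
    -- the error is a quadratic form in the data; its cumulants are traces
    (∀ (ωL : Fin 2 → ℝ) (Δ : ℝ), 0 < Δ → ∀ (n : ℕ) (h : Fin 2),
      (∀ x : EuclideanSpace ℝ (Fin n), SpinNoise.filterError s ωL b Δ x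
        = 1 / 2 * (x.ofLp ⬝ᵥ (SpinNoise.errorMat s ωL b Δ n).mulVec x.ofLp)) ∧
      0 ∈ interior (ProbabilityTheory.integrableExpSet
        (SpinNoise.filterError s ωL b Δ (n := n)) (SpinNoise.signalLaw s (ωL h) Δ n)) ∧
      ∀ m : ℕ, 1 ≤ m →
        SpinNoise.cumulant m (SpinNoise.filterError s ωL b Δ (n := n))
            (SpinNoise.signalLaw s (ωL h) Δ n)
          = ((m - 1).factorial : ℝ) / 2
            * ((SpinNoise.errorMat s ωL b Δ n * SpinNoise.covMat s (ωL h) Δ n) ^ m).trace) ∧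
    -- asymptotics of the cumulants, with `t = n Δ`
    (∀ (ωL : Fin 2 → ℝ) (h : Fin 2) (m : ℕ), 1 ≤ m →
      MeasureTheory.IntegrableOn (SpinNoise.errorIntegrand s ωL b h m) (Set.Ioi 0) ∧
      ∀ Δ₀ : ℝ, 0 < Δ₀ → ∃ C : ℝ, ∀ Δ : ℝ, 0 < Δ → Δ ≤ Δ₀ → ∀ n : ℕ,
        |SpinNoise.cumulant m (SpinNoise.filterError s ωL b Δ (n := n))
              (SpinNoise.signalLaw s (ωL h) Δ n)
            - (n * Δ) * ((m - 1).factorial : ℝ) / (2 * Real.pi)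
              * ∫ ω in Set.Ioi (0 : ℝ), SpinNoise.errorIntegrand s ωL b h m ω|
          ≤ C * (1 + (n * Δ) * Δ)) ∧
    -- the moments of the frequency-domain log-likelihood ratio are well defined
    (∀ (ωL : Fin 2 → ℝ) (h : Fin 2),
      MeasureTheory.IntegrableOn (SpinNoise.spectralMean s ωL h) (Set.Ioi 0) ∧
      MeasureTheory.IntegrableOn (SpinNoise.spectralVar s ωL h) (Set.Ioi 0)) ∧
    -- mean and variance of the error for large central frequency
    (∀ (δ Δ₀ : ℝ), 0 < Δ₀ → ∃ C Ω : ℝ, 0 < Ω ∧ ∀ ωc : ℝ, Ω ≤ ωc →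
      ∃ K : ℝ, ∀ Δ : ℝ, 0 < Δ → Δ ≤ Δ₀ → ∀ (n : ℕ) (h : Fin 2),
        |(∫ x, SpinNoise.filterError s (SpinNoise.centred ωc δ) b Δ x
              ∂(SpinNoise.signalLaw s (SpinNoise.centred ωc δ h) Δ n))
            - b ^ 2 / ωc ^ 2 * SpinNoise.meanLS s (SpinNoise.centred ωc δ) h (n * Δ)|
          ≤ C * ((n * Δ) / ωc ^ 3 + 1) + K * ((n * Δ) * Δ) ∧
        |ProbabilityTheory.variance
              (SpinNoise.filterError s (SpinNoise.centred ωc δ) b Δ (n := n))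
              (SpinNoise.signalLaw s (SpinNoise.centred ωc δ h) Δ n)
            - b ^ 4 / ωc ^ 4 * SpinNoise.varLS s (SpinNoise.centred ωc δ) h (n * Δ)|
          ≤ C * ((n * Δ) / ωc ^ 5 + 1) + K * ((n * Δ) * Δ)) := by
  have hpi := Real.pi_pos
  refine ⟨fun ωL Δ hΔ n h => ⟨fun x => SpinNoise.filterError_eq hγ hQ hSph hΔ ωL b x,
      SpinNoise.cumulant_filterError hγ hQ hSph hΔ ωL b n h⟩,
    fun ωL h m hm => ⟨SpinNoise.integrableOn_errorIntegrand hγ hQ hSph hb ωL h hm,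
      fun Δ₀ hΔ₀ => ?_⟩,
    fun ωL h => ⟨(SpinNoise.integrable_spectralMean hγ hQ hSph ωL h).integrableOn,
      (SpinNoise.integrable_spectralVar hγ hQ hSph ωL h).integrableOn⟩,
    fun δ Δ₀ hΔ₀ => ?_⟩
  · obtain ⟨C, hC0, hC⟩ := SpinNoise.exists_cumulant_bound hγ hQ hSph hb hΔ₀ hm
    obtain ⟨K, hK0, hK⟩ := hC ωL
    -- The Larmor frequencies are fixed here, so the two constants may be merged.
    refine ⟨C + K, fun Δ hΔ hΔΔ₀ n => (hK Δ hΔ hΔΔ₀ n h).trans ?_⟩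
    have h1 : 0 ≤ C * (n * Δ * Δ) := by positivity
    linarith
  · obtain ⟨C₁, hC₁0, hC₁⟩ := SpinNoise.exists_cumulant_bound hγ hQ hSph hb hΔ₀ le_rfl
    obtain ⟨C₂, hC₂0, hC₂⟩ := SpinNoise.exists_cumulant_bound hγ hQ hSph hb hΔ₀ one_le_two
    obtain ⟨C₃, hC₃0, hC₃⟩ := SpinNoise.exists_spectral_bound hγ hQ hSph hb δ
    -- This threshold gives `ωc ≥ 1` and `|δ| ≤ ωc`, so both Larmor frequencies are at least `ωc /
    -- 2`.
    refine ⟨C₁ + C₂ + C₃, |δ| + 1, by positivity, fun ωc hωc => ?_⟩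
    have hδ := abs_nonneg δ
    have hc : 0 < ωc := by linarith
    obtain ⟨K₁, hK₁0, hK₁⟩ := hC₁ (SpinNoise.centred ωc δ)
    obtain ⟨K₂, hK₂0, hK₂⟩ := hC₂ (SpinNoise.centred ωc δ)
    refine ⟨K₁ + K₂, fun Δ hΔ hΔΔ₀ n h => ?_⟩
    obtain ⟨h1, h2⟩ := hC₃ ωc (by linarith) (by linarith) h
    have h3 := hK₁ Δ hΔ hΔΔ₀ n h
    have h4 := hK₂ Δ hΔ hΔΔ₀ n h
    rw [← SpinNoise.integral_filterError hγ hQ hSph hΔ] at h3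
    rw [← SpinNoise.variance_filterError hγ hQ hSph hΔ] at h4
    rw [Nat.sub_self, Nat.factorial_zero, Nat.cast_one, mul_one] at h3
    rw [show 2 - 1 = 1 from rfl, Nat.factorial_one, Nat.cast_one, mul_one] at h4
    -- Since `0! = 1! = 1`, mean and variance carry the same prefactor `t / (2 π)`, and one triangle
    -- inequality through the integral `I` serves both.
    have key : ∀ {E T I J w c p : ℝ}, 0 ≤ T → 0 < p → |E - T / (2 * Real.pi) * I| ≤ c →
        |I - w * J| ≤ C₃ / p → |E - w * (T / (2 * Real.pi) * J)| ≤ c + C₃ * (T / p) := by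
      intro E T I J w c p hT hp h5 h6
      have e : E - w * (T / (2 * Real.pi) * J)
          = (E - T / (2 * Real.pi) * I) + T / (2 * Real.pi) * (I - w * J) := by ring
      rw [e]
      refine (abs_add_le _ _).trans (add_le_add h5 ?_)
      rw [abs_mul, abs_of_nonneg (by positivity)]
      calc _ ≤ T * (C₃ / p) := by
            gcongr
            exact div_le_self hT (by linarith [Real.two_le_pi])
        _ = _ := by ring
    have hT : 0 ≤ n * Δ := by positivity
    have hTΔ : 0 ≤ n * Δ * Δ := by positivity
    refine ⟨(key hT (pow_pos hc 3) h3 h1).trans ?_, (key hT (pow_pos hc 5) h4 h2).trans ?_⟩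
    · have h5 : 0 ≤ (C₁ + C₂) * (n * Δ / ωc ^ 3) := by positivity
      have h6 : 0 ≤ K₂ * (n * Δ * Δ) := by positivity
      linarith
    · have h5 : 0 ≤ (C₁ + C₂) * (n * Δ / ωc ^ 5) := by positivity
      have h6 : 0 ≤ K₁ * (n * Δ * Δ) := by positivity
      linarith
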